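/- Let $T\ge 0$, $d\in\mathbb N$, let $(\Omega,\mathcal F,P)$ be a probability space with a filtration $\mathbb F=(\mathcal F_t)_{t\in[0,T]}$ satisfying the usual conditions (it is right-continuous and $\mathcal F_0$ contains every $P$-null set), and let $S=(S_t)_{t\in[0,T]}$ be an $\mathbb F$-adapted càdlàg $\mathbb R^d$-valued process. Assume that $S$ is sticky with respect to $\mathbb F$, i.e. for every $[0,T]$-valued $\mathbb F$-stopping time $\tau$ and every strictly positive $\mathcal F_\tau$-measurable random variable $\kappa$, $$P\Big(\sup_{u\in[\tau,T]}|S_u-S_\tau|<\kappa\,\Big|\,\mathcal F_\tau\Big)>0\quad\text{a.s.}$$ Let $g:[0,\infty)\to[0,\infty)$ be convex with $g(0)=0$, let $\varepsilon>0$, and define the stopping times $$\tau_0=0,\qquad \tau_{n+1}=\inf\{t>\tau_n:\ |S_t-S_{\tau_n}|\ge\varepsilon\}\wedge T .$$ Assume that for every $n\ge 0$, almost surely, $0$ belongs to the relative interior of the convex hull of the support of the conditional law $P(S_{\tau_{n+1}}-S_{\tau_n}\in\cdot\mid\mathcal F_{\tau_n})$. Then there exist a probability measure $Q\sim P$ and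 a càdlàg $\mathbb R^d$-valued $Q$-martingale $\tilde S$ with respect to $\mathbb F$ such that $\tilde S_0=S_0$ and $\tilde S_T=S_T$ a.s., and $$E_Q\, g\Big(\sup_{t\in[0,T]}|S_t-\tilde S_t|\Big)<g(2\varepsilon)+2\sqrt{\varepsilon},$$ where $g(2\delta)+2\sqrt{\delta}\to 0$ as $\delta\downarrow 0$. Moreover, if $S$ has continuous trajectories, then $\sup_{t\in[0,T]}|S_t-\tilde S_t|<2\varepsilon$ a.s.; and if all components of $S$ are strictly positive (respectively nonnegative), then a.s. so are all components of $\tilde S_t$, for all $t\in[0,T]$. -/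

import Mathlib

open MeasureTheory ProbabilityTheory Filter Topology Set

/-- The space `ℝ^d` with the Euclidean norm. -/
abbrev Euc (d : ℕ) : Type := EuclideanSpace ℝ (Fin d)

/-- The time interval `[0, T]`; for `0 ≤ T` it is a complete linear order with `⊥ = 0`, `⊤ = T`. -/
abbrev TimeInterval (T : ℝ) : Type := Set.Icc (0 : ℝ) T

/-- A path on `[0, T]` is càdlàg: right continuous with left limits at every time. At time `0`
the left limit condition is void, at time `T` the right continuity is void. -/
def IsCadlagPath {T : ℝ} {E : Type*} [TopologicalSpace E] (f : TimeInterval T → E) : Prop :=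
  ∀ t, ContinuousWithinAt f (Ici t) t ∧ ∃ l, Tendsto f (𝓝[<] t) (𝓝 l)

/-- The usual conditions: the filtration is right continuous, and its initial σ-algebra contains
all `P`-null sets. -/
structure UsualConditions {Ω : Type*} {mΩ : MeasurableSpace Ω} {T : ℝ} [Fact ((0 : ℝ) ≤ T)]
    (F : Filtration (TimeInterval T) mΩ) (P : Measure Ω) : Prop where
  rightContinuous : F.IsRightContinuous
  complete : ∀ N : Set Ω, P N = 0 → MeasurableSet[F ⊥] N

/-- The process `S` is sticky: for each `[0, T]`-valued stopping time `τ` and each strictly positive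
`F_τ`-measurable `κ`, one has `P(sup_{u ∈ [τ, T]} |S_u - S_τ| < κ | F_τ) > 0` almost surely.
(The supremum is over a bounded set whenever the path is càdlàg.) -/
def IsSticky {Ω : Type*} {mΩ : MeasurableSpace Ω} {T : ℝ} {d : ℕ} (P : Measure Ω)
    (F : Filtration (TimeInterval T) mΩ) (S : TimeInterval T → Ω → Euc d) : Prop :=
  ∀ (τ : Ω → TimeInterval T)
    (hτ : IsStoppingTime F (fun ω => (τ ω : WithTop (TimeInterval T)))) (κ : Ω → ℝ),
    Measurable[hτ.measurableSpace] κ → (∀ ω, 0 < κ ω) →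
    ∀ᵐ ω ∂P,
      0 < (P⟦{ω' | (⨆ u : Set.Ici (τ ω'), ‖S u ω' - S (τ ω') ω'‖) < κ ω'} |
        hτ.measurableSpace⟧) ω

/-- The times `τ_0 = 0`, `τ_{n+1} = inf {t > τ_n : |S_t - S_{τ_n}| ≥ ε} ∧ T`. The infimum is taken
in the complete lattice `[0, T]`, where the infimum of the empty set is `T`. -/
noncomputable def moveTime {Ω : Type*} {T : ℝ} [Fact ((0 : ℝ) ≤ T)] {d : ℕ}
    (S : TimeInterval T → Ω → Euc d) (ε : ℝ) : ℕ → Ω → TimeInterval T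
  | 0, _ => ⊥
  | n + 1, ω => sInf {t | moveTime S ε n ω < t ∧ ε ≤ ‖S t ω - S (moveTime S ε n ω) ω‖}

/-- The (regular) conditional law `P(Y ∈ · | m)` of `Y` given a sub-σ-algebra `m`: the conditional
distribution of `Y` given the identity map from `Ω` to `Ω` equipped with `m`. -/
noncomputable def condLaw {Ω : Type*} {mΩ : MeasurableSpace Ω} {d : ℕ} (P : Measure Ω)
    [IsFiniteMeasure P] (m : MeasurableSpace Ω) (Y : Ω → Euc d) (ω : Ω) : Measure (Euc d) :=
  @condDistrib Ω Ω (Euc d) _ _ _ mΩ m Y id P _ ω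

/-- The relative interior of the convex hull of the support of `μ`. -/
def relintHullSupport {d : ℕ} (μ : Measure (Euc d)) : Set (Euc d) :=
  intrinsicInterior ℝ (convexHull ℝ μ.support)

/-!
The measure `Q` is built so that the process sampled at its move times `τ n` becomes a martingale
closed by `S_T`, and `S'` is a càdlàg version of `E_Q[S_T | F_t]`.

*One step.* Let `Y` be an increment `S_{τ (n+1)} - S_{τ n}`. Stickiness gives the event that `Y` is
small and `τ (n+1) = T` positive conditional probability. Start from a weight that puts nearly all
its mass on this event, and multiply it by the slope of a convex function of linear growth at
`⟪θ, Y⟫`, where `θ` minimizes the corresponding convex potential: the first order condition says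
that `Y` is centred under the new weight. The minimizer exists because `0` lies in the relative
interior of the convex hull of the support of the conditional law, so that no nonzero functional on
the span of the support is almost surely nonpositive. The minimizers stay bounded as the weight
concentrates, so the tilted weight still gives very little mass to the complement of the event.
Selecting approximate minimizers measurably over the conditional law yields `exists_step_density`.

*All steps.* The move times reach `T` after finitely many steps, hence the product of the step
densities converges, and the estimates per step show that no mass is lost
(`exists_equivalent_martingale_measure`). Irregular steps, which are large or do not end at `T`, are
so rare under `Q` that a single small `R ∈ L²` dominates all of them; in particular `S_T ∈ L²`
(`exists_isMoveMartingale`).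

*The martingale.* That the closed martingale has a càdlàg version is proved by counting
oscillations along dyadic grids (`exists_cadlag_martingale`).

*The distance.* For `τ n ≤ t < τ (n+1)`, `S'_t - S_t` is the conditional expectation given `F_t` of
`S_{τ (n+1)} - S_t` (`IsMoveMartingale.condExp_indicator_sub`), so by Jensen
`g ‖S_t - S'_t‖ ≤ g (2ε) + E[R | F_t]`, and a maximal inequality bounds the expected supremum
(`IsMoveMartingale.integral_gauge_lt`). For continuous paths the sampled increments have norm at
most `ε`, which bounds the distance by `2ε`; the bound is strict because a distance close to `2ε`
forces a small conditional variance of the next sampled value, hence this value close to `S'_t`,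
whereas `S_t` is then about to come near it (`IsMoveMartingale.ae_iSup_lt`). A càdlàg
martingale with positive terminal value stays positive
(`ae_forall_pos_of_terminal_pos`).
-/

set_option linter.unusedSectionVars false

/-! ### A convex potential and its minimizers -/

/-- The convex, increasing, Lipschitz function `x + √(1 + x²)`, whose slope takes values in
`(0, 2)`. -/
noncomputable def softPlus (x : ℝ) : ℝ := x + √(1 + x ^ 2)

/-- The derivative of `softPlus`. -/
noncomputable def softSlope (x : ℝ) : ℝ := 1 + x / √(1 + x ^ 2)

theorem sqrt_one_add_sq_pos (x : ℝ) : 0 < √(1 + x ^ 2) := by positivity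

theorem abs_lt_sqrt_one_add_sq (x : ℝ) : |x| < √(1 + x ^ 2) := by
  rw [← Real.sqrt_sq_eq_abs]
  exact Real.sqrt_lt_sqrt (sq_nonneg x) (by linarith)

theorem softSlope_pos (x : ℝ) : 0 < softSlope x := by
  have h := abs_lt_sqrt_one_add_sq x
  have h1 := sqrt_one_add_sq_pos x
  have : -1 < x / √(1 + x ^ 2) := by
    rw [lt_div_iff₀ h1]; linarith [neg_abs_le x]
  unfold softSlope; linarith

theorem softSlope_lt_two (x : ℝ) : softSlope x < 2 := by
  have h := abs_lt_sqrt_one_add_sq x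
  have h1 := sqrt_one_add_sq_pos x
  have : x / √(1 + x ^ 2) < 1 := by
    rw [div_lt_iff₀ h1]; linarith [le_abs_self x]
  unfold softSlope; linarith

theorem hasDerivAt_softPlus (x : ℝ) : HasDerivAt softPlus (softSlope x) x := by
  have h1 := sqrt_one_add_sq_pos x
  have h : HasDerivAt (fun x : ℝ => 1 + x ^ 2) (2 * x) x := by
    simpa using ((hasDerivAt_id x).pow 2).const_add 1
  refine ((hasDerivAt_id x).add (h.sqrt (by positivity))).congr_deriv ?_
  unfold softSlope
  field_simp

theorem continuous_softSlope : Continuous softSlope := by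
  unfold softSlope
  exact continuous_const.add (continuous_id.div (by fun_prop) fun x => (sqrt_one_add_sq_pos x).ne')

theorem continuous_softPlus : Continuous softPlus := by
  unfold softPlus; fun_prop

theorem softSlope_strictMono : StrictMono softSlope := by
  have hd : ∀ x, HasDerivAt softSlope (1 / (√(1 + x ^ 2)) ^ 3) x := by
    intro x
    have h1 := sqrt_one_add_sq_pos x
    have hs : √(1 + x ^ 2) ^ 2 = 1 + x ^ 2 := Real.sq_sqrt (by positivity)
    have h : HasDerivAt (fun x : ℝ => 1 + x ^ 2) (2 * x) x := by
      simpa using ((hasDerivAt_id x).pow 2).const_add 1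
    refine (((hasDerivAt_id x).div (h.sqrt (by positivity)) h1.ne').const_add 1).congr_deriv ?_
    simp only [id]
    rw [div_eq_div_iff (by positivity) (by positivity)]
    field_simp
    rw [hs]; ring
  apply strictMono_of_deriv_pos
  intro x
  rw [(hd x).deriv]
  have := sqrt_one_add_sq_pos x
  positivity

theorem softSlope_neg_one : (1 / 4 : ℝ) ≤ softSlope (-1) := by
  unfold softSlope
  have h1 : (4 / 3 : ℝ) ≤ √(1 + (-1) ^ 2) := by
    apply Real.le_sqrt_of_sq_le; norm_num
  have : (1 : ℝ) / √(1 + (-1) ^ 2) ≤ 3 / 4 := by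
    rw [div_le_iff₀ (by positivity)]; linarith
  rw [neg_div]; linarith

theorem softPlus_pos (x : ℝ) : 0 < softPlus x := by
  unfold softPlus; linarith [abs_lt_sqrt_one_add_sq x, neg_abs_le x]

theorem max_le_softPlus (x : ℝ) : max x 0 ≤ softPlus x := by
  refine max_le ?_ (softPlus_pos x).le
  unfold softPlus; linarith [sqrt_one_add_sq_pos x]

theorem softPlus_zero : softPlus 0 = 1 := by simp [softPlus]

theorem abs_softPlus_sub_le (x y : ℝ) : |softPlus x - softPlus y| ≤ 2 * |x - y| := by
  have := Convex.norm_image_sub_le_of_norm_hasDerivWithin_le (f := softPlus) (f' := softSlope)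
    (s := univ) (C := 2) (x := y) (y := x) (fun z _ => (hasDerivAt_softPlus z).hasDerivWithinAt)
    (fun z _ => by
      rw [Real.norm_eq_abs, abs_of_pos (softSlope_pos z)]; exact (softSlope_lt_two z).le)
    convex_univ (mem_univ _) (mem_univ _)
  simpa using this

section Minimizer

variable {α E : Type*} [MeasurableSpace α] [NormedAddCommGroup E] [InnerProductSpace ℝ E]
  [FiniteDimensional ℝ E] [MeasurableSpace E] [BorelSpace E]

/-- The convex potential `θ ↦ ∫ w softPlus ⟪θ, y⟫ dρ`; at a minimizer the slope
`w softSlope ⟪θ, y⟫` is an unnormalised density under which `y` has mean zero. -/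
noncomputable def potential (ρ : Measure α) (w : α → ℝ) (y : α → E) (θ : E) : ℝ :=
  ∫ x, w x * softPlus (inner ℝ θ (y x)) ∂ρ

variable {ρ : Measure α} {w : α → ℝ} {y : α → E}

theorem integrable_mul_softPlus (hw : Integrable w ρ) (hwy : Integrable (fun x => w x * ‖y x‖) ρ)
    (hy : Measurable y) (θ : E) :
    Integrable (fun x => w x * softPlus (inner ℝ θ (y x))) ρ := by
  refine Integrable.mono' (hw.norm.add (hwy.norm.const_mul (2 * ‖θ‖))) ?_ ?_
  · exact hw.aestronglyMeasurable.mul (continuous_softPlus.measurable.comp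
      (by fun_prop)).aestronglyMeasurable
  · refine ae_of_all _ fun x => ?_
    have h1 := abs_softPlus_sub_le (inner ℝ θ (y x)) 0
    have h2 := abs_real_inner_le_norm θ (y x)
    rw [softPlus_zero, sub_zero] at h1
    have h3 : |softPlus (inner ℝ θ (y x))| ≤ 1 + 2 * ‖θ‖ * ‖y x‖ := by
      have := abs_sub_abs_le_abs_sub (softPlus (inner ℝ θ (y x))) 1
      rw [abs_one] at this
      nlinarith
    simp only [norm_mul, Real.norm_eq_abs, Pi.add_apply, abs_norm]
    calc |w x| * |softPlus (inner ℝ θ (y x))| ≤ |w x| * (1 + 2 * ‖θ‖ * ‖y x‖) := by gcongr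
      _ = _ := by ring

theorem continuous_potential (hw : Integrable w ρ) (hwy : Integrable (fun x => w x * ‖y x‖) ρ)
    (hy : Measurable y) : Continuous (potential ρ w y) := by
  refine (LipschitzWith.of_dist_le_mul (K := (2 * ∫ x, ‖w x * ‖y x‖‖ ∂ρ).toNNReal)
    fun θ θ' => ?_).continuous
  rw [Real.coe_toNNReal _ (by positivity), Real.dist_eq, dist_eq_norm, ← Real.norm_eq_abs]
  unfold potential
  rw [← integral_sub (integrable_mul_softPlus hw hwy hy θ) (integrable_mul_softPlus hw hwy hy θ')]
  rw [mul_assoc, ← integral_mul_const, ← integral_const_mul]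
  refine norm_integral_le_of_norm_le ((hwy.norm.mul_const _).const_mul _) (ae_of_all _ fun x => ?_)
  rw [← mul_sub, norm_mul, norm_mul, norm_norm]
  have h1 := abs_softPlus_sub_le (inner ℝ θ (y x)) (inner ℝ θ' (y x))
  have h2 := abs_real_inner_le_norm (θ - θ') (y x)
  rw [inner_sub_left] at h2
  calc ‖w x‖ * ‖softPlus (inner ℝ θ (y x)) - softPlus (inner ℝ θ' (y x))‖
      ≤ ‖w x‖ * (2 * (‖θ - θ'‖ * ‖y x‖)) := by
        gcongr; rw [Real.norm_eq_abs]; linarith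
    _ = _ := by ring

theorem integrable_mul_softSlope (hw : Integrable w ρ) (hy : Measurable y) (θ : E) :
    Integrable (fun x => w x * softSlope (inner ℝ θ (y x))) ρ := by
  refine Integrable.mono' (hw.norm.mul_const 2) ?_ (ae_of_all _ fun x => ?_)
  · exact hw.aestronglyMeasurable.mul (continuous_softSlope.measurable.comp
      (by fun_prop)).aestronglyMeasurable
  · rw [norm_mul]
    gcongr
    rw [Real.norm_eq_abs, abs_of_pos (softSlope_pos _)]; exact (softSlope_lt_two _).le

theorem integrable_mul_softSlope_smul (hw : Integrable w ρ)
    (hwy : Integrable (fun x => w x * ‖y x‖) ρ) (hy : Measurable y) (θ : E) :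
    Integrable (fun x => (w x * softSlope (inner ℝ θ (y x))) • y x) ρ := by
  refine Integrable.mono' (hwy.norm.mul_const 2) ?_ (ae_of_all _ fun x => ?_)
  · exact (integrable_mul_softSlope hw hy θ).aestronglyMeasurable.smul hy.aestronglyMeasurable
  · rw [norm_smul, norm_mul, norm_mul, norm_norm]
    have : ‖softSlope (inner ℝ θ (y x))‖ ≤ 2 := by
      rw [Real.norm_eq_abs, abs_of_pos (softSlope_pos _)]; exact (softSlope_lt_two _).le
    calc ‖w x‖ * ‖softSlope (inner ℝ θ (y x))‖ * ‖y x‖ ≤ ‖w x‖ * 2 * ‖y x‖ := by gcongr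
      _ = _ := by ring

/-- First order condition at a minimizer of the potential. -/
theorem integral_softSlope_smul_eq_zero (hw : Integrable w ρ)
    (hwy : Integrable (fun x => w x * ‖y x‖) ρ) (hy : Measurable y) {θ : E}
    (hmin : ∀ θ', potential ρ w y θ ≤ potential ρ w y θ') :
    ∫ x, (w x * softSlope (inner ℝ θ (y x))) • y x ∂ρ = 0 := by
  refine ext_inner_left ℝ fun v => ?_
  rw [inner_zero_right, ← integral_inner (integrable_mul_softSlope_smul hw hwy hy θ)]
  have hd : HasDerivAt (fun s : ℝ => potential ρ w y (θ + s • v))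
      (∫ x, w x * (softSlope (inner ℝ (θ + (0 : ℝ) • v) (y x)) * inner ℝ v (y x)) ∂ρ) 0 := by
    refine (hasDerivAt_integral_of_dominated_loc_of_deriv_le
      (F := fun s x => w x * softPlus (inner ℝ (θ + s • v) (y x)))
      (F' := fun s x => w x * (softSlope (inner ℝ (θ + s • v) (y x)) * inner ℝ v (y x)))
      (bound := fun x => ‖w x * ‖y x‖‖ * (2 * ‖v‖)) (s := univ) univ_mem ?_ ?_ ?_ ?_ ?_ ?_).2
    · exact Eventually.of_forall fun s => (integrable_mul_softPlus hw hwy hy _).aestronglyMeasurable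
    · exact integrable_mul_softPlus hw hwy hy _
    · exact hw.aestronglyMeasurable.mul ((continuous_softSlope.measurable.comp
        (by fun_prop)).aestronglyMeasurable.mul (by fun_prop))
    · refine ae_of_all _ fun x s _ => ?_
      rw [norm_mul, norm_mul, norm_mul, norm_norm]
      have h1 : ‖softSlope (inner ℝ (θ + s • v) (y x))‖ ≤ 2 := by
        rw [Real.norm_eq_abs, abs_of_pos (softSlope_pos _)]; exact (softSlope_lt_two _).le
      have h2 := norm_inner_le_norm (𝕜 := ℝ) v (y x)
      calc ‖w x‖ * (‖softSlope (inner ℝ (θ + s • v) (y x))‖ * ‖inner ℝ v (y x)‖)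
          ≤ ‖w x‖ * (2 * (‖v‖ * ‖y x‖)) := by gcongr
        _ = _ := by ring
    · exact hwy.norm.mul_const _
    · refine ae_of_all _ fun x s _ => ?_
      refine HasDerivAt.const_mul _ ?_
      refine (hasDerivAt_softPlus _).comp s ?_
      have : (fun s : ℝ => inner ℝ (θ + s • v) (y x)) =
          fun s => inner ℝ θ (y x) + s * inner ℝ v (y x) := by
        ext s; rw [inner_add_left, real_inner_smul_left]
      rw [this]
      simpa using ((hasDerivAt_id s).mul_const (inner ℝ v (y x))).const_add (inner ℝ θ (y x))
  have h0 := IsLocalMin.hasDerivAt_eq_zero (f := fun s : ℝ => potential ρ w y (θ + s • v))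
    (a := 0) (Eventually.of_forall fun s => by simpa using hmin (θ + s • v)) hd
  rw [← h0]
  refine integral_congr_ae (ae_of_all _ fun x => ?_)
  simp only [zero_smul, add_zero, real_inner_smul_right]
  ring

/-- The potential depends only on the component of `θ` in a subspace carrying `y`; orthogonal
to it there is no coercivity and no uniqueness of minimizers. -/
theorem potential_starProjection {V : Submodule ℝ E} (hV : ∀ᵐ x ∂ρ, y x ∈ V) (θ : E) :
    potential ρ w y (V.starProjection θ) = potential ρ w y θ := by
  refine integral_congr_ae ?_
  filter_upwards [hV] with x hx
  rw [V.inner_starProjection_left_eq_right, V.starProjection_eq_self_iff.2 hx]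

/-- A potential that grows linearly on a subspace carrying `y` has a minimizer. -/
theorem exists_potential_minimizer {V : Submodule ℝ E} (hV : ∀ᵐ x ∂ρ, y x ∈ V)
    (hw : Integrable w ρ) (hwy : Integrable (fun x => w x * ‖y x‖) ρ) (hy : Measurable y)
    {c : ℝ} (hc : 0 < c) (hcoer : ∀ θ ∈ V, c * ‖θ‖ ≤ potential ρ w y θ) :
    ∃ θ ∈ V, ∀ θ', potential ρ w y θ ≤ potential ρ w y θ' := by
  have hcont : Continuous (fun θ : V => potential ρ w y θ) :=
    (continuous_potential hw hwy hy).comp continuous_subtype_val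
  have hlim : Tendsto (fun θ : V => potential ρ w y θ) (cocompact V) atTop := by
    refine tendsto_atTop_mono (fun θ : V => hcoer θ θ.2) ?_
    exact Tendsto.const_mul_atTop hc (tendsto_norm_cocompact_atTop)
  obtain ⟨θ, hθ⟩ := hcont.exists_forall_le hlim
  refine ⟨θ, θ.2, fun θ' => ?_⟩
  rw [← potential_starProjection hV θ']
  exact hθ ⟨V.starProjection θ', V.starProjection_apply_mem θ'⟩

/-- Minimizers inside the subspace are unique. -/
theorem potential_minimizer_unique {V : Submodule ℝ E}
    (hw : Integrable w ρ) (hwy : Integrable (fun x => w x * ‖y x‖) ρ) (hy : Measurable y)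
    (hwpos : ∀ᵐ x ∂ρ, 0 < w x)
    {c : ℝ} (hc : 0 < c) (hcoer : ∀ θ ∈ V, c * ‖θ‖ ≤ potential ρ w y θ) {θ₁ θ₂ : E}
    (h₁V : θ₁ ∈ V) (h₂V : θ₂ ∈ V)
    (h₁ : ∀ θ', potential ρ w y θ₁ ≤ potential ρ w y θ')
    (h₂ : ∀ θ', potential ρ w y θ₂ ≤ potential ρ w y θ') : θ₁ = θ₂ := by
  have e₁ := integral_softSlope_smul_eq_zero hw hwy hy h₁
  have e₂ := integral_softSlope_smul_eq_zero hw hwy hy h₂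
  have i₁ := integrable_mul_softSlope_smul hw hwy hy θ₁
  have i₂ := integrable_mul_softSlope_smul hw hwy hy θ₂
  have e : ∫ x, w x * ((softSlope (inner ℝ θ₁ (y x)) - softSlope (inner ℝ θ₂ (y x))) *
      (inner ℝ θ₁ (y x) - inner ℝ θ₂ (y x))) ∂ρ = 0 := by
    have := integral_inner (𝕜 := ℝ) (i₁.sub i₂) (θ₁ - θ₂)
    simp only [Pi.sub_apply] at this
    rw [integral_sub i₁ i₂, e₁, e₂, sub_zero, inner_zero_right] at this
    rw [← this]
    refine integral_congr_ae (ae_of_all _ fun x => ?_)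
    simp only [inner_sub_left, inner_sub_right, real_inner_smul_right]
    ring
  have hnn : ∀ a b : ℝ, 0 ≤ (softSlope a - softSlope b) * (a - b) := by
    intro a b
    rcases le_total a b with h | h
    · exact mul_nonneg_of_nonpos_of_nonpos (sub_nonpos.2 (softSlope_strictMono.monotone h))
        (sub_nonpos.2 h)
    · exact mul_nonneg (sub_nonneg.2 (softSlope_strictMono.monotone h)) (sub_nonneg.2 h)
  have hint : Integrable (fun x => w x * ((softSlope (inner ℝ θ₁ (y x)) -
      softSlope (inner ℝ θ₂ (y x))) * (inner ℝ θ₁ (y x) - inner ℝ θ₂ (y x)))) ρ := by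
    refine (Integrable.const_inner (𝕜 := ℝ) (θ₁ - θ₂) (i₁.sub i₂)).congr (ae_of_all _ fun x => ?_)
    simp only [Pi.sub_apply, inner_sub_left, inner_sub_right, real_inner_smul_right]
    ring
  rw [integral_eq_zero_iff_of_nonneg_ae
    (by filter_upwards [hwpos] with x hx using mul_nonneg hx.le (hnn _ _)) hint] at e
  have hz : ∀ᵐ x ∂ρ, inner ℝ (θ₁ - θ₂) (y x) = 0 := by
    filter_upwards [e, hwpos] with x hx hx'
    rw [inner_sub_left]
    have hx1 := (mul_eq_zero.1 hx).resolve_left hx'.ne'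
    rcases mul_eq_zero.1 hx1 with h | h
    · rw [softSlope_strictMono.injective (sub_eq_zero.1 h), sub_self]
    · exact h
  -- otherwise the potential is constant along the direction `θ₁ - θ₂`, against its linear growth
  by_contra hne
  have hpos : 0 < ‖θ₁ - θ₂‖ := norm_pos_iff.2 (sub_ne_zero.2 hne)
  have hconst : ∀ t : ℝ, potential ρ w y (t • (θ₁ - θ₂)) = potential ρ w y 0 := by
    intro t
    refine integral_congr_ae ?_
    filter_upwards [hz] with x hx
    rw [real_inner_smul_left, hx]; simp
  set p := potential ρ w y 0
  have h0 : 0 ≤ p := by simpa using hcoer 0 V.zero_mem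
  have := hcoer (((p + 1) / (c * ‖θ₁ - θ₂‖)) • (θ₁ - θ₂)) (V.smul_mem _ (V.sub_mem h₁V h₂V))
  rw [hconst, norm_smul, Real.norm_eq_abs, abs_of_pos (by positivity)] at this
  have h3 : c * ((p + 1) / (c * ‖θ₁ - θ₂‖) * ‖θ₁ - θ₂‖) = p + 1 := by field_simp
  linarith

/-- Along a minimizing sequence, the functionals `⟪θ k, ·⟫` converge on the subspace carrying
`y`, although the `θ k` themselves need not converge. -/
theorem tendsto_inner_of_minimizing {V : Submodule ℝ E} (hV : ∀ᵐ x ∂ρ, y x ∈ V)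
    (hw : Integrable w ρ) (hwy : Integrable (fun x => w x * ‖y x‖) ρ) (hy : Measurable y)
    (hwpos : ∀ᵐ x ∂ρ, 0 < w x)
    {c : ℝ} (hc : 0 < c) (hcoer : ∀ θ ∈ V, c * ‖θ‖ ≤ potential ρ w y θ) {θ : E} (hθV : θ ∈ V)
    (hθ : ∀ θ', potential ρ w y θ ≤ potential ρ w y θ') {u : ℕ → E}
    (hu : Tendsto (fun k => potential ρ w y (u k)) atTop (𝓝 (potential ρ w y θ))) {z : E}
    (hz : z ∈ V) : Tendsto (fun k => inner ℝ (u k) z) atTop (𝓝 (inner ℝ θ z)) := by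
  have hproj : Tendsto (fun k => V.starProjection (u k)) atTop (𝓝 θ) := by
    obtain ⟨K, hK⟩ := hu.bddAbove_range
    -- coercivity confines the projections to a compact ball, and every cluster point is `θ`
    refine tendsto_of_subseq_tendsto fun ns hns => ?_
    have hb : ∀ k, V.starProjection (u (ns k)) ∈ Metric.closedBall (0 : E) (K / c) := by
      intro k
      rw [mem_closedBall_zero_iff, le_div_iff₀ hc, mul_comm]
      refine (hcoer _ (V.starProjection_apply_mem _)).trans ?_
      rw [potential_starProjection hV]
      exact hK ⟨ns k, rfl⟩
    obtain ⟨a, -, φ, hφ, ha⟩ := (isCompact_closedBall (0 : E) (K / c)).tendsto_subseq hb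
    refine ⟨φ, ?_⟩
    have haV : a ∈ V := (Submodule.closed_of_finiteDimensional V).mem_of_tendsto ha
      (Eventually.of_forall fun k => V.starProjection_apply_mem _)
    have hval : potential ρ w y a = potential ρ w y θ := by
      refine tendsto_nhds_unique (((continuous_potential hw hwy hy).tendsto a).comp ha) ?_
      have := hu.comp (hns.comp hφ.tendsto_atTop)
      refine this.congr fun k => ?_
      simp only [Function.comp_apply]
      rw [potential_starProjection hV]
    have : a = θ := potential_minimizer_unique hw hwy hy hwpos hc hcoer haV hθV
      (fun θ' => hval ▸ hθ θ') hθ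
    rw [← this]; exact ha
  have h2 : Tendsto (fun k => inner ℝ (V.starProjection (u k)) z) atTop (𝓝 (inner ℝ θ z)) :=
    hproj.inner tendsto_const_nhds
  refine h2.congr fun k => ?_
  rw [V.inner_starProjection_left_eq_right, V.starProjection_eq_self_iff.2 hz]

/-- If no nonzero functional on `V` is almost surely nonpositive on `y`, then the mean positive
part grows at least linearly in the functional. -/
theorem exists_coercive_const {V : Submodule ℝ E}
    (hw : Integrable w ρ) (hwy : Integrable (fun x => w x * ‖y x‖) ρ) (hy : Measurable y)
    (hwpos : ∀ x, 0 < w x)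
    (hnd : ∀ θ ∈ V, θ ≠ 0 → 0 < ρ {x | 0 < inner ℝ θ (y x)}) :
    ∃ c, 0 < c ∧ ∀ θ ∈ V, c * ‖θ‖ ≤ ∫ x, w x * max (inner ℝ θ (y x)) 0 ∂ρ := by
  have hint : ∀ θ : E, Integrable (fun x => w x * max (inner ℝ θ (y x)) 0) ρ := by
    intro θ
    refine Integrable.mono' (hwy.norm.mul_const ‖θ‖) ?_ (ae_of_all _ fun x => ?_)
    · exact hw.aestronglyMeasurable.mul (Measurable.aestronglyMeasurable (by fun_prop))
    · rw [norm_mul, norm_mul, norm_norm, Real.norm_eq_abs (max _ _), abs_of_nonneg (le_max_right _ _)]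
      have := abs_real_inner_le_norm θ (y x)
      calc ‖w x‖ * max (inner ℝ θ (y x)) 0 ≤ ‖w x‖ * (‖θ‖ * ‖y x‖) := by
            gcongr
            exact max_le ((le_abs_self _).trans this) (by positivity)
        _ = _ := by ring
  set h : E → ℝ := fun θ => ∫ x, w x * max (inner ℝ θ (y x)) 0 ∂ρ with hh
  have hcont : Continuous h := by
    refine (LipschitzWith.of_dist_le_mul (K := (∫ x, ‖w x * ‖y x‖‖ ∂ρ).toNNReal)
      fun θ θ' => ?_).continuous
    rw [Real.coe_toNNReal _ (by positivity), Real.dist_eq, dist_eq_norm, hh,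
      ← Real.norm_eq_abs]
    simp only
    rw [← integral_sub (hint θ) (hint θ'), ← integral_mul_const]
    refine norm_integral_le_of_norm_le (hwy.norm.mul_const _) (ae_of_all _ fun x => ?_)
    rw [← mul_sub, norm_mul, norm_mul, norm_norm, mul_assoc]
    gcongr
    refine (abs_max_sub_max_le_abs _ _ _).trans ?_
    rw [← inner_sub_left, mul_comm]
    exact abs_real_inner_le_norm _ _
  have hpos : ∀ θ ∈ V, θ ≠ 0 → 0 < h θ := by
    intro θ hθ hne
    rw [hh]
    refine (integral_pos_iff_support_of_nonneg (fun x => mul_nonneg (hwpos x).le (le_max_right _ _))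
      (hint θ)).2 ((hnd θ hθ hne).trans_le (measure_mono fun x hx => ?_))
    simp only [mem_ofPred_eq] at hx
    simp [(hwpos x).ne', hx]
  have hhom : ∀ (t : ℝ) (θ : E), 0 ≤ t → h (t • θ) = t * h θ := by
    intro t θ ht
    simp only [hh]
    rw [← integral_const_mul]
    refine integral_congr_ae (ae_of_all _ fun x => ?_)
    simp only [real_inner_smul_left]
    have : max (t * inner ℝ θ (y x)) 0 = t * max (inner ℝ θ (y x)) 0 := by
      rw [mul_max_of_nonneg _ _ ht, mul_zero]
    rw [this]; ring
  by_cases hne : ((V : Set E) ∩ Metric.sphere 0 1).Nonempty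
  · have hK : IsCompact ((V : Set E) ∩ Metric.sphere 0 1) :=
      (isCompact_sphere 0 1).inter_left (Submodule.closed_of_finiteDimensional V)
    obtain ⟨θ₀, hθ₀, hmin⟩ := hK.exists_isMinOn hne hcont.continuousOn
    have hne0 : θ₀ ≠ 0 := by
      rintro rfl; simpa using hθ₀.2
    refine ⟨h θ₀, hpos θ₀ hθ₀.1 hne0, fun θ hθ => ?_⟩
    rcases eq_or_ne θ 0 with rfl | hθ0
    · simp
    have hn : 0 < ‖θ‖ := norm_pos_iff.2 hθ0
    have h1 := hmin (a := ‖θ‖⁻¹ • θ) ⟨V.smul_mem _ hθ, by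
      simp [norm_smul, hn.ne']⟩
    simp only [mem_ofPred_eq] at h1
    rw [hhom _ _ (by positivity)] at h1
    calc h θ₀ * ‖θ‖ ≤ ‖θ‖⁻¹ * h θ * ‖θ‖ := by gcongr
      _ = h θ := by field_simp
  · refine ⟨1, one_pos, fun θ hθ => ?_⟩
    have : θ = 0 := by
      by_contra hθ0
      have hn : 0 < ‖θ‖ := norm_pos_iff.2 hθ0
      exact hne ⟨‖θ‖⁻¹ • θ, V.smul_mem _ hθ, by simp [norm_smul, hn.ne']⟩
    subst this; simp

end Minimizer

/-! ### Nondegeneracy from the relative interior -/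

/-- If `0` is in the relative interior of the convex hull of the support, then every nonzero
functional of the span of the support is strictly positive with positive measure. -/
theorem measure_inner_pos_of_zero_mem_relintHullSupport {d : ℕ} {μ : Measure (Euc d)}
    (h : (0 : Euc d) ∈ relintHullSupport μ) {θ : Euc d} (hθ : θ ∈ Submodule.span ℝ μ.support)
    (hne : θ ≠ 0) : 0 < μ {x | 0 < inner ℝ θ x} := by
  rw [pos_iff_ne_zero]
  intro h0
  have hsub : μ.support ⊆ {x | inner ℝ θ x ≤ 0} := by
    refine Measure.support_subset_of_isClosed (isClosed_le (by fun_prop) continuous_const) ?_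
    rw [mem_ae_iff]
    convert h0 using 2
    ext x; simp
  have hhull : convexHull ℝ μ.support ⊆ {x | inner ℝ θ x ≤ 0} :=
    convexHull_min hsub (convex_halfSpace_le (innerSL ℝ θ).isLinear 0)
  obtain ⟨z, hz, hz0⟩ := mem_intrinsicInterior.1 h
  have h0A : (0 : Euc d) ∈ affineSpan ℝ (convexHull ℝ μ.support) := hz0 ▸ z.2
  have hdir : Submodule.span ℝ μ.support ≤ (affineSpan ℝ (convexHull ℝ μ.support)).direction := by
    refine Submodule.span_le.2 fun s hs => ?_
    have := AffineSubspace.vsub_mem_direction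
      (subset_affineSpan ℝ _ (subset_convexHull ℝ _ hs)) h0A
    simpa using this
  have hmem : ∀ t : ℝ, t • θ ∈ affineSpan ℝ (convexHull ℝ μ.support) := fun t => by
    have := AffineSubspace.vadd_mem_of_mem_direction (Submodule.smul_mem _ t (hdir hθ)) h0A
    simpa using this
  have hcont : Continuous fun t : ℝ =>
      (⟨t • θ, hmem t⟩ : affineSpan ℝ (convexHull ℝ μ.support)) := by fun_prop
  have hz' : (⟨(0 : ℝ) • θ, hmem 0⟩ : affineSpan ℝ (convexHull ℝ μ.support)) = z := by
    apply Subtype.ext; simp [hz0]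
  have hev : ∀ᶠ t : ℝ in 𝓝 0, t • θ ∈ convexHull ℝ μ.support := by
    have := hcont.tendsto 0 (hz' ▸ mem_interior_iff_mem_nhds.1 hz)
    exact this
  obtain ⟨t, ht, ht0⟩ := ((hev.filter_mono nhdsWithin_le_nhds).and
    (self_mem_nhdsWithin (a := (0 : ℝ)) (s := Ioi 0))).exists
  have h1 := hhull ht
  simp only [mem_ofPred_eq, real_inner_smul_right, real_inner_self_eq_norm_sq] at h1
  have h2 : 0 < ‖θ‖ := norm_pos_iff.2 hne
  have h3 : (0 : ℝ) < t := ht0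
  have : 0 < t * ‖θ‖ ^ 2 := by positivity
  linarith

/-! ### Weights concentrated on small increments -/

section MixWeight

variable {α E : Type*} [MeasurableSpace α] [NormedAddCommGroup E] [InnerProductSpace ℝ E]
  [FiniteDimensional ℝ E] [MeasurableSpace E] [BorelSpace E]

/-- The part of `B` on which `y` has norm less than `1 / (m + 1)`. -/
def smallPart (B : Set α) (y : α → E) (m : ℕ) : Set α := B ∩ {x | ‖y x‖ < 1 / (m + 1 : ℝ)}

/-- A strictly positive weight against which `1`, `‖y‖` and `W` are bounded by `1`. -/
noncomputable def baseWeight (W : α → ℝ) (y : α → E) (x : α) : ℝ := 1 / (1 + ‖y x‖ + W x)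

/-- The weight that puts most of its mass on the small part of `B`, perturbed by a small multiple
of the base weight. -/
noncomputable def mixWeight (ρ : Measure α) (B : Set α) (W : α → ℝ) (y : α → E) (η : ℝ) (m : ℕ)
    (x : α) : ℝ :=
  (smallPart B y m).indicator 1 x + η * ρ.real (smallPart B y m) * baseWeight W y x

variable {ρ : Measure α} {B : Set α} {W : α → ℝ} {y : α → E} {η : ℝ} {m : ℕ}

theorem measurableSet_smallPart (hB : MeasurableSet B) (hy : Measurable y) :
    MeasurableSet (smallPart B y m) :=
  hB.inter (measurableSet_lt hy.norm measurable_const)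

theorem baseWeight_pos (hW : ∀ x, 0 ≤ W x) (x : α) : 0 < baseWeight W y x := by
  have := hW x; unfold baseWeight; positivity

theorem baseWeight_le_one (hW : ∀ x, 0 ≤ W x) (x : α) : baseWeight W y x ≤ 1 := by
  have := hW x; have := norm_nonneg (y x)
  unfold baseWeight; rw [div_le_one (by positivity)]; linarith

theorem baseWeight_mul_norm_le (hW : ∀ x, 0 ≤ W x) (x : α) : baseWeight W y x * ‖y x‖ ≤ 1 := by
  have := hW x; have := norm_nonneg (y x)
  unfold baseWeight; rw [one_div_mul_eq_div, div_le_one (by positivity)]; linarith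

theorem baseWeight_mul_le (hW : ∀ x, 0 ≤ W x) (x : α) : baseWeight W y x * W x ≤ 1 := by
  have := hW x; have := norm_nonneg (y x)
  unfold baseWeight; rw [one_div_mul_eq_div, div_le_one (by positivity)]; linarith

theorem measurable_baseWeight (hWm : Measurable W) (hy : Measurable y) :
    Measurable (baseWeight W y) := by
  unfold baseWeight; fun_prop

theorem measurable_mixWeight (hB : MeasurableSet B) (hWm : Measurable W) (hy : Measurable y) :
    Measurable (mixWeight ρ B W y η m) :=
  (measurable_one.indicator (measurableSet_smallPart hB hy)).add
    ((measurable_baseWeight hWm hy).const_mul _)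

theorem mixWeight_nonneg (hη : 0 ≤ η) (hW : ∀ x, 0 ≤ W x) (x : α) :
    0 ≤ mixWeight ρ B W y η m x :=
  add_nonneg (indicator_nonneg (fun _ _ => zero_le_one) _)
    (mul_nonneg (by positivity) (baseWeight_pos hW x).le)

theorem mixWeight_pos (hη : 0 < η) (hW : ∀ x, 0 ≤ W x) (hp : 0 < ρ.real (smallPart B y m)) (x : α) :
    0 < mixWeight ρ B W y η m x :=
  add_pos_of_nonneg_of_pos (indicator_nonneg (fun _ _ => zero_le_one) _)
    (mul_pos (by positivity) (baseWeight_pos hW x))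

variable [IsProbabilityMeasure ρ]

theorem mixWeight_le (hη : 0 ≤ η) (hW : ∀ x, 0 ≤ W x) (x : α) :
    mixWeight ρ B W y η m x ≤ 1 + η := by
  unfold mixWeight
  have h1 : (smallPart B y m).indicator (1 : α → ℝ) x ≤ 1 := indicator_le_self' (by simp) x
  have h2 : ρ.real (smallPart B y m) ≤ 1 := measureReal_le_one
  have h3 := baseWeight_le_one (y := y) hW x
  have h4 := (baseWeight_pos (y := y) hW x).le
  have h5 : ρ.real (smallPart B y m) * baseWeight W y x ≤ 1 := mul_le_one₀ h2 h4 h3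
  nlinarith

theorem mixWeight_mul_norm_le (hη : 0 ≤ η) (hW : ∀ x, 0 ≤ W x) (x : α) :
    mixWeight ρ B W y η m x * ‖y x‖ ≤ 1 + η := by
  unfold mixWeight
  have h1 : (smallPart B y m).indicator (1 : α → ℝ) x * ‖y x‖ ≤ 1 := by
    by_cases hx : x ∈ smallPart B y m
    · rw [indicator_of_mem hx, Pi.one_apply, one_mul]
      refine hx.2.le.trans ?_
      rw [div_le_one (by positivity)]; linarith [(m.cast_nonneg : (0 : ℝ) ≤ m)]
    · simp [indicator_of_notMem hx]
  have h2 : ρ.real (smallPart B y m) ≤ 1 := measureReal_le_one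
  have h3 := baseWeight_mul_norm_le (y := y) hW x
  have h4 := (baseWeight_pos (y := y) hW x).le
  have h5 : ρ.real (smallPart B y m) * (baseWeight W y x * ‖y x‖) ≤ 1 :=
    mul_le_one₀ h2 (by positivity) h3
  nlinarith

theorem integrable_mixWeight (hη : 0 ≤ η) (hW : ∀ x, 0 ≤ W x) (hB : MeasurableSet B)
    (hWm : Measurable W) (hy : Measurable y) : Integrable (mixWeight ρ B W y η m) ρ := by
  refine Integrable.of_bound (measurable_mixWeight hB hWm hy).aestronglyMeasurable (1 + η)
    (ae_of_all _ fun x => ?_)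
  rw [Real.norm_eq_abs, abs_of_nonneg (mixWeight_nonneg hη hW x)]
  exact mixWeight_le hη hW x

theorem integrable_mixWeight_mul_norm (hη : 0 ≤ η) (hW : ∀ x, 0 ≤ W x) (hB : MeasurableSet B)
    (hWm : Measurable W) (hy : Measurable y) :
    Integrable (fun x => mixWeight ρ B W y η m x * ‖y x‖) ρ := by
  refine Integrable.of_bound ((measurable_mixWeight hB hWm hy).mul hy.norm).aestronglyMeasurable
    (1 + η) (ae_of_all _ fun x => ?_)
  rw [Real.norm_eq_abs, abs_of_nonneg (mul_nonneg (mixWeight_nonneg hη hW x) (norm_nonneg _))]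
  exact mixWeight_mul_norm_le hη hW x

/-- The potential of the mixed weight grows linearly, at a rate proportional to the mass of the
small part of `B`. -/
theorem exists_forall_le_potential_mixWeight {V : Submodule ℝ E} (hη : 0 < η) (hW : ∀ x, 0 ≤ W x)
    (hB : MeasurableSet B) (hWm : Measurable W) (hy : Measurable y)
    (hnd : ∀ θ ∈ V, θ ≠ 0 → 0 < ρ {x | 0 < inner ℝ θ (y x)}) :
    ∃ c, 0 < c ∧ ∀ (m : ℕ), ∀ θ ∈ V, c * ρ.real (smallPart B y m) * ‖θ‖ ≤
      potential ρ (mixWeight ρ B W y η m) y θ := by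
  have hib : Integrable (baseWeight W y) ρ := by
    refine Integrable.of_bound (measurable_baseWeight hWm hy).aestronglyMeasurable 1
      (ae_of_all _ fun x => ?_)
    rw [Real.norm_eq_abs, abs_of_pos (baseWeight_pos hW x)]
    exact baseWeight_le_one hW x
  have hiby : Integrable (fun x => baseWeight W y x * ‖y x‖) ρ := by
    refine Integrable.of_bound ((measurable_baseWeight hWm hy).mul hy.norm).aestronglyMeasurable 1
      (ae_of_all _ fun x => ?_)
    rw [Real.norm_eq_abs, abs_of_nonneg (mul_nonneg (baseWeight_pos hW x).le (norm_nonneg _))]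
    exact baseWeight_mul_norm_le hW x
  obtain ⟨c, hc, hcV⟩ := exists_coercive_const hib hiby hy (baseWeight_pos hW) hnd
  refine ⟨c * η, by positivity, fun m θ hθ => ?_⟩
  set p := ρ.real (smallPart B y m)
  calc c * η * p * ‖θ‖ = η * p * (c * ‖θ‖) := by ring
    _ ≤ η * p * ∫ x, baseWeight W y x * max (inner ℝ θ (y x)) 0 ∂ρ := by
        gcongr; exact hcV θ hθ
    _ = ∫ x, η * p * (baseWeight W y x * max (inner ℝ θ (y x)) 0) ∂ρ := by
        rw [integral_const_mul]
    _ ≤ _ := by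
        refine integral_mono_of_nonneg (ae_of_all _ fun x => ?_) (integrable_mul_softPlus
          (integrable_mixWeight hη.le hW hB hWm hy)
          (integrable_mixWeight_mul_norm hη.le hW hB hWm hy) hy θ) (ae_of_all _ fun x => ?_)
        · exact mul_nonneg (by positivity)
            (mul_nonneg (baseWeight_pos hW x).le (le_max_right _ _))
        · simp only
          rw [← mul_assoc]
          refine mul_le_mul ?_ (max_le_softPlus _) (le_max_right _ _) (mixWeight_nonneg hη.le hW x)
          exact le_add_of_nonneg_left (indicator_nonneg (fun _ _ => zero_le_one) _)

/-- For `m` large, the tilted mixed weight gives almost no mass to the complement of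
`B ∩ {‖y‖ < ε}`, even when that mass is weighted by `W`: the minimizers stay bounded as `m → ∞`
because both the potential at `0` and its linear growth rate scale with the mass of the small
part of `B`. -/
theorem exists_mixWeight_minimizer {V : Submodule ℝ E} (hV : ∀ᵐ x ∂ρ, y x ∈ V)
    (hη : 0 < η) (hη1 : η ≤ 1) (hW : ∀ x, 0 ≤ W x)
    (hB : MeasurableSet B) (hWm : Measurable W) (hy : Measurable y)
    (hnd : ∀ θ ∈ V, θ ≠ 0 → 0 < ρ {x | 0 < inner ℝ θ (y x)})
    (hp : ∀ m : ℕ, 0 < ρ (smallPart B y m)) {ε : ℝ} (hε : 0 < ε) :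
    ∃ (m : ℕ) (θ : E), (∀ θ', potential ρ (mixWeight ρ B W y η m) y θ ≤
        potential ρ (mixWeight ρ B W y η m) y θ') ∧
      (∀ u : ℕ → E, Tendsto (fun k => potential ρ (mixWeight ρ B W y η m) y (u k)) atTop
          (𝓝 (potential ρ (mixWeight ρ B W y η m) y θ)) →
        ∀ᵐ x ∂ρ, Tendsto (fun k => inner ℝ (u k) (y x)) atTop (𝓝 (inner ℝ θ (y x)))) ∧
      0 < ∫ x, mixWeight ρ B W y η m x * softSlope (inner ℝ θ (y x)) ∂ρ ∧
      ∫⁻ x in (B ∩ {x | ‖y x‖ < ε})ᶜ, ENNReal.ofReal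
          (mixWeight ρ B W y η m x * softSlope (inner ℝ θ (y x)) * W x) ∂ρ ≤
        ENNReal.ofReal
          (8 * η * ∫ x, mixWeight ρ B W y η m x * softSlope (inner ℝ θ (y x)) ∂ρ) := by
  obtain ⟨c, hc, hcV⟩ := exists_forall_le_potential_mixWeight (η := η) hη hW hB hWm hy hnd
  obtain ⟨m₁, hm₁⟩ := exists_nat_gt (2 / c)
  obtain ⟨m₂, hm₂⟩ := exists_nat_gt (1 / ε)
  set m := max m₁ m₂ with hm
  have hm1 : 2 / c ≤ (m + 1 : ℝ) := by
    have : (m₁ : ℝ) ≤ m := by exact_mod_cast le_max_left _ _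
    linarith
  have hm2 : 1 / (m + 1 : ℝ) ≤ ε := by
    have : (m₂ : ℝ) ≤ m := by exact_mod_cast le_max_right _ _
    rw [div_le_iff₀ (by positivity)]
    rw [div_lt_iff₀ hε] at hm₂
    nlinarith
  set p := ρ.real (smallPart B y m) with hpdef
  have hp0 : 0 < p := ENNReal.toReal_pos (hp m).ne' (measure_ne_top _ _)
  set w := mixWeight ρ B W y η m with hwdef
  have hwi : Integrable w ρ := integrable_mixWeight hη.le hW hB hWm hy
  have hwy : Integrable (fun x => w x * ‖y x‖) ρ := integrable_mixWeight_mul_norm hη.le hW hB hWm hy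
  have hwpos : ∀ x, 0 < w x := mixWeight_pos hη hW hp0
  have hcp : 0 < c * p := by positivity
  obtain ⟨θ, hθV, hθ⟩ := exists_potential_minimizer hV hwi hwy hy hcp (hcV m)
  -- the value of the potential at `0` bounds the minimizer
  have hpot0 : potential ρ w y 0 ≤ 2 * p := by
    have h1 : potential ρ w y 0 = ∫ x, w x ∂ρ := by
      simp [potential, softPlus_zero]
    have h2 : ∫ x, w x ∂ρ = p + η * p * ∫ x, baseWeight W y x ∂ρ := by
      simp only [hwdef, mixWeight]
      rw [integral_add ((integrable_const 1).indicator (measurableSet_smallPart hB hy)),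
        integral_indicator_one (measurableSet_smallPart hB hy), integral_const_mul]
      refine Integrable.const_mul (Integrable.of_bound
        (measurable_baseWeight hWm hy).aestronglyMeasurable 1 (ae_of_all _ fun x => ?_)) _
      rw [Real.norm_eq_abs, abs_of_pos (baseWeight_pos hW x)]
      exact baseWeight_le_one hW x
    have h3 : ∫ x, baseWeight W y x ∂ρ ≤ 1 := by
      have := integral_mono_of_nonneg (μ := ρ)
        (ae_of_all _ fun x => (baseWeight_pos (y := y) hW x).le)
        (integrable_const 1) (ae_of_all _ fun x => baseWeight_le_one (y := y) hW x)
      simpa using this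
    have h4 : 0 ≤ ∫ x, baseWeight W y x ∂ρ :=
      integral_nonneg fun x => (baseWeight_pos hW x).le
    rw [h1, h2]
    have : η * (∫ x, baseWeight W y x ∂ρ) ≤ 1 := mul_le_one₀ hη1 h4 h3
    nlinarith
  have hθn : ‖θ‖ ≤ (m + 1 : ℝ) := by
    have h := ((hcV m θ hθV).trans (hθ 0)).trans hpot0
    have : c * ‖θ‖ ≤ 2 := by
      have : p * (c * ‖θ‖) ≤ p * 2 := by linarith
      exact le_of_mul_le_mul_left this hp0
    refine le_trans ?_ hm1
    rw [le_div_iff₀ hc]; linarith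
  have hsi : Integrable (fun x => w x * softSlope (inner ℝ θ (y x))) ρ :=
    integrable_mul_softSlope hwi hy θ
  -- on the small part `⟪θ, y⟫ ≥ -1`, so the normalising constant is at least `p / 4`
  have hN : p * (1 / 4) ≤ ∫ x, w x * softSlope (inner ℝ θ (y x)) ∂ρ := by
    have h1 : p * (1 / 4) = ∫ x, (smallPart B y m).indicator (fun _ => (1 / 4 : ℝ)) x ∂ρ := by
      rw [integral_indicator (measurableSet_smallPart hB hy)]; simp [hpdef]
    rw [h1]
    refine integral_mono_of_nonneg
      (ae_of_all _ fun x => indicator_nonneg (fun _ _ => by norm_num) _) hsi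
      (ae_of_all _ fun x => ?_)
    by_cases hx : x ∈ smallPart B y m
    · simp only [indicator_of_mem hx]
      have hw1 : 1 ≤ w x := by
        simp only [hwdef, mixWeight, indicator_of_mem hx, Pi.one_apply]
        have := (baseWeight_pos (y := y) hW x).le
        have : 0 ≤ η * p * baseWeight W y x := by positivity
        linarith
      have hin : -1 ≤ inner ℝ θ (y x) := by
        have h2 := abs_real_inner_le_norm θ (y x)
        have h3 : ‖θ‖ * ‖y x‖ ≤ 1 := by
          have h4 : ‖y x‖ < 1 / (m + 1 : ℝ) := hx.2
          calc ‖θ‖ * ‖y x‖ ≤ (m + 1 : ℝ) * (1 / (m + 1 : ℝ)) := by gcongr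
            _ = 1 := by field_simp
        linarith [neg_abs_le (inner ℝ θ (y x) : ℝ)]
      have h5 := softSlope_neg_one.trans (softSlope_strictMono.monotone hin)
      nlinarith
    · simp only [indicator_of_notMem hx]
      exact mul_nonneg (hwpos x).le (softSlope_pos _).le
  refine ⟨m, θ, hθ, fun u hu => ?_, lt_of_lt_of_le (by positivity) hN, ?_⟩
  · filter_upwards [hV] with x hx
    exact tendsto_inner_of_minimizing hV hwi hwy hy (ae_of_all _ hwpos) hcp (hcV m) hθV hθ hu hx
  · -- off `B ∩ {‖y‖ < ε}` only the perturbation of size `η * p` contributes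
    have hCm : MeasurableSet (B ∩ {x | ‖y x‖ < ε})ᶜ :=
      (hB.inter (measurableSet_lt hy.norm measurable_const)).compl
    have h1 : ∀ x ∈ (B ∩ {x | ‖y x‖ < ε})ᶜ,
        ENNReal.ofReal (w x * softSlope (inner ℝ θ (y x)) * W x) ≤
          ENNReal.ofReal (2 * (η * p)) := by
      intro x hx
      refine ENNReal.ofReal_le_ofReal ?_
      have hxs : x ∉ smallPart B y m := fun h => hx ⟨h.1, lt_of_lt_of_le h.2 hm2⟩
      have hwx : w x = η * p * baseWeight W y x := by
        simp [hwdef, mixWeight, indicator_of_notMem hxs, hpdef]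
      have h2 := baseWeight_mul_le (y := y) hW x
      have h3 := softSlope_lt_two (inner ℝ θ (y x))
      have h4 := softSlope_pos (inner ℝ θ (y x))
      have h5 : 0 ≤ baseWeight W y x * W x := mul_nonneg (baseWeight_pos hW x).le (hW x)
      calc w x * softSlope (inner ℝ θ (y x)) * W x
          = (η * p) * (softSlope (inner ℝ θ (y x)) * (baseWeight W y x * W x)) := by
            rw [hwx]; ring
        _ ≤ (η * p) * (2 * 1) := by gcongr
        _ = 2 * (η * p) := by ring
    calc ∫⁻ x in (B ∩ {x | ‖y x‖ < ε})ᶜ,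
          ENNReal.ofReal (w x * softSlope (inner ℝ θ (y x)) * W x) ∂ρ
        ≤ ∫⁻ x in (B ∩ {x | ‖y x‖ < ε})ᶜ, ENNReal.ofReal (2 * (η * p)) ∂ρ :=
          setLIntegral_mono' hCm h1
      _ ≤ ENNReal.ofReal (2 * (η * p)) := by
          rw [setLIntegral_const]
          exact mul_le_of_le_one_right zero_le prob_le_one
      _ ≤ _ := ENNReal.ofReal_le_ofReal (by nlinarith)

end MixWeight

open TopologicalSpace (denseSeq denseRange_denseSeq)

/-! ### Measurable selection over a kernel -/

section KernelTilt

variable {Ω' α E : Type*} [MeasurableSpace Ω'] [MeasurableSpace α] [NormedAddCommGroup E]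
  [InnerProductSpace ℝ E] [FiniteDimensional ℝ E] [MeasurableSpace E] [BorelSpace E]
  (k : Kernel Ω' α) [IsMarkovKernel k] (B : Set α) (W : α → ℝ) (y : α → E) (η : ℝ)

/-- The potential of the mixed weight for the law `k ω`. -/
noncomputable def kernelPotential (m : ℕ) (ω : Ω') (θ : E) : ℝ :=
  potential (k ω) (mixWeight (k ω) B W y η m) y θ

theorem bddBelow_kernelPotential (hη : 0 ≤ η) (hW : ∀ x, 0 ≤ W x) (m : ℕ) (ω : Ω') :
    BddBelow (range fun i => kernelPotential k B W y η m ω (denseSeq E i)) := by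
  refine ⟨0, ?_⟩
  rintro _ ⟨i, rfl⟩
  exact integral_nonneg fun x => mul_nonneg (mixWeight_nonneg hη hW x) (softPlus_pos _).le

theorem exists_kernelPotential_lt (m n : ℕ) (ω : Ω') :
    ∃ j, kernelPotential k B W y η m ω (denseSeq E j) <
      (⨅ i, kernelPotential k B W y η m ω (denseSeq E i)) + 1 / (n + 1 : ℝ) :=
  exists_lt_of_ciInf_lt (lt_add_of_pos_right _ (by positivity))

open Classical in
/-- A measurably chosen approximate minimizer of the potential: the first member of a dense
sequence that is optimal up to `1 / (n + 1)`. -/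
noncomputable def approxMinimizer (m n : ℕ) (ω : Ω') : E :=
  denseSeq E (Nat.find (exists_kernelPotential_lt k B W y η m n ω))

/-- The limiting slope along the approximate minimizers; a limit superior, so that it is measurable
without knowing that the limit exists. -/
noncomputable def limSlope (m : ℕ) (p : Ω' × α) : ℝ :=
  limsup (fun n => softSlope (inner ℝ (approxMinimizer k B W y η m n p.1) (y p.2))) atTop

/-- The unnormalised density built from the mixed weight and the limiting slope. -/
noncomputable def tiltWeight (m : ℕ) (p : Ω' × α) : ℝ :=
  mixWeight (k p.1) B W y η m p.2 * limSlope k B W y η m p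

variable {k B W y η}

theorem measurable_mixWeight_kernel (hB : MeasurableSet B) (hWm : Measurable W) (hy : Measurable y)
    (m : ℕ) : Measurable fun p : Ω' × α => mixWeight (k p.1) B W y η m p.2 := by
  have hs := measurableSet_smallPart (m := m) hB hy
  refine ((measurable_one.indicator hs).comp measurable_snd).add (Measurable.mul ?_
    ((measurable_baseWeight hWm hy).comp measurable_snd))
  exact (((k.measurable_coe hs).ennreal_toReal).const_mul η).comp measurable_fst

theorem measurable_kernelPotential (hB : MeasurableSet B) (hWm : Measurable W) (hy : Measurable y)
    (m : ℕ) (θ : E) : Measurable fun ω => kernelPotential k B W y η m ω θ := by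
  refine (StronglyMeasurable.integral_kernel_prod_right' (κ := k) (f := fun p : Ω' × α =>
    mixWeight (k p.1) B W y η m p.2 * softPlus (inner ℝ θ (y p.2))) ?_).measurable
  refine Measurable.stronglyMeasurable ((measurable_mixWeight_kernel hB hWm hy m).mul ?_)
  exact continuous_softPlus.measurable.comp (by fun_prop)

theorem measurable_approxMinimizer (hB : MeasurableSet B) (hWm : Measurable W) (hy : Measurable y)
    (m n : ℕ) : Measurable (approxMinimizer k B W y η m n) := by
  classical
  refine (measurable_from_nat (f := denseSeq E)).comp (measurable_find _ fun j => ?_)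
  exact measurableSet_lt (measurable_kernelPotential hB hWm hy m _)
    ((Measurable.iInf fun i => measurable_kernelPotential hB hWm hy m _).add_const _)

theorem measurable_limSlope (hB : MeasurableSet B) (hWm : Measurable W) (hy : Measurable y)
    (m : ℕ) : Measurable (limSlope k B W y η m) := by
  refine Measurable.limsup fun n => continuous_softSlope.measurable.comp ?_
  exact ((measurable_approxMinimizer hB hWm hy m n).comp measurable_fst).inner
    (hy.comp measurable_snd)

theorem measurable_tiltWeight (hB : MeasurableSet B) (hWm : Measurable W) (hy : Measurable y)
    (m : ℕ) : Measurable (tiltWeight k B W y η m) :=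
  (measurable_mixWeight_kernel hB hWm hy m).mul (measurable_limSlope hB hWm hy m)

theorem limSlope_mem_Icc (m : ℕ) (p : Ω' × α) : limSlope k B W y η m p ∈ Icc (0 : ℝ) 2 := by
  have h0 : ∀ n, 0 ≤ softSlope (inner ℝ (approxMinimizer k B W y η m n p.1) (y p.2)) :=
    fun n => (softSlope_pos _).le
  have h2 : ∀ n, softSlope (inner ℝ (approxMinimizer k B W y η m n p.1) (y p.2)) ≤ 2 :=
    fun n => (softSlope_lt_two _).le
  constructor
  · refine le_limsup_of_frequently_le (Frequently.of_forall h0) ?_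
    exact isBoundedUnder_of ⟨2, h2⟩
  · refine limsup_le_of_le ?_ (Eventually.of_forall h2)
    exact (isBoundedUnder_of ⟨0, h0⟩ : IsBoundedUnder (· ≥ ·) _ _).isCoboundedUnder_le

theorem tiltWeight_nonneg (hη : 0 ≤ η) (hW : ∀ x, 0 ≤ W x) (m : ℕ) (p : Ω' × α) :
    0 ≤ tiltWeight k B W y η m p :=
  mul_nonneg (mixWeight_nonneg hη hW _) (limSlope_mem_Icc m p).1

theorem integrable_tiltWeight_smul (hη : 0 ≤ η) (hW : ∀ x, 0 ≤ W x) (hB : MeasurableSet B)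
    (hWm : Measurable W) (hy : Measurable y) (m : ℕ) (ω : Ω') :
    Integrable (fun x => tiltWeight k B W y η m (ω, x) • y x) (k ω) := by
  refine Integrable.of_bound (((measurable_tiltWeight hB hWm hy m).comp
    measurable_prodMk_left).smul hy).aestronglyMeasurable ((1 + η) * 2) (ae_of_all _ fun x => ?_)
  rw [norm_smul, Real.norm_eq_abs, abs_of_nonneg (tiltWeight_nonneg hη hW m _)]
  have h1 := mixWeight_mul_norm_le (ρ := k ω) (B := B) (y := y) (m := m) hη hW x
  have h2 := limSlope_mem_Icc (k := k) (B := B) (W := W) (y := y) (η := η) m (ω, x)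
  have h3 := mixWeight_nonneg (ρ := k ω) (B := B) (y := y) (m := m) hη hW x
  calc tiltWeight k B W y η m (ω, x) * ‖y x‖
      = (mixWeight (k ω) B W y η m x * ‖y x‖) * limSlope k B W y η m (ω, x) := by
        simp only [tiltWeight]; ring
    _ ≤ _ := mul_le_mul h1 h2.2 h2.1 (by positivity)

theorem integrable_tiltWeight (hη : 0 ≤ η) (hW : ∀ x, 0 ≤ W x) (hB : MeasurableSet B)
    (hWm : Measurable W) (hy : Measurable y) (m : ℕ) (ω : Ω') :
    Integrable (fun x => tiltWeight k B W y η m (ω, x)) (k ω) := by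
  refine Integrable.of_bound ((measurable_tiltWeight hB hWm hy m).comp
    measurable_prodMk_left).aestronglyMeasurable ((1 + η) * 2) (ae_of_all _ fun x => ?_)
  rw [Real.norm_eq_abs, abs_of_nonneg (tiltWeight_nonneg hη hW m _)]
  have h2 := limSlope_mem_Icc (k := k) (B := B) (W := W) (y := y) (η := η) m (ω, x)
  exact mul_le_mul (mixWeight_le hη hW x) h2.2 h2.1 (by positivity)

/-- Along the approximate minimizers the limiting slope is the slope at the true minimizer. -/
theorem limSlope_ae_eq (hη : 0 < η) (hW : ∀ x, 0 ≤ W x) (hB : MeasurableSet B)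
    (hWm : Measurable W) (hy : Measurable y) {m : ℕ} {ω : Ω'} {θ : E}
    (hmin : ∀ θ', kernelPotential k B W y η m ω θ ≤ kernelPotential k B W y η m ω θ')
    (hlim : ∀ u : ℕ → E, Tendsto (fun n => kernelPotential k B W y η m ω (u n)) atTop
          (𝓝 (kernelPotential k B W y η m ω θ)) →
        ∀ᵐ x ∂(k ω), Tendsto (fun n => inner ℝ (u n) (y x)) atTop (𝓝 (inner ℝ θ (y x)))) :
    ∀ᵐ x ∂(k ω), limSlope k B W y η m (ω, x) = softSlope (inner ℝ θ (y x)) := by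
  classical
  have hcont : Continuous (kernelPotential k B W y η m ω) :=
    continuous_potential (integrable_mixWeight hη.le hW hB hWm hy)
      (integrable_mixWeight_mul_norm hη.le hW hB hWm hy) hy
  have hinf : (⨅ i, kernelPotential k B W y η m ω (denseSeq E i)) ≤
      kernelPotential k B W y η m ω θ := by
    refine le_of_forall_pos_lt_add fun r hr => ?_
    have hopen : IsOpen {θ' | kernelPotential k B W y η m ω θ' <
      kernelPotential k B W y η m ω θ + r} := isOpen_lt hcont continuous_const
    obtain ⟨_, hx, i, rfl⟩ := (denseRange_denseSeq E).inter_open_nonempty _ hopen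
      ⟨θ, lt_add_of_pos_right _ hr⟩
    exact (ciInf_le (bddBelow_kernelPotential k B W y η hη.le hW m ω) i).trans_lt hx
  have hu : Tendsto (fun n => kernelPotential k B W y η m ω (approxMinimizer k B W y η m n ω))
      atTop (𝓝 (kernelPotential k B W y η m ω θ)) := by
    have hup : Tendsto (fun n : ℕ => kernelPotential k B W y η m ω θ + 1 / (n + 1 : ℝ)) atTop
        (𝓝 (kernelPotential k B W y η m ω θ)) := by
      simpa using tendsto_one_div_add_atTop_nhds_zero_nat.const_add
        (kernelPotential k B W y η m ω θ)
    refine tendsto_of_tendsto_of_tendsto_of_le_of_le tendsto_const_nhds hup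
      (fun n => hmin _) fun n => ?_
    have := Nat.find_spec (exists_kernelPotential_lt k B W y η m n ω)
    simp only
    refine (this.le).trans ?_
    gcongr
  filter_upwards [hlim _ hu] with x hx
  exact ((continuous_softSlope.tendsto _).comp hx).limsup_eq

/-- The conditions asked of the tilted weight: it is a strictly positive weight of positive mass,
it centres `y`, and it gives little mass, weighted by `W`, to the complement of `C`. -/
def tiltGood (k : Kernel Ω' α) [IsMarkovKernel k] (B : Set α) (W : α → ℝ) (y : α → E) (η : ℝ)
    (C : Set α) (m : ℕ) : Set Ω' :=
  {ω | 0 < ∫ x, tiltWeight k B W y η m (ω, x) ∂(k ω)} ∩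
  {ω | ∫ x, tiltWeight k B W y η m (ω, x) • y x ∂(k ω) = 0} ∩
  {ω | ∫⁻ x in Cᶜ, ENNReal.ofReal (tiltWeight k B W y η m (ω, x) * W x) ∂(k ω) ≤
    ENNReal.ofReal (8 * η * ∫ x, tiltWeight k B W y η m (ω, x) ∂(k ω))} ∩
  {ω | k ω (Prod.mk ω ⁻¹' {p | tiltWeight k B W y η m p ≤ 0}) = 0}

theorem measurableSet_tiltGood (hB : MeasurableSet B) (hWm : Measurable W) (hy : Measurable y)
    {C : Set α} (hC : MeasurableSet C) (m : ℕ) :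
    MeasurableSet (tiltGood k B W y η C m) := by
  have ht := measurable_tiltWeight (k := k) (η := η) hB hWm hy m
  have i1 : Measurable fun ω => ∫ x, tiltWeight k B W y η m (ω, x) ∂(k ω) :=
    (ht.stronglyMeasurable.integral_kernel_prod_right' (κ := k)).measurable
  have i2 : StronglyMeasurable fun ω => ∫ x, tiltWeight k B W y η m (ω, x) • y x ∂(k ω) :=
    StronglyMeasurable.integral_kernel_prod_right' (κ := k)
      (f := fun p : Ω' × α => tiltWeight k B W y η m p • y p.2)
      (ht.smul (hy.comp measurable_snd)).stronglyMeasurable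
  have i3 : Measurable fun ω => ∫⁻ x in Cᶜ,
      ENNReal.ofReal (tiltWeight k B W y η m (ω, x) * W x) ∂(k ω) := by
    simp only [← lintegral_indicator hC.compl]
    refine Measurable.lintegral_kernel_prod_right' (κ := k)
      (f := fun p : Ω' × α => Cᶜ.indicator
        (fun x => ENNReal.ofReal (tiltWeight k B W y η m (p.1, x) * W x)) p.2) ?_
    exact ((ht.mul (hWm.comp measurable_snd)).ennreal_ofReal).indicator (measurable_snd hC.compl)
  refine (((measurableSet_lt measurable_const i1).inter
    (i2.measurable (measurableSet_singleton 0))).inter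
    (measurableSet_le i3 (i1.const_mul _).ennreal_ofReal)).inter ?_
  exact (Kernel.measurable_kernel_prodMk_left (measurableSet_le ht measurable_const))
    (measurableSet_singleton 0)

/-- Some mixed weight is good at every `ω` for which `y` is nondegenerate under `k ω` and the
small parts of `B` have positive mass. -/
theorem exists_mem_tiltGood (hη : 0 < η) (hη1 : η ≤ 1) (hW : ∀ x, 0 ≤ W x) (hB : MeasurableSet B)
    (hWm : Measurable W) (hy : Measurable y) {ω : Ω'} {V : Submodule ℝ E}
    (hV : ∀ᵐ x ∂(k ω), y x ∈ V)
    (hnd : ∀ θ ∈ V, θ ≠ 0 → 0 < k ω {x | 0 < inner ℝ θ (y x)})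
    (hp : ∀ m : ℕ, 0 < k ω (smallPart B y m)) {ε : ℝ} (hε : 0 < ε) :
    ∃ m, ω ∈ tiltGood k B W y η (B ∩ {x | ‖y x‖ < ε}) m := by
  obtain ⟨m, θ, hmin, hlim, hN, hsmall⟩ :=
    exists_mixWeight_minimizer hV hη hη1 hW hB hWm hy hnd hp hε
  have heq := limSlope_ae_eq (k := k) hη hW hB hWm hy hmin hlim
  have hw : ∀ᵐ x ∂(k ω), tiltWeight k B W y η m (ω, x) =
      mixWeight (k ω) B W y η m x * softSlope (inner ℝ θ (y x)) := by
    filter_upwards [heq] with x hx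
    rw [tiltWeight, hx]
  have e1 : ∫ x, tiltWeight k B W y η m (ω, x) ∂(k ω) = _ := integral_congr_ae hw
  refine ⟨m, ⟨⟨?_, ?_⟩, ?_⟩, ?_⟩
  · rw [mem_ofPred_eq, e1]; exact hN
  · rw [mem_ofPred_eq]
    refine (integral_congr_ae ?_).trans (integral_softSlope_smul_eq_zero
      (integrable_mixWeight hη.le hW hB hWm hy)
      (integrable_mixWeight_mul_norm hη.le hW hB hWm hy) hy hmin)
    filter_upwards [hw] with x hx
    rw [hx]
  · rw [mem_ofPred_eq, e1]
    refine (lintegral_congr_ae ?_).trans_le hsmall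
    filter_upwards [ae_restrict_of_ae hw] with x hx
    rw [hx]
  · rw [mem_ofPred_eq]
    refine measure_mono_null ?_ (ae_iff.1 hw)
    intro x hx hx'
    simp only [mem_preimage, mem_ofPred_eq] at hx
    rw [hx'] at hx
    exact absurd hx (not_le.2 (mul_pos (mixWeight_pos hη hW (ENNReal.toReal_pos (hp m).ne'
      (measure_ne_top _ _)) x) (softSlope_pos _)))

/-- A measurable choice, over a kernel, of densities that centre `y` and give a prescribed small
mass, weighted by `W`, to the complement of `B ∩ {‖y‖ < ε}`. -/
theorem exists_kernel_density (k : Kernel Ω' α) [IsMarkovKernel k] {ε δ : ℝ} (hε : 0 < ε)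
    (hδ : 0 < δ) (hW : ∀ x, 0 ≤ W x) (hB : MeasurableSet B) (hWm : Measurable W)
    (hy : Measurable y) :
    ∃ z : Ω' × α → ENNReal, Measurable z ∧ (∀ p, z p < ⊤) ∧
      ∀ (ω : Ω') (V : Submodule ℝ E), (∀ᵐ x ∂(k ω), y x ∈ V) →
      (∀ θ ∈ V, θ ≠ 0 → 0 < k ω {x | 0 < inner ℝ θ (y x)}) →
      (∀ m : ℕ, 0 < k ω (smallPart B y m)) →
      (∀ᵐ x ∂(k ω), 0 < z (ω, x)) ∧ ∫⁻ x, z (ω, x) ∂(k ω) = 1 ∧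
      (∀ v : E, ∫⁻ x, z (ω, x) * ENNReal.ofReal (inner ℝ v (y x)) ∂(k ω) =
        ∫⁻ x, z (ω, x) * ENNReal.ofReal (-inner ℝ v (y x)) ∂(k ω)) ∧
      ∫⁻ x in (B ∩ {x | ‖y x‖ < ε})ᶜ, z (ω, x) * ENNReal.ofReal (W x) ∂(k ω) ≤
        ENNReal.ofReal δ := by
  classical
  obtain ⟨η, hη, hη1, hηδ⟩ : ∃ η : ℝ, 0 < η ∧ η ≤ 1 ∧ 8 * η ≤ δ :=
    ⟨min (δ / 8) 1, by positivity, min_le_right _ _, by linarith [min_le_left (δ / 8) 1]⟩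
  set C : Set α := B ∩ {x | ‖y x‖ < ε} with hC
  have hCm : MeasurableSet C := hB.inter (measurableSet_lt hy.norm measurable_const)
  -- use the first good index at each `ω`
  set D : ℕ → Set Ω' := disjointed (tiltGood k B W y η C) with hD
  have hDm : ∀ m, MeasurableSet (D m) :=
    MeasurableSet.disjointed fun m => measurableSet_tiltGood hB hWm hy hCm m
  set N : ℕ → Ω' → ℝ := fun m ω => ∫ x, tiltWeight k B W y η m (ω, x) ∂(k ω) with hN
  have hNm : ∀ m, Measurable (N m) := fun m => ((measurable_tiltWeight hB hWm hy
    m).stronglyMeasurable.integral_kernel_prod_right' (κ := k)).measurable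
  set f : ℕ → Ω' × α → ENNReal := fun m => (Prod.fst ⁻¹' D m).indicator
    fun p => ENNReal.ofReal (tiltWeight k B W y η m p / N m p.1) with hf
  have hone : ∀ m p, p.1 ∈ D m → ∑' m, f m p = ENNReal.ofReal (tiltWeight k B W y η m p / N m p.1) := by
    intro m p hp
    rw [tsum_eq_single m]
    · exact indicator_of_mem (show p ∈ Prod.fst ⁻¹' D m from hp) _
    · intro j hj
      refine indicator_of_notMem (s := Prod.fst ⁻¹' D j) (fun h : p.1 ∈ D j => ?_) _
      exact (disjoint_disjointed (tiltGood k B W y η C) hj).le_bot ⟨h, hp⟩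
  refine ⟨fun p => ∑' m, f m p, ?_, ?_, ?_⟩
  · refine Measurable.tsum fun m => Measurable.indicator ?_ (measurable_fst (hDm m))
    exact ((measurable_tiltWeight hB hWm hy m).div ((hNm m).comp measurable_fst)).ennreal_ofReal
  · intro p
    by_cases h : ∃ m, p.1 ∈ D m
    · obtain ⟨m, hm⟩ := h
      simp only [hone m p hm]; exact ENNReal.ofReal_lt_top
    · push Not at h
      have : ∑' m, f m p = 0 := by
        rw [ENNReal.tsum_eq_zero]
        exact fun m => indicator_of_notMem (s := Prod.fst ⁻¹' D m) (h m) _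
      simp only [this]; exact ENNReal.zero_lt_top
  · intro ω V hV hnd hp
    obtain ⟨m, hm⟩ : ∃ m, ω ∈ D m := by
      have : ω ∈ ⋃ m, tiltGood k B W y η C m :=
        mem_iUnion.2 (exists_mem_tiltGood hη hη1 hW hB hWm hy hV hnd hp hε)
      rw [← iUnion_disjointed] at this
      exact mem_iUnion.1 this
    have hz : ∀ x, ∑' m, f m (ω, x) = ENNReal.ofReal (tiltWeight k B W y η m (ω, x) / N m ω) :=
      fun x => hone m (ω, x) hm
    obtain ⟨⟨⟨g1, g2⟩, g3⟩, g4⟩ := disjointed_subset _ m hm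
    simp only [mem_ofPred_eq] at g1 g2 g3 g4
    have hNpos : 0 < N m ω := g1
    have ht0 := fun x => tiltWeight_nonneg (k := k) (B := B) (y := y) hη.le hW m (ω, x)
    have hti := integrable_tiltWeight (k := k) hη.le hW hB hWm hy m ω
    have hty := integrable_tiltWeight_smul (k := k) hη.le hW hB hWm hy m ω
    simp only [hz]
    refine ⟨?_, ?_, fun v => ?_, ?_⟩
    · rw [ae_iff]
      refine measure_mono_null (fun x hx => ?_) g4
      simp only [mem_ofPred_eq, ENNReal.ofReal_pos, not_lt] at hx
      simp only [mem_preimage, mem_ofPred_eq]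
      by_contra hlt
      exact absurd hx (not_le.2 (div_pos (not_le.1 hlt) hNpos))
    · rw [← ofReal_integral_eq_lintegral_ofReal (hti.div_const _)
        (ae_of_all _ fun x => div_nonneg (ht0 x) hNpos.le), integral_div]
      have : (∫ x, tiltWeight k B W y η m (ω, x) ∂(k ω)) / N m ω = 1 := div_self hNpos.ne'
      rw [this, ENNReal.ofReal_one]
    · set F : α → ℝ := fun x => tiltWeight k B W y η m (ω, x) / N m ω * inner ℝ v (y x) with hF
      have hFi : Integrable F (k ω) := by
        refine ((Integrable.const_inner (𝕜 := ℝ) v hty).div_const (N m ω)).congr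
          (ae_of_all _ fun x => ?_)
        simp only [hF, real_inner_smul_right]; ring
      have hF0 : ∫ x, F x ∂(k ω) = 0 := by
        have := integral_inner (𝕜 := ℝ) hty v
        rw [g2, inner_zero_right] at this
        have e : ∀ x, F x = inner ℝ v (tiltWeight k B W y η m (ω, x) • y x) / N m ω := by
          intro x; simp only [hF, real_inner_smul_right]; ring
        simp only [e]
        rw [integral_div, this, zero_div]
      have h1 := integral_eq_lintegral_pos_part_sub_lintegral_neg_part hFi
      rw [hF0] at h1
      have f1 : ∫⁻ x, ENNReal.ofReal (F x) ∂(k ω) ≠ ⊤ := hFi.lintegral_lt_top.ne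
      have f2 : ∫⁻ x, ENNReal.ofReal (-F x) ∂(k ω) ≠ ⊤ := hFi.neg.lintegral_lt_top.ne
      have h2 := (ENNReal.toReal_eq_toReal_iff' f1 f2).1 (by linarith)
      have hd0 : ∀ x, 0 ≤ tiltWeight k B W y η m (ω, x) / N m ω :=
        fun x => div_nonneg (ht0 x) hNpos.le
      simp only [← ENNReal.ofReal_mul (hd0 _)]
      simp only [hF] at h2
      rw [h2]
      simp only [mul_neg]
    · calc ∫⁻ x in Cᶜ, ENNReal.ofReal (tiltWeight k B W y η m (ω, x) / N m ω) *
            ENNReal.ofReal (W x) ∂(k ω)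
          = ∫⁻ x in Cᶜ, ENNReal.ofReal (N m ω)⁻¹ *
              ENNReal.ofReal (tiltWeight k B W y η m (ω, x) * W x) ∂(k ω) := by
            refine lintegral_congr fun x => ?_
            rw [← ENNReal.ofReal_mul (div_nonneg (ht0 x) hNpos.le),
              ← ENNReal.ofReal_mul (inv_nonneg.2 hNpos.le)]
            congr 1; ring
        _ = ENNReal.ofReal (N m ω)⁻¹ *
              ∫⁻ x in Cᶜ, ENNReal.ofReal (tiltWeight k B W y η m (ω, x) * W x) ∂(k ω) :=
            lintegral_const_mul' _ _ ENNReal.ofReal_ne_top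
        _ ≤ ENNReal.ofReal (N m ω)⁻¹ * ENNReal.ofReal (8 * η * N m ω) := by gcongr
        _ = ENNReal.ofReal (8 * η) := by
            rw [← ENNReal.ofReal_mul (inv_nonneg.2 hNpos.le)]
            congr 1; field_simp
        _ ≤ ENNReal.ofReal δ := ENNReal.ofReal_le_ofReal hηδ

end KernelTilt

/-! ### The density of one step -/

/-- Disintegration of an integral along a conditional distribution, over an event of the
conditioning variable. -/
theorem setLIntegral_comp_eq_lintegral_condDistrib {Ω Ω' β : Type*} {mΩ : MeasurableSpace Ω}
    {mΩ' : MeasurableSpace Ω'} [MeasurableSpace β] [StandardBorelSpace β] [Nonempty β]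
    {P : Measure Ω} [IsFiniteMeasure P] {I : Ω → Ω'} (hI : Measurable I) {X : Ω → β}
    (hX : Measurable X) {f : Ω' × β → ENNReal} (hf : Measurable f) {A : Set Ω'}
    (hA : MeasurableSet A) :
    ∫⁻ ω in I ⁻¹' A, f (I ω, X ω) ∂P =
      ∫⁻ ω in I ⁻¹' A, ∫⁻ x, f (I ω, x) ∂(condDistrib X I P (I ω)) ∂P := by
  set F : Ω' × β → ENNReal := (Prod.fst ⁻¹' A).indicator f with hF
  have hFm : Measurable F := hf.indicator (measurable_fst hA)
  have h1 : ∫⁻ ω in I ⁻¹' A, f (I ω, X ω) ∂P = ∫⁻ ω, F (I ω, X ω) ∂P := by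
    rw [← lintegral_indicator (hI hA)]; rfl
  have h2 : ∫⁻ ω in I ⁻¹' A, ∫⁻ x, f (I ω, x) ∂(condDistrib X I P (I ω)) ∂P =
      ∫⁻ ω, ∫⁻ x, F (I ω, x) ∂(condDistrib X I P (I ω)) ∂P := by
    rw [← lintegral_indicator (hI hA)]
    refine lintegral_congr fun ω => ?_
    by_cases h : ω ∈ I ⁻¹' A
    · rw [indicator_of_mem h]
      exact lintegral_congr fun x => (indicator_of_mem (show (I ω, x) ∈ Prod.fst ⁻¹' A from h) f).symm
    · rw [indicator_of_notMem h]
      have : ∀ x, F (I ω, x) = 0 := fun x =>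
        indicator_of_notMem (show (I ω, x) ∉ Prod.fst ⁻¹' A from h) f
      simp [this]
  rw [h1, h2, ← lintegral_map hFm (hI.prodMk hX), ← compProd_map_condDistrib hX.aemeasurable,
    Measure.lintegral_compProd hFm,
    lintegral_map (hFm.lintegral_kernel_prod_right') hI]

/-- One step of the change of measure, conditioning on a variable `I`: a density that makes `Y` a
martingale difference and gives little mass, weighted by `W`, to the complement of
`B ∩ {‖Y‖ < ε}`. -/
theorem exists_density_condDistrib {Ω Ω' : Type*} {mΩ : MeasurableSpace Ω}
    {mΩ' : MeasurableSpace Ω'} {d : ℕ} (P : Measure Ω) [IsProbabilityMeasure P] {I : Ω → Ω'}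
    (hI : Measurable I) {Y : Ω → Euc d} (hY : Measurable Y) {B : Set Ω} (hB : MeasurableSet B)
    {b : Ω → Bool} (hb : ∀ ω, b ω = true ↔ ω ∈ B)
    (h0 : ∀ᵐ ω ∂P, (0 : Euc d) ∈ relintHullSupport (condDistrib Y I P (I ω)))
    (hst : ∀ κ : ℝ, 0 < κ → ∀ᵐ ω ∂P, 0 < (P⟦B ∩ {ω | ‖Y ω‖ < κ} | mΩ'.comap I⟧) ω)
    {W : Euc d → ℝ} (hWm : Measurable W) (hW : ∀ y, 0 ≤ W y) {ε δ : ℝ} (hε : 0 < ε) (hδ : 0 < δ) :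
    ∃ z : Ω' × (Euc d × Bool) → ENNReal, Measurable z ∧ (∀ p, z p < ⊤) ∧
      (∀ᵐ ω ∂P, 0 < z (I ω, (Y ω, b ω))) ∧
      (∀ A, MeasurableSet A → ∫⁻ ω in I ⁻¹' A, z (I ω, (Y ω, b ω)) ∂P = P (I ⁻¹' A)) ∧
      (∀ A, MeasurableSet A → ∀ i,
        ∫⁻ ω in I ⁻¹' A, z (I ω, (Y ω, b ω)) * ENNReal.ofReal (Y ω i) ∂P =
        ∫⁻ ω in I ⁻¹' A, z (I ω, (Y ω, b ω)) * ENNReal.ofReal (-Y ω i) ∂P) ∧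
      (∀ A, MeasurableSet A →
        ∫⁻ ω in I ⁻¹' A, (B ∩ {ω | ‖Y ω‖ < ε})ᶜ.indicator
          (fun ω => z (I ω, (Y ω, b ω)) * ENNReal.ofReal (W (Y ω))) ω ∂P ≤
        ENNReal.ofReal δ * P (I ⁻¹' A)) := by
  -- the pair records the increment and whether `B` occurred, and takes values in a standard Borel
  -- space although `Ω` need not be one
  set X : Ω → Euc d × Bool := fun ω => (Y ω, b ω) with hXdef
  have hbm : Measurable b := by
    refine measurable_to_bool ?_
    convert hB using 1
    ext ω; simp [hb]
  have hX : Measurable X := hY.prodMk hbm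
  set k := condDistrib X I P with hk
  set B' : Set (Euc d × Bool) := {p | p.2 = true} with hB'
  have hB'm : MeasurableSet B' := measurable_snd (measurableSet_singleton true)
  obtain ⟨z, hzm, hzt, hz⟩ := exists_kernel_density (B := B') (W := fun p => W p.1)
    (y := Prod.fst) k hε hδ (fun p => hW p.1) hB'm (hWm.comp measurable_fst) measurable_fst
  have hsm : ∀ m, MeasurableSet (smallPart B' (Prod.fst : Euc d × Bool → Euc d) m) :=
    fun m => measurableSet_smallPart hB'm measurable_fst
  have hpos : ∀ᵐ ω ∂P, ∀ m : ℕ, 0 < k (I ω) (smallPart B' Prod.fst m) := by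
    rw [ae_all_iff]
    intro m
    have h1 := condDistrib_ae_eq_condExp (μ := P) hI hX (hsm m)
    have h2 := hst (1 / (m + 1 : ℝ)) (by positivity)
    have e : X ⁻¹' (smallPart B' Prod.fst m) = B ∩ {ω | ‖Y ω‖ < 1 / (m + 1 : ℝ)} := by
      ext ω
      simp only [smallPart, hB', hXdef, mem_preimage, mem_inter_iff, mem_ofPred_eq, hb]
    rw [e] at h1
    filter_upwards [h1, h2] with ω h1 h2
    by_contra hn
    have : k (I ω) (smallPart B' Prod.fst m) = 0 := by simpa using hn
    rw [← h1, Measure.real, ← hk, this] at h2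
    simp at h2
  have hlaw : ∀ᵐ ω ∂P, condDistrib Y I P (I ω) = (k (I ω)).map Prod.fst := by
    have h1 := condDistrib_comp (mβ := mΩ') (μ := P) I hX.aemeasurable (f := Prod.fst) measurable_fst
    have h2 := ae_of_ae_map hI.aemeasurable h1
    filter_upwards [h2] with ω hω
    rw [← Kernel.map_apply _ measurable_fst, ← hω]
    rfl
  have hgood : ∀ᵐ ω ∂P, (∀ᵐ x ∂(k (I ω)), 0 < z (I ω, x)) ∧ ∫⁻ x, z (I ω, x) ∂(k (I ω)) = 1 ∧
      (∀ v : Euc d, ∫⁻ x, z (I ω, x) * ENNReal.ofReal (inner ℝ v x.1) ∂(k (I ω)) =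
        ∫⁻ x, z (I ω, x) * ENNReal.ofReal (-inner ℝ v x.1) ∂(k (I ω))) ∧
      ∫⁻ x in (B' ∩ {x | ‖x.1‖ < ε})ᶜ, z (I ω, x) * ENNReal.ofReal (W x.1) ∂(k (I ω)) ≤
        ENNReal.ofReal δ := by
    filter_upwards [hpos, hlaw, h0] with ω h1 h2 h3
    refine hz (I ω) (Submodule.span ℝ (condDistrib Y I P (I ω)).support) ?_ ?_ h1
    · rw [ae_iff]
      have h4 : ((k (I ω)).map Prod.fst) (condDistrib Y I P (I ω)).supportᶜ = 0 := by
        rw [← h2]; exact Measure.measure_compl_support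
      rw [Measure.map_apply measurable_fst Measure.isClosed_support.measurableSet.compl] at h4
      refine measure_mono_null (fun x hx => ?_) h4
      exact fun hx' => hx (Submodule.subset_span hx')
    · intro θ hθ hne
      have h4 := measure_inner_pos_of_zero_mem_relintHullSupport h3 hθ hne
      rwa [h2, Measure.map_apply measurable_fst
        (measurableSet_lt measurable_const (by fun_prop))] at h4
  have hdis : ∀ {f : Ω' × (Euc d × Bool) → ENNReal}, Measurable f → ∀ A, MeasurableSet A →
      ∫⁻ ω in I ⁻¹' A, f (I ω, X ω) ∂P =
      ∫⁻ ω in I ⁻¹' A, ∫⁻ x, f (I ω, x) ∂(k (I ω)) ∂P := fun hf A hA =>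
    setLIntegral_comp_eq_lintegral_condDistrib hI hX hf hA
  refine ⟨z, hzm, hzt, ?_, fun A hA => ?_, fun A hA i => ?_, fun A hA => ?_⟩
  · have hN : MeasurableSet {p | z p = 0} := hzm (measurableSet_singleton 0)
    have h1 := hdis (f := {p | z p = 0}.indicator 1) (measurable_one.indicator hN) univ
      MeasurableSet.univ
    simp only [preimage_univ, Measure.restrict_univ] at h1
    have h2 : ∫⁻ ω, ∫⁻ x, {p | z p = 0}.indicator (1 : Ω' × (Euc d × Bool) → ENNReal) (I ω, x) ∂(k (I ω)) ∂P = 0 := by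
      rw [lintegral_eq_zero_iff' ?_]
      · filter_upwards [hgood] with ω hω
        refine (lintegral_eq_zero_iff' ?_).2 ?_
        · exact ((measurable_one.indicator hN).comp measurable_prodMk_left).aemeasurable
        · filter_upwards [hω.1] with x hx
          simp [hx.ne']
      · exact ((measurable_one.indicator hN).lintegral_kernel_prod_right'.comp hI).aemeasurable
    rw [h2] at h1
    have h3 := (lintegral_eq_zero_iff ((measurable_one.indicator hN).comp (hI.prodMk hX))).1 h1
    filter_upwards [h3] with ω hω
    rw [pos_iff_ne_zero]
    intro hz0
    have : (I ω, X ω) ∈ {p | z p = 0} := hz0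
    simp [indicator_of_mem this] at hω
  · rw [hdis hzm A hA]
    rw [lintegral_congr_ae (g := fun _ => 1)]
    · simp
    · filter_upwards [ae_restrict_of_ae hgood] with ω hω using hω.2.1
  · have e : ∀ y : Euc d, y i = inner ℝ (EuclideanSpace.single i (1 : ℝ)) y := by
      intro y; simp [EuclideanSpace.inner_single_left]
    have m1 : Measurable fun p : Ω' × (Euc d × Bool) => z p * ENNReal.ofReal (p.2.1 i) := by
      refine hzm.mul (Measurable.ennreal_ofReal ?_); fun_prop
    have m2 : Measurable fun p : Ω' × (Euc d × Bool) => z p * ENNReal.ofReal (-p.2.1 i) := by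
      refine hzm.mul (Measurable.ennreal_ofReal ?_); fun_prop
    rw [hdis m1 A hA, hdis m2 A hA]
    refine lintegral_congr_ae ?_
    filter_upwards [ae_restrict_of_ae hgood] with ω hω
    have := hω.2.2.1 (EuclideanSpace.single i (1 : ℝ))
    simpa only [← e] using this
  · have hC : MeasurableSet (B' ∩ {x : Euc d × Bool | ‖x.1‖ < ε})ᶜ :=
      (hB'm.inter (measurableSet_lt (by fun_prop) measurable_const)).compl
    have m1 : Measurable fun p : Ω' × (Euc d × Bool) =>
        (B' ∩ {x : Euc d × Bool | ‖x.1‖ < ε})ᶜ.indicator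
          (fun x => z (p.1, x) * ENNReal.ofReal (W x.1)) p.2 :=
      (hzm.mul (hWm.comp (measurable_fst.comp measurable_snd)).ennreal_ofReal).indicator
        (measurable_snd hC)
    have e : ∀ ω, (B ∩ {ω | ‖Y ω‖ < ε})ᶜ.indicator
          (fun ω => z (I ω, (Y ω, b ω)) * ENNReal.ofReal (W (Y ω))) ω =
        (B' ∩ {x : Euc d × Bool | ‖x.1‖ < ε})ᶜ.indicator
          (fun x => z (I ω, x) * ENNReal.ofReal (W x.1)) (X ω) := by
      intro ω
      have : ω ∈ (B ∩ {ω | ‖Y ω‖ < ε})ᶜ ↔ X ω ∈ (B' ∩ {x : Euc d × Bool | ‖x.1‖ < ε})ᶜ := by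
        simp only [hB', hXdef, mem_compl_iff, mem_inter_iff, mem_ofPred_eq, hb]
      by_cases h : ω ∈ (B ∩ {ω | ‖Y ω‖ < ε})ᶜ
      · rw [indicator_of_mem h, indicator_of_mem (this.1 h)]
      · rw [indicator_of_notMem h, indicator_of_notMem (fun h' => h (this.2 h'))]
    simp only [e]
    rw [hdis m1 A hA, ← setLIntegral_const]
    refine lintegral_mono_ae ?_
    filter_upwards [ae_restrict_of_ae hgood] with ω hω
    rw [lintegral_indicator hC]
    exact hω.2.2.2

/-- One step of the change of measure, conditioning on a σ-algebra `G`: the density `Z` has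
conditional mass one, makes `Y` a martingale difference and gives little mass, weighted by `W`, to
the complement of `B ∩ {‖Y‖ < ε}`. The centring is stated through positive and negative parts, so
that it needs no integrability of `Y`. -/
theorem exists_step_density {Ω : Type*} {mΩ : MeasurableSpace Ω} {d : ℕ} (P : Measure Ω)
    [IsProbabilityMeasure P] {G G' : MeasurableSpace Ω} (hG : G ≤ G') (hG' : G' ≤ mΩ)
    {Y : Ω → Euc d} (hY : Measurable[G'] Y) {B : Set Ω} (hB : MeasurableSet[G'] B)
    (h0 : ∀ᵐ ω ∂P, (0 : Euc d) ∈ relintHullSupport (condLaw P G Y ω))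
    (hst : ∀ κ : ℝ, 0 < κ → ∀ᵐ ω ∂P, 0 < (P⟦B ∩ {ω | ‖Y ω‖ < κ} | G⟧) ω)
    {W : Euc d → ℝ} (hWm : Measurable W) (hW : ∀ y, 0 ≤ W y) {ε δ : ℝ} (hε : 0 < ε) (hδ : 0 < δ) :
    ∃ Z : Ω → ENNReal, Measurable[G'] Z ∧ (∀ ω, Z ω < ⊤) ∧ (∀ᵐ ω ∂P, 0 < Z ω) ∧
      (∀ A, MeasurableSet[G] A → ∫⁻ ω in A, Z ω ∂P = P A) ∧
      (∀ A, MeasurableSet[G] A → ∀ i, ∫⁻ ω in A, Z ω * ENNReal.ofReal (Y ω i) ∂P =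
        ∫⁻ ω in A, Z ω * ENNReal.ofReal (-Y ω i) ∂P) ∧
      (∀ A, MeasurableSet[G] A → ∫⁻ ω in A, (B ∩ {ω | ‖Y ω‖ < ε})ᶜ.indicator
          (fun ω => Z ω * ENNReal.ofReal (W (Y ω))) ω ∂P ≤ ENNReal.ofReal δ * P A) := by
  classical
  obtain ⟨z, hz1, hz2, hz3, hz4, hz5, hz6⟩ := @exists_density_condDistrib Ω Ω mΩ G d P _ id
    (measurable_id'' (hG.trans hG')) Y (hY.mono hG' le_rfl) B (hG' _ hB)
    (fun ω => decide (ω ∈ B)) (by simp) h0 (by rwa [MeasurableSpace.comap_id]) W hWm hW ε δ hε hδ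
  refine ⟨fun ω => z (ω, (Y ω, decide (ω ∈ B))), ?_, fun ω => hz2 _, hz3, hz4, hz5, hz6⟩
  have hb : Measurable[G'] (fun ω => decide (ω ∈ B)) := by
    refine @measurable_to_bool Ω G' _ ?_
    convert hB using 1
    ext ω; simp
  exact hz1.comp ((measurable_id'' hG).prodMk (hY.prodMk hb))

/-! ### The product of the step densities -/

/-- Inequalities between integrals over the events of a σ-algebra persist against nonnegative
weights measurable for that σ-algebra. -/
theorem lintegral_mul_le_of_forall_setLIntegral_le {Ω : Type*} {G mΩ : MeasurableSpace Ω}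
    {P : Measure Ω} (hG : G ≤ mΩ) {f g l : Ω → ENNReal}
    (hf : Measurable f) (hg : Measurable g)
    (h : ∀ A, MeasurableSet[G] A → ∫⁻ ω in A, f ω ∂P ≤ ∫⁻ ω in A, g ω ∂P)
    (hl : Measurable[G] l) : ∫⁻ ω, f ω * l ω ∂P ≤ ∫⁻ ω, g ω * l ω ∂P := by
  have hl' : Measurable l := hl.mono hG le_rfl
  have e1 : ∫⁻ ω, f ω * l ω ∂P = ∫⁻ ω, l ω ∂((P.withDensity f).trim hG) := by
    rw [lintegral_trim hG hl, lintegral_withDensity_eq_lintegral_mul _ hf hl']; rfl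
  have e2 : ∫⁻ ω, g ω * l ω ∂P = ∫⁻ ω, l ω ∂((P.withDensity g).trim hG) := by
    rw [lintegral_trim hG hl, lintegral_withDensity_eq_lintegral_mul _ hg hl']; rfl
  rw [e1, e2]
  refine lintegral_mono' ?_ le_rfl
  refine Measure.le_iff.2 fun A hA => ?_
  rw [trim_measurableSet_eq hG hA, trim_measurableSet_eq hG hA, withDensity_apply _ (hG _ hA),
    withDensity_apply _ (hG _ hA)]
  exact h A hA

theorem lintegral_mul_eq_of_forall_setLIntegral_eq {Ω : Type*} {G mΩ : MeasurableSpace Ω}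
    {P : Measure Ω} (hG : G ≤ mΩ) {f g l : Ω → ENNReal}
    (hf : Measurable f) (hg : Measurable g)
    (h : ∀ A, MeasurableSet[G] A → ∫⁻ ω in A, f ω ∂P = ∫⁻ ω in A, g ω ∂P)
    (hl : Measurable[G] l) : ∫⁻ ω, f ω * l ω ∂P = ∫⁻ ω, g ω * l ω ∂P :=
  le_antisymm (lintegral_mul_le_of_forall_setLIntegral_le hG hf hg (fun A hA => (h A hA).le) hl)
    (lintegral_mul_le_of_forall_setLIntegral_le hG hg hf (fun A hA => (h A hA).ge) hl)

/-- The density process of a change of measure, with successive factors `Z n`. -/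
noncomputable def densityProcess {Ω : Type*} (L₀ : Ω → ENNReal) (Z : ℕ → Ω → ENNReal) :
    ℕ → Ω → ENNReal
  | 0, ω => L₀ ω
  | n + 1, ω => densityProcess L₀ Z n ω * Z n ω

/-- A multiplicative density process that is constant after the time described by `A n`, and whose
mass before that time vanishes in the limit, has a limit which is a density consistent with each
`L n`. -/
theorem exists_limit_density {Ω : Type*} {mΩ : MeasurableSpace Ω} (P : Measure Ω)
    (G : Filtration ℕ mΩ) {L₀ : Ω → ENNReal} {Z : ℕ → Ω → ENNReal} {A : ℕ → Set Ω}
    (hL₀ : Measurable[G 0] L₀) (hL₀t : ∀ ω, L₀ ω < ⊤) (hL₀p : ∀ ω, 0 < L₀ ω)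
    (hL₀1 : ∫⁻ ω, L₀ ω ∂P = 1)
    (hZ : ∀ n, Measurable[G (n + 1)] (Z n)) (hZt : ∀ n ω, Z n ω < ⊤)
    (hZp : ∀ n, ∀ᵐ ω ∂P, 0 < Z n ω)
    (hZ1 : ∀ n B, MeasurableSet[G n] B → ∫⁻ ω in B, Z n ω ∂P = P B)
    (hA : ∀ n, MeasurableSet[G n] (A n)) (hAmono : Monotone A) (hAtop : ⋃ n, A n = univ)
    (hZA : ∀ n, ∀ ω ∈ A n, Z n ω = 1)
    {δ : ℕ → ENNReal} (hδ : Tendsto δ atTop (𝓝 0))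
    (hZδ : ∀ n B, MeasurableSet[G n] B →
      ∫⁻ ω in B, (A (n + 1))ᶜ.indicator (Z n) ω ∂P ≤ δ n * P B) :
    (∀ n, Measurable[G n] (densityProcess L₀ Z n)) ∧ (∀ n ω, densityProcess L₀ Z n ω < ⊤) ∧
    (∀ n, ∫⁻ ω, densityProcess L₀ Z n ω ∂P = 1) ∧
    ∃ Λ : Ω → ENNReal, Measurable Λ ∧ (∀ ω, Λ ω < ⊤) ∧ (∀ᵐ ω ∂P, 0 < Λ ω) ∧
      ∀ n B, MeasurableSet[G n] B → ∫⁻ ω in B, Λ ω ∂P = ∫⁻ ω in B, densityProcess L₀ Z n ω ∂P := by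
  set L := densityProcess L₀ Z with hL
  have hLm : ∀ n, Measurable[G n] (L n) := by
    intro n
    induction n with
    | zero => exact hL₀
    | succ n ih => exact (ih.mono (G.mono n.le_succ) le_rfl).mul (hZ n)
  have hLm' : ∀ n, Measurable (L n) := fun n => (hLm n).mono (G.le n) le_rfl
  have hLt : ∀ n ω, L n ω < ⊤ := by
    intro n ω
    induction n with
    | zero => exact hL₀t ω
    | succ n ih => exact ENNReal.mul_lt_top ih (hZt n ω)
  have hLp : ∀ᵐ ω ∂P, ∀ n, 0 < L n ω := by
    filter_upwards [ae_all_iff.2 hZp] with ω hω n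
    induction n with
    | zero => exact hL₀p ω
    | succ n ih => exact ENNReal.mul_pos ih.ne' (hω n).ne'
  have hZm' : ∀ n, Measurable (Z n) := fun n => (hZ n).mono (G.le _) le_rfl
  have hstep : ∀ n B, MeasurableSet[G n] B → ∫⁻ ω in B, L (n + 1) ω ∂P = ∫⁻ ω in B, L n ω ∂P := by
    intro n B hB
    rw [← lintegral_indicator (G.le n _ hB), ← lintegral_indicator (G.le n _ hB)]
    have := lintegral_mul_eq_of_forall_setLIntegral_eq (P := P) (G.le n) (hZm' n)
      (measurable_one (α := ENNReal)) (by simpa using hZ1 n) (l := B.indicator (L n))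
      ((hLm n).indicator hB)
    convert this using 1
    · refine lintegral_congr fun ω => ?_
      by_cases h : ω ∈ B
      · simp only [indicator_of_mem h, hL, densityProcess]; exact mul_comm _ _
      · simp [indicator_of_notMem h]
    · simp
  have hcons : ∀ n m, n ≤ m → ∀ B, MeasurableSet[G n] B →
      ∫⁻ ω in B, L m ω ∂P = ∫⁻ ω in B, L n ω ∂P := by
    intro n m hnm
    induction m, hnm using Nat.le_induction with
    | base => intro B _; rfl
    | succ m hnm ih => intro B hB; rw [hstep m B (G.mono hnm _ hB), ih B hB]
  have hL1 : ∀ n, ∫⁻ ω, L n ω ∂P = 1 := by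
    intro n
    have := hcons 0 n (Nat.zero_le _) univ MeasurableSet.univ
    simp only [Measure.restrict_univ] at this
    rw [this]; exact hL₀1
  have htail : ∀ n, ∫⁻ ω in (A (n + 1))ᶜ, L (n + 1) ω ∂P ≤ δ n := by
    intro n
    have hAm := G.le _ _ (hA (n + 1))
    rw [← lintegral_indicator hAm.compl]
    have := lintegral_mul_le_of_forall_setLIntegral_le (P := P) (G.le n)
      ((hZm' n).indicator hAm.compl) (measurable_const (a := δ n))
      (fun B hB => by rw [setLIntegral_const]; exact hZδ n B hB) (hLm n)
    rw [lintegral_const_mul _ (hLm' n), hL1, mul_one] at this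
    refine le_trans (le_of_eq (lintegral_congr fun ω => ?_)) this
    by_cases h : ω ∈ (A (n + 1))ᶜ
    · simp only [indicator_of_mem h, hL, densityProcess]; exact mul_comm _ _
    · simp [indicator_of_notMem h]
  have hconst : ∀ n m, n ≤ m → ∀ ω ∈ A n, L m ω = L n ω := by
    intro n m hnm ω hω
    induction m, hnm using Nat.le_induction with
    | base => rfl
    | succ m hnm ih =>
      have : L (m + 1) ω = L m ω * Z m ω := rfl
      rw [this, hZA m ω (hAmono hnm hω), mul_one, ih]
  refine ⟨hLm, hLt, hL1, fun ω => liminf (fun n => L n ω) atTop, Measurable.liminf hLm', ?_⟩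
  have hΛ : ∀ n, ∀ ω ∈ A n, liminf (fun n => L n ω) atTop = L n ω := by
    intro n ω hω
    refine Tendsto.liminf_eq (tendsto_const_nhds.congr' ?_)
    filter_upwards [eventually_ge_atTop n] with m hm
    exact (hconst n m hm ω hω).symm
  have hex : ∀ ω, ∃ n, ω ∈ A n := fun ω => mem_iUnion.1 (hAtop ▸ mem_univ ω)
  refine ⟨fun ω => ?_, ?_, fun n B hB => ?_⟩
  · obtain ⟨n, hn⟩ := hex ω
    simp only [hΛ n ω hn]; exact hLt n ω
  · filter_upwards [hLp] with ω hω
    obtain ⟨n, hn⟩ := hex ω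
    simp only [hΛ n ω hn]; exact hω n
  · set Λ : Ω → ENNReal := fun ω => liminf (fun n => L n ω) atTop
    have hΛm : Measurable Λ := Measurable.liminf hLm'
    have hBm := G.le _ _ hB
    have t1 : Tendsto (fun m => ∫⁻ ω in B ∩ A m, Λ ω ∂P) atTop (𝓝 (∫⁻ ω in B, Λ ω ∂P)) := by
      have hmono : Monotone fun m => B ∩ A m := fun a b hab => inter_subset_inter_right _ (hAmono hab)
      have := tendsto_measure_iUnion_atTop (μ := P.withDensity Λ) hmono
      rw [← inter_iUnion, hAtop, inter_univ, withDensity_apply _ hBm] at this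
      refine this.congr fun m => ?_
      rw [Function.comp_apply, withDensity_apply _ (hBm.inter (G.le _ _ (hA m)))]
    have t2 : Tendsto (fun m => ∫⁻ ω in B ∩ (A m)ᶜ, L m ω ∂P) atTop (𝓝 0) := by
      rw [← tendsto_add_atTop_iff_nat 1]
      refine tendsto_of_tendsto_of_tendsto_of_le_of_le tendsto_const_nhds hδ
        (fun _ => zero_le) fun m => ?_
      exact (lintegral_mono_set inter_subset_right).trans (htail m)
    have t3 : Tendsto (fun m => ∫⁻ ω in B ∩ A m, Λ ω ∂P + ∫⁻ ω in B ∩ (A m)ᶜ, L m ω ∂P) atTop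
        (𝓝 (∫⁻ ω in B, L n ω ∂P)) := by
      refine tendsto_const_nhds.congr' ?_
      filter_upwards [eventually_ge_atTop n] with m hm
      have hAm := G.le _ _ (hA m)
      rw [← hcons n m hm B hB, ← lintegral_inter_add_sdiff (L m) B hAm, sdiff_eq]
      congr 1
      refine setLIntegral_congr_fun (hBm.inter hAm) fun ω hω => (hΛ m ω hω.2).symm
    have := t1.add t2
    rw [add_zero] at this
    exact tendsto_nhds_unique this t3

/-- Equivalent martingale measure for a process that is stopped after finitely many steps: the
increments `Y n` become martingale differences, the initial value `X₀` becomes square integrable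
and, apart from a last step of norm less than `ε`, the increments have arbitrarily small mass even
when weighted by `W`. -/
theorem exists_equivalent_martingale_measure {Ω : Type*} {mΩ : MeasurableSpace Ω} {d : ℕ}
    (P : Measure Ω) [IsProbabilityMeasure P] (G : Filtration ℕ mΩ) {Y : ℕ → Ω → Euc d}
    (hY : ∀ n, Measurable[G (n + 1)] (Y n)) {A : ℕ → Set Ω} (hA : ∀ n, MeasurableSet[G n] (A n))
    (hAmono : Monotone A) (hAtop : ⋃ n, A n = univ) (hYA : ∀ n, ∀ ω ∈ A n, Y n ω = 0)
    (h0 : ∀ n, ∀ᵐ ω ∂P, (0 : Euc d) ∈ relintHullSupport (condLaw P (G n) (Y n) ω))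
    (hst : ∀ n, ∀ κ : ℝ, 0 < κ → ∀ᵐ ω ∂P, 0 < (P⟦A (n + 1) ∩ {ω | ‖Y n ω‖ < κ} | G n⟧) ω)
    {X₀ : Ω → ℝ} (hX₀ : Measurable[G 0] X₀)
    {W : Euc d → ℝ} (hWm : Measurable W) (hW : ∀ y, 1 ≤ W y) {ε : ℝ} (hε : 0 < ε)
    {δ : ℕ → ℝ} (hδ : ∀ n, 0 < δ n) (hδ0 : Tendsto δ atTop (𝓝 0)) :
    ∃ Q : Measure Ω, IsProbabilityMeasure Q ∧ Q ≪ P ∧ P ≪ Q ∧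
      ∫⁻ ω, ENNReal.ofReal (X₀ ω ^ 2) ∂Q < ⊤ ∧
      (∀ n, ∫⁻ ω in (A (n + 1) ∩ {ω | ‖Y n ω‖ < ε})ᶜ, ENNReal.ofReal (W (Y n ω)) ∂Q ≤
        ENNReal.ofReal (δ n)) ∧
      (∀ n B, MeasurableSet[G n] B → ∀ i, ∫⁻ ω in B, ENNReal.ofReal (Y n ω i) ∂Q =
        ∫⁻ ω in B, ENNReal.ofReal (-Y n ω i) ∂Q) := by
  classical
  choose Z hZm hZt hZp hZ1 hZY hZW using fun n => exists_step_density P (G.mono n.le_succ)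
    (G.le (n + 1)) (hY n) (hA (n + 1)) (h0 n) (hst n) hWm (fun y => zero_le_one.trans (hW y)) hε
    (hδ n)
  -- no change of measure once the process has stopped
  set Z' : ℕ → Ω → ENNReal := fun n => (A n).piecewise 1 (Z n) with hZ'
  have hAm : ∀ n, MeasurableSet (A n) := fun n => G.le n _ (hA n)
  have hZ'A : ∀ n, ∀ ω ∈ A n, Z' n ω = 1 := fun n ω hω => piecewise_eq_of_mem _ _ _ hω
  have hZ'A' : ∀ n, ∀ ω ∉ A n, Z' n ω = Z n ω := fun n ω hω => piecewise_eq_of_notMem _ _ _ hω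
  have hZ'm : ∀ n, Measurable[G (n + 1)] (Z' n) := fun n =>
    Measurable.piecewise (G.mono n.le_succ _ (hA n)) (@measurable_const _ _ _ (G (n + 1)) 1) (hZm n)
  have hZ'm' : ∀ n, Measurable (Z' n) := fun n => (hZ'm n).mono (G.le _) le_rfl
  have hYm' : ∀ n, Measurable (Y n) := fun n => (hY n).mono (G.le _) le_rfl
  have hAC : ∀ n, A n ⊆ A (n + 1) ∩ {ω | ‖Y n ω‖ < ε} := fun n ω hω =>
    ⟨hAmono n.le_succ hω, by simp [hYA n ω hω, hε]⟩
  have hsplit : ∀ n (f : Ω → ENNReal) B, (∀ ω ∈ A n, f ω = 0) →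
      ∫⁻ ω in B, f ω ∂P = ∫⁻ ω in B \ A n, f ω ∂P := by
    intro n f B hf
    rw [← lintegral_inter_add_sdiff f B (hAm n)]
    have : ∫⁻ ω in B ∩ A n, f ω ∂P ≤ ∫⁻ ω in A n, f ω ∂P := lintegral_mono_set inter_subset_right
    rw [setLIntegral_congr_fun (hAm n) (g := fun _ => 0) hf, lintegral_zero] at this
    rw [nonpos_iff_eq_zero.1 this, zero_add]
  have hZ'1 : ∀ n B, MeasurableSet[G n] B → ∫⁻ ω in B, Z' n ω ∂P = P B := by
    intro n B hB
    have hBm := G.le n _ hB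
    rw [← lintegral_inter_add_sdiff _ B (hAm n),
      setLIntegral_congr_fun (hBm.inter (hAm n)) (g := fun _ => 1) (fun ω hω => hZ'A n ω hω.2),
      setLIntegral_congr_fun (hBm.diff (hAm n)) (g := Z n) (fun ω hω => hZ'A' n ω hω.2),
      hZ1 n _ (hB.diff (hA n)), lintegral_const, Measure.restrict_apply_univ, one_mul,
      measure_inter_add_sdiff _ (hAm n)]
  have hZ'Y : ∀ n B, MeasurableSet[G n] B → ∀ i, ∫⁻ ω in B, Z' n ω * ENNReal.ofReal (Y n ω i) ∂P =
        ∫⁻ ω in B, Z' n ω * ENNReal.ofReal (-Y n ω i) ∂P := by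
    intro n B hB i
    have hBm := G.le n _ hB
    rw [hsplit n _ B (fun ω hω => by simp [hYA n ω hω]),
      hsplit n (fun ω => Z' n ω * ENNReal.ofReal (-Y n ω i)) B (fun ω hω => by simp [hYA n ω hω]),
      setLIntegral_congr_fun (hBm.diff (hAm n)) (f := fun ω => Z' n ω * ENNReal.ofReal (Y n ω i))
        (g := fun ω => Z n ω * ENNReal.ofReal (Y n ω i))
        (fun ω hω => by simp only [hZ'A' n ω hω.2]),
      setLIntegral_congr_fun (hBm.diff (hAm n)) (f := fun ω => Z' n ω * ENNReal.ofReal (-Y n ω i))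
        (g := fun ω => Z n ω * ENNReal.ofReal (-Y n ω i))
        (fun ω hω => by simp only [hZ'A' n ω hω.2])]
    exact hZY n _ (hB.diff (hA n)) i
  have hZ'W : ∀ n B, MeasurableSet[G n] B →
      ∫⁻ ω in B, (A (n + 1) ∩ {ω | ‖Y n ω‖ < ε})ᶜ.indicator
        (fun ω => Z' n ω * ENNReal.ofReal (W (Y n ω))) ω ∂P ≤ ENNReal.ofReal (δ n) * P B := by
    intro n B hB
    have hBm := G.le n _ hB
    rw [hsplit n _ B (fun ω hω => indicator_of_notMem (not_not.2 (hAC n hω)) _)]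
    have : ∫⁻ ω in B \ A n, (A (n + 1) ∩ {ω | ‖Y n ω‖ < ε})ᶜ.indicator
        (fun ω => Z' n ω * ENNReal.ofReal (W (Y n ω))) ω ∂P =
      ∫⁻ ω in B \ A n, (A (n + 1) ∩ {ω | ‖Y n ω‖ < ε})ᶜ.indicator
        (fun ω => Z n ω * ENNReal.ofReal (W (Y n ω))) ω ∂P := by
      refine setLIntegral_congr_fun (hBm.diff (hAm n)) fun ω hω => ?_
      simp only [indicator, hZ'A' n ω hω.2]
    rw [this]
    refine (hZW n _ (hB.diff (hA n))).trans ?_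
    gcongr
    exact sdiff_subset
  have hX₀' : Measurable X₀ := hX₀.mono (G.le 0) le_rfl
  -- an initial density that makes `X₀` square integrable
  set u : Ω → ENNReal := fun ω => ENNReal.ofReal (1 / (1 + X₀ ω ^ 2)) with hu
  have hum : Measurable[G 0] u := by
    refine Measurable.ennreal_ofReal ?_
    exact measurable_const.div (measurable_const.add (hX₀.pow_const 2))
  have hum' : Measurable u := hum.mono (G.le 0) le_rfl
  have hup : ∀ ω, 0 < u ω := fun ω => ENNReal.ofReal_pos.2 (by positivity)
  have hu1 : ∀ ω, u ω ≤ 1 := fun ω => by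
    rw [hu, ← ENNReal.ofReal_one]
    refine ENNReal.ofReal_le_ofReal ?_
    rw [div_le_one (by positivity)]; nlinarith [sq_nonneg (X₀ ω)]
  set c := ∫⁻ ω, u ω ∂P with hc
  have hc0 : c ≠ 0 := by
    intro h
    rw [hc, lintegral_eq_zero_iff hum'] at h
    have : ∀ᵐ ω ∂P, False := by
      filter_upwards [h] with ω hω using (hup ω).ne' hω
    exact (IsProbabilityMeasure.ne_zero P) (ae_eq_bot.1 (eventually_false_iff_eq_bot.1 this))
  have hct : c ≠ ⊤ := by
    refine ne_top_of_le_ne_top (ENNReal.one_ne_top) ?_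
    calc c ≤ ∫⁻ _, 1 ∂P := lintegral_mono hu1
      _ = 1 := by simp
  obtain ⟨hLm, hLt, hL1, Λ, hΛm, hΛt, hΛp, hΛ⟩ := exists_limit_density P G (L₀ := fun ω => u ω / c)
    (Z := Z') (A := A) (hum.div_const c)
    (fun ω => ENNReal.div_lt_top ENNReal.ofReal_ne_top hc0)
    (fun ω => ENNReal.div_pos (hup ω).ne' hct)
    (by simp only [div_eq_mul_inv]
        rw [lintegral_mul_const _ hum', ← hc, ENNReal.mul_inv_cancel hc0 hct])
    hZ'm (fun n ω => by
      by_cases h : ω ∈ A n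
      · rw [hZ'A n ω h]; exact ENNReal.one_lt_top
      · rw [hZ'A' n ω h]; exact hZt n ω)
    (fun n => by
      filter_upwards [hZp n] with ω hω
      by_cases h : ω ∈ A n
      · rw [hZ'A n ω h]; exact one_pos
      · rw [hZ'A' n ω h]; exact hω)
    hZ'1 hA hAmono hAtop hZ'A (δ := fun n => ENNReal.ofReal (δ n))
    (by simpa using ENNReal.tendsto_ofReal hδ0)
    (fun n B hB => by
      refine le_trans (lintegral_mono fun ω => ?_) (hZ'W n B hB)
      by_cases h : ω ∈ (A (n + 1))ᶜ
      · have h' : ω ∈ (A (n + 1) ∩ {ω | ‖Y n ω‖ < ε})ᶜ := fun h' => h h'.1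
        rw [indicator_of_mem h, indicator_of_mem h']
        refine le_mul_of_one_le_right zero_le ?_
        rw [← ENNReal.ofReal_one]
        exact ENNReal.ofReal_le_ofReal (hW _)
      · rw [indicator_of_notMem h]; exact zero_le)
  set L := densityProcess (fun ω => u ω / c) Z' with hL
  have hLm' : ∀ n, Measurable (L n) := fun n => (hLm n).mono (G.le _) le_rfl
  have htr : ∀ n (f : Ω → ENNReal), Measurable[G n] f →
      ∫⁻ ω, f ω ∂(P.withDensity Λ) = ∫⁻ ω, L n ω * f ω ∂P := by
    intro n f hf
    rw [lintegral_withDensity_eq_lintegral_mul _ hΛm (hf.mono (G.le n) le_rfl)]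
    exact lintegral_mul_eq_of_forall_setLIntegral_eq (G.le n) hΛm (hLm' n) (hΛ n) hf
  refine ⟨P.withDensity Λ, ⟨?_⟩, withDensity_absolutelyContinuous _ _,
    withDensity_absolutelyContinuous' hΛm.aemeasurable ?_, ?_, fun n => ?_, fun n B hB i => ?_⟩
  · have := htr 0 (fun _ => 1) (@measurable_const _ _ _ (G 0) 1)
    simpa [hL1 0] using this
  · filter_upwards [hΛp] with ω hω using hω.ne'
  · rw [htr 0 _ (hX₀.pow_const 2).ennreal_ofReal]
    have : ∀ ω, L 0 ω * ENNReal.ofReal (X₀ ω ^ 2) ≤ c⁻¹ := by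
      intro ω
      have e : L 0 ω = u ω / c := rfl
      have h1 : u ω * ENNReal.ofReal (X₀ ω ^ 2) ≤ 1 := by
        rw [hu, ← ENNReal.ofReal_mul (by positivity), ← ENNReal.ofReal_one]
        refine ENNReal.ofReal_le_ofReal ?_
        rw [one_div_mul_eq_div, div_le_one (by positivity)]; linarith
      calc L 0 ω * ENNReal.ofReal (X₀ ω ^ 2) = (u ω * ENNReal.ofReal (X₀ ω ^ 2)) * c⁻¹ := by
            rw [e, div_eq_mul_inv]; ring
        _ ≤ 1 * c⁻¹ := by gcongr
        _ = c⁻¹ := one_mul _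
    calc ∫⁻ ω, L 0 ω * ENNReal.ofReal (X₀ ω ^ 2) ∂P ≤ ∫⁻ _, c⁻¹ ∂P := lintegral_mono this
      _ = c⁻¹ := by simp
      _ < ⊤ := ENNReal.inv_lt_top.2 (pos_iff_ne_zero.2 hc0)
  · have hCm : MeasurableSet[G (n + 1)] (A (n + 1) ∩ {ω | ‖Y n ω‖ < ε})ᶜ :=
      ((hA (n + 1)).inter (hY n (measurableSet_lt measurable_norm measurable_const))).compl
    have hWY : Measurable[G (n + 1)] fun ω => ENNReal.ofReal (W (Y n ω)) :=
      (hWm.comp (hY n)).ennreal_ofReal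
    rw [← lintegral_indicator (G.le _ _ hCm), htr (n + 1) _ (hWY.indicator hCm)]
    have := lintegral_mul_le_of_forall_setLIntegral_le (P := P) (G.le n)
      (f := (A (n + 1) ∩ {ω | ‖Y n ω‖ < ε})ᶜ.indicator
        (fun ω => Z' n ω * ENNReal.ofReal (W (Y n ω)))) (g := fun _ => ENNReal.ofReal (δ n))
      (((hZ'm' n).mul (hWY.mono (G.le _) le_rfl)).indicator (G.le _ _ hCm)) measurable_const
      (fun B hB => by rw [setLIntegral_const]; exact hZ'W n B hB) (hLm n)
    rw [lintegral_const_mul _ (hLm' n), hL1, mul_one] at this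
    refine le_trans (le_of_eq (lintegral_congr fun ω => ?_)) this
    have e : L (n + 1) ω = L n ω * Z' n ω := rfl
    by_cases h : ω ∈ (A (n + 1) ∩ {ω | ‖Y n ω‖ < ε})ᶜ
    · rw [indicator_of_mem h, indicator_of_mem h, e]; ring
    · rw [indicator_of_notMem h, indicator_of_notMem h]; simp
  · have hB' := G.mono n.le_succ _ hB
    have hYi : Measurable[G (n + 1)] fun ω => Y n ω i :=
      (by fun_prop : Measurable fun y : Euc d => y i).comp (hY n)
    have m1 : Measurable[G (n + 1)] fun ω => ENNReal.ofReal (Y n ω i) := hYi.ennreal_ofReal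
    have m2 : Measurable[G (n + 1)] fun ω => ENNReal.ofReal (-Y n ω i) := hYi.neg.ennreal_ofReal
    rw [← lintegral_indicator (G.le n _ hB), ← lintegral_indicator (G.le n _ hB),
      htr (n + 1) _ (m1.indicator hB'), htr (n + 1) _ (m2.indicator hB')]
    have := lintegral_mul_eq_of_forall_setLIntegral_eq (P := P) (G.le n)
      ((hZ'm' n).mul (m1.mono (G.le _) le_rfl)) ((hZ'm' n).mul (m2.mono (G.le _) le_rfl))
      (fun B hB => hZ'Y n B hB i) (l := B.indicator (L n)) ((hLm n).indicator hB)
    convert this using 1 <;>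
    · refine lintegral_congr fun ω => ?_
      have e : L (n + 1) ω = L n ω * Z' n ω := rfl
      by_cases h : ω ∈ B
      · simp only [indicator_of_mem h, e, Pi.mul_apply]; ring
      · simp [indicator_of_notMem h]

/-! ### Càdlàg paths and dyadic grids -/

/-- The `j`-th point of the grid of mesh `T / 2 ^ m` in `[0, T]`; it is `T` for `2 ^ m ≤ j`. -/
noncomputable def grid {T : ℝ} [hT : Fact ((0 : ℝ) ≤ T)] (m j : ℕ) : TimeInterval T :=
  ⟨T * ((min j (2 ^ m) : ℕ) : ℝ) / 2 ^ m, by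
    have := hT.out
    refine ⟨by positivity, ?_⟩
    rw [div_le_iff₀ (by positivity)]
    refine mul_le_mul_of_nonneg_left ?_ this
    exact_mod_cast min_le_right _ _⟩

section Grid

variable {T : ℝ} [hT : Fact ((0 : ℝ) ≤ T)]

lemma grid_mono (m : ℕ) : Monotone (grid (T := T) m) := by
  intro i j hij
  have := hT.out
  show T * ((min i (2 ^ m) : ℕ) : ℝ) / 2 ^ m ≤ T * ((min j (2 ^ m) : ℕ) : ℝ) / 2 ^ m
  have h : min i (2 ^ m) ≤ min j (2 ^ m) := min_le_min_right _ hij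
  gcongr

lemma grid_eq_top {m j : ℕ} (h : 2 ^ m ≤ j) : grid (T := T) m j = ⊤ := by
  refine Subtype.ext ?_
  show T * ((min j (2 ^ m) : ℕ) : ℝ) / 2 ^ m = T
  rw [min_eq_right h]; push_cast; field_simp

lemma grid_eq_grid {m m' : ℕ} (h : m ≤ m') (j : ℕ) :
    grid (T := T) m j = grid m' (j * 2 ^ (m' - m)) := by
  obtain ⟨k, rfl⟩ := Nat.exists_eq_add_of_le h
  refine Subtype.ext ?_
  show T * ((min j (2 ^ m) : ℕ) : ℝ) / 2 ^ m =
    T * ((min (j * 2 ^ (m + k - m)) (2 ^ (m + k)) : ℕ) : ℝ) / 2 ^ (m + k)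
  have : min (j * 2 ^ (m + k - m)) (2 ^ (m + k)) = min j (2 ^ m) * 2 ^ k := by
    rw [Nat.add_sub_cancel_left, pow_add, Nat.mul_min_mul_right]
  rw [this, pow_add]; push_cast; field_simp

/-- The smallest grid point above `t` is within `T / 2 ^ m` of `t`. -/
lemma exists_grid_ge (t : TimeInterval T) (m : ℕ) :
    t ≤ grid m ⌈(t : ℝ) * 2 ^ m / T⌉₊ ∧
      ((grid m ⌈(t : ℝ) * 2 ^ m / T⌉₊ : TimeInterval T) : ℝ) ≤ t + T / 2 ^ m := by
  have h0 := hT.out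
  rcases h0.eq_or_lt with h | h
  · have h1 : ∀ s : TimeInterval T, (s : ℝ) = 0 := fun s => le_antisymm (s.2.2.trans h.ge) s.2.1
    refine ⟨Subtype.coe_le_coe.1 (by rw [h1, h1]), by rw [h1, h1, ← h]; simp⟩
  have hle : ⌈(t : ℝ) * 2 ^ m / T⌉₊ ≤ 2 ^ m := by
    refine Nat.ceil_le.2 ?_
    rw [div_le_iff₀ h]; push_cast
    have := mul_le_mul_of_nonneg_right t.2.2 (by positivity : (0 : ℝ) ≤ 2 ^ m)
    linarith
  have e : ((grid m ⌈(t : ℝ) * 2 ^ m / T⌉₊ : TimeInterval T) : ℝ) =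
      T * (⌈(t : ℝ) * 2 ^ m / T⌉₊ : ℝ) / 2 ^ m := by
    show T * ((min ⌈(t : ℝ) * 2 ^ m / T⌉₊ (2 ^ m) : ℕ) : ℝ) / 2 ^ m = _
    rw [min_eq_left hle]
  have hp : (0 : ℝ) ≤ (t : ℝ) * 2 ^ m / T := by have := t.2.1; positivity
  constructor
  · rw [← Subtype.coe_le_coe, e, le_div_iff₀ (by positivity)]
    have := Nat.le_ceil ((t : ℝ) * 2 ^ m / T)
    rw [div_le_iff₀ h] at this; linarith
  · rw [e, div_le_iff₀ (by positivity), add_mul, div_mul_cancel₀ _ (by positivity)]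
    have := (Nat.ceil_lt_add_one hp).le
    calc T * (⌈(t : ℝ) * 2 ^ m / T⌉₊ : ℝ) ≤ T * ((t : ℝ) * 2 ^ m / T + 1) := by gcongr
      _ = _ := by field_simp

lemma exists_grid_between {a b : TimeInterval T} (hab : a < b) :
    ∃ m j, a < grid m j ∧ grid m j < b := by
  obtain ⟨c, hac, hcb⟩ := exists_between hab
  have h0 := hT.out
  have h1 : Tendsto (fun m : ℕ => (c : ℝ) + T / 2 ^ m) atTop (𝓝 (c + 0)) := by
    refine tendsto_const_nhds.add ?_
    have := (tendsto_pow_atTop_nhds_zero_of_lt_one (r := (1 / 2 : ℝ)) (by norm_num)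
      (by norm_num)).const_mul T
    simpa [div_eq_mul_inv] using this
  rw [add_zero] at h1
  obtain ⟨m, hm⟩ := (h1.eventually (gt_mem_nhds (Subtype.coe_lt_coe.2 hcb))).exists
  obtain ⟨h2, h3⟩ := exists_grid_ge c m
  exact ⟨m, _, hac.trans_le h2, Subtype.coe_lt_coe.1 (h3.trans_lt hm)⟩

lemma nhdsGT_neBot_of_lt_top {t : TimeInterval T} (ht : t < ⊤) : (𝓝[>] t).NeBot :=
  nhdsGT_neBot_of_exists_gt ⟨_, ht⟩

lemma frequently_grid {t : TimeInterval T} (ht : t < ⊤) :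
    ∃ᶠ s in 𝓝[>] t, ∃ m j, s = grid m j := by
  intro h
  obtain ⟨u, hu, hs⟩ := (mem_nhdsGT_iff_exists_Ioo_subset' ht).1 h
  obtain ⟨m, j, h1, h2⟩ := exists_grid_between hu
  exact hs ⟨h1, h2⟩ ⟨m, j, rfl⟩

variable {E : Type*} [NormedAddCommGroup E] {f g : TimeInterval T → E}

lemma IsCadlagPath.sub (hf : IsCadlagPath f) (hg : IsCadlagPath g) :
    IsCadlagPath (fun t => f t - g t) := fun t => by
  obtain ⟨h1, l, hl⟩ := hf t
  obtain ⟨h2, m, hm⟩ := hg t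
  exact ⟨h1.sub h2, _, hl.sub hm⟩

lemma IsCadlagPath.tendsto_nhdsGT (hf : IsCadlagPath f) (t : TimeInterval T) :
    Tendsto f (𝓝[>] t) (𝓝 (f t)) :=
  (hf t).1.mono_left (nhdsWithin_mono _ Ioi_subset_Ici_self)

/-- A closed condition on a right-continuous path need only be checked at grid points. -/
lemma forall_mem_of_forall_grid_mem {X : Type*} [TopologicalSpace X] {f : TimeInterval T → X}
    (hf : ∀ t, ContinuousWithinAt f (Ici t) t)
    {C : Set X} (hC : IsClosed C) (h : ∀ m j, f (grid m j) ∈ C) (t : TimeInterval T) :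
    f t ∈ C := by
  rcases (le_top : t ≤ ⊤).eq_or_lt with rfl | ht
  · rw [← grid_eq_top (le_refl (2 ^ 0))]; exact h _ _
  · have := nhdsGT_neBot_of_lt_top ht
    refine hC.mem_of_frequently_of_tendsto ((frequently_grid ht).mono ?_)
      ((hf t).mono_left (nhdsWithin_mono _ Ioi_subset_Ici_self))
    rintro s ⟨m, j, rfl⟩
    exact h m j

lemma IsCadlagPath.exists_norm_le (hf : IsCadlagPath f) : ∃ C, ∀ t, ‖f t‖ ≤ C := by
  have : ∃ C, ∀ t ∈ (univ : Set (TimeInterval T)), ‖f t‖ ≤ C := by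
    refine isCompact_univ.induction_on (p := fun s => ∃ C, ∀ t ∈ s, ‖f t‖ ≤ C) ⟨0, by simp⟩
      ?_ ?_ ?_
    · rintro s t hst ⟨C, hC⟩; exact ⟨C, fun u hu => hC u (hst hu)⟩
    · rintro s t ⟨C, hC⟩ ⟨D, hD⟩
      exact ⟨max C D, fun u hu => hu.elim (fun h => (hC u h).trans (le_max_left _ _))
        (fun h => (hD u h).trans (le_max_right _ _))⟩
    · intro t _
      obtain ⟨h1, l, hl⟩ := hf t
      have e1 : ∀ᶠ s in 𝓝[<] t, ‖f s‖ < ‖l‖ + 1 :=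
        hl.norm.eventually (gt_mem_nhds (lt_add_one _))
      have e2 : ∀ᶠ s in 𝓝[≥] t, ‖f s‖ < ‖f t‖ + 1 :=
        h1.norm.eventually (gt_mem_nhds (lt_add_one _))
      have e3 : ∀ᶠ s in 𝓝 t, ‖f s‖ < max (‖l‖ + 1) (‖f t‖ + 1) := by
        rw [← nhdsLT_sup_nhdsGE, eventually_sup]
        exact ⟨e1.mono fun s hs => hs.trans_le (le_max_left _ _),
          e2.mono fun s hs => hs.trans_le (le_max_right _ _)⟩
      rw [nhdsWithin_univ]
      exact ⟨_, e3, _, fun s hs => le_of_lt hs⟩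
  obtain ⟨C, hC⟩ := this
  exact ⟨C, fun t => hC t (mem_univ t)⟩

lemma IsCadlagPath.bddAbove_range_norm (hf : IsCadlagPath f) :
    BddAbove (range fun t => ‖f t‖) := by
  obtain ⟨C, hC⟩ := hf.exists_norm_le
  exact ⟨C, by rintro _ ⟨t, rfl⟩; exact hC t⟩

/-! ### The first time a path has moved by `ε` -/

/-- The first time after `s` at which the path `f` is at distance at least `ε` from `f s`. -/
noncomputable def nextMove (f : TimeInterval T → E) (ε : ℝ) (s : TimeInterval T) :
    TimeInterval T := sInf {t | s < t ∧ ε ≤ ‖f t - f s‖}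

variable {ε : ℝ} {s t : TimeInterval T}

lemma le_nextMove : s ≤ nextMove f ε s := le_sInf fun _ h => h.1.le

lemma norm_sub_lt_of_lt_nextMove (hε : 0 < ε) (hst : s ≤ t) (ht : t < nextMove f ε s) :
    ‖f t - f s‖ < ε := by
  rcases hst.eq_or_lt with rfl | hst
  · simpa using hε
  · by_contra! h
    exact notMem_of_lt_csInf ht (OrderBot.bddBelow _) ⟨hst, h⟩

lemma nextMove_eq_top (h : ∀ u, s ≤ u → ‖f u - f s‖ < ε) : nextMove f ε s = ⊤ := by
  have : {t | s < t ∧ ε ≤ ‖f t - f s‖} = ∅ := by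
    ext t; simp only [mem_ofPred_eq, mem_empty_iff_false, iff_false, not_and, not_le]
    exact fun ht => h t ht.le
  rw [nextMove, this, sInf_empty]

lemma IsCadlagPath.lt_nextMove (hf : IsCadlagPath f) (hε : 0 < ε) (hs : s < ⊤) :
    s < nextMove f ε s := by
  have h1 : Tendsto (fun t => ‖f t - f s‖) (𝓝[>] s) (𝓝 0) := by
    simpa using ((hf.tendsto_nhdsGT s).sub_const (f s)).norm
  obtain ⟨u, hu, hs'⟩ := (mem_nhdsGT_iff_exists_Ioo_subset' hs).1
    (h1.eventually (gt_mem_nhds hε))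
  refine lt_of_lt_of_le hu (le_sInf fun t ht => ?_)
  by_contra! htu
  exact absurd (hs' ⟨ht.1, htu⟩) (not_lt.2 ht.2)

/-- The infimum in the definition of `nextMove` is attained, by right-continuity. -/
lemma IsCadlagPath.le_norm_sub_nextMove (hf : IsCadlagPath f)
    (h : nextMove f ε s < ⊤) : ε ≤ ‖f (nextMove f ε s) - f s‖ := by
  set u := nextMove f ε s with hu
  by_contra! hlt
  have h1 : Tendsto (fun t => ‖f t - f s‖) (𝓝[≥] u) (𝓝 ‖f u - f s‖) :=
    (((hf u).1).sub_const (f s)).norm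
  obtain ⟨v, hv, hs'⟩ := (mem_nhdsGE_iff_exists_Ico_subset' h).1
    (h1.eventually (gt_mem_nhds hlt))
  obtain ⟨t, ht, htv⟩ := sInf_lt_iff.1 (show sInf {t | s < t ∧ ε ≤ ‖f t - f s‖} < v from hv)
  exact absurd (hs' ⟨sInf_le ht, htv⟩) (not_lt.2 ht.2)

lemma norm_sub_nextMove_le (hf : Continuous f) (hε : 0 < ε) :
    ‖f (nextMove f ε s) - f s‖ ≤ ε := by
  rcases (le_nextMove : s ≤ nextMove f ε s).eq_or_lt with h | h
  · rw [← h]; simpa using hε.le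
  · have : (𝓝[<] (nextMove f ε s)).NeBot := nhdsLT_neBot_of_exists_lt ⟨s, h⟩
    have h1 : Tendsto (fun t => ‖f t - f s‖) (𝓝[<] (nextMove f ε s))
        (𝓝 ‖f (nextMove f ε s) - f s‖) :=
      ((hf.continuousAt.mono_left nhdsWithin_le_nhds).sub_const (f s)).norm
    refine le_of_tendsto h1 ?_
    filter_upwards [Ioo_mem_nhdsLT h] with t ht
    exact (norm_sub_lt_of_lt_nextMove hε ht.1.le ht.2).le

end Grid

section MoveTime

variable {Ω : Type*} {T : ℝ} [hT : Fact ((0 : ℝ) ≤ T)] {d : ℕ} {S : TimeInterval T → Ω → Euc d}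
  {ε : ℝ} {ω : Ω} {n : ℕ}

lemma moveTime_succ (S : TimeInterval T → Ω → Euc d) (ε : ℝ) (n : ℕ) (ω : Ω) :
    moveTime S ε (n + 1) ω = nextMove (fun t => S t ω) ε (moveTime S ε n ω) := rfl

lemma moveTime_mono (S : TimeInterval T → Ω → Euc d) (ε : ℝ) (ω : Ω) :
    Monotone fun n => moveTime S ε n ω :=
  monotone_nat_of_le_succ fun _ => le_nextMove

lemma exists_moveTime_eq_top (hf : IsCadlagPath fun t => S t ω) (hε : 0 < ε) :
    ∃ n, moveTime S ε n ω = ⊤ := by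
  by_contra! hne
  set a := fun n => moveTime S ε n ω with ha
  have hlt : ∀ n, a n < ⊤ := fun n => lt_top_iff_ne_top.2 (hne n)
  have hsm : StrictMono a := strictMono_nat_of_lt_succ fun n => hf.lt_nextMove hε (hlt n)
  have hlim := tendsto_atTop_iSup hsm.monotone
  have hlim' : Tendsto a atTop (𝓝[<] (⨆ n, a n)) :=
    tendsto_nhdsWithin_iff.2 ⟨hlim, Eventually.of_forall fun n =>
      (hsm n.lt_succ_self).trans_le (le_iSup a _)⟩
  obtain ⟨-, l, hl⟩ := hf (⨆ n, a n)
  have h1 := hl.comp hlim'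
  have h2 := ((h1.comp (tendsto_add_atTop_nat 1)).sub h1).norm
  rw [sub_self, norm_zero] at h2
  refine absurd (ge_of_tendsto h2 (Eventually.of_forall fun n => ?_)) (not_le.2 hε)
  exact hf.le_norm_sub_nextMove (s := a n) (hlt (n + 1))

/-- Every time before `T` lies between two successive `moveTime`s. -/
lemma exists_moveTime_le_lt (hf : IsCadlagPath fun t => S t ω) (hε : 0 < ε) {t : TimeInterval T}
    (ht : t < ⊤) : ∃ n, moveTime S ε n ω ≤ t ∧ t < moveTime S ε (n + 1) ω := by
  obtain ⟨N, hN⟩ := exists_moveTime_eq_top hf hε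
  have hex : ∃ n, t < moveTime S ε n ω := ⟨N, by rw [hN]; exact ht⟩
  classical
  obtain ⟨n, hn⟩ : ∃ n, Nat.find hex = n + 1 := by
    refine Nat.exists_eq_succ_of_ne_zero fun h => ?_
    have := Nat.find_spec hex
    rw [h] at this
    exact not_lt_bot this
  refine ⟨n, not_lt.1 (Nat.find_min hex (by omega)), ?_⟩
  rw [← hn]; exact Nat.find_spec hex

end MoveTime

/-! ### Stopping times under the usual conditions -/

/-- `τ` is a stopping time with values in `[0, T]`. -/
abbrev IsTime {Ω : Type*} {mΩ : MeasurableSpace Ω} {T : ℝ} (F : Filtration (TimeInterval T) mΩ)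
    (τ : Ω → TimeInterval T) : Prop :=
  IsStoppingTime F fun ω => (τ ω : WithTop (TimeInterval T))

section Stopping

variable {Ω : Type*} {mΩ : MeasurableSpace Ω} {T : ℝ} [hT : Fact ((0 : ℝ) ≤ T)]
  {F : Filtration (TimeInterval T) mΩ} {P : Measure Ω} {τ σ τ' : Ω → TimeInterval T}

lemma isTime_iff : IsTime F τ ↔ ∀ i, MeasurableSet[F i] {ω | τ ω ≤ i} := by
  simp only [IsTime, IsStoppingTime, WithTop.coe_le_coe]

lemma IsTime.measurableSet_iff (hτ : IsTime F τ) {s : Set Ω} :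
    MeasurableSet[hτ.measurableSpace] s ↔ ∀ i, MeasurableSet[F i] (s ∩ {ω | τ ω ≤ i}) := by
  rw [IsStoppingTime.measurableSet]
  simp only [WithTop.coe_le_coe]
  refine ⟨fun h => h.2, fun h => ⟨?_, h⟩⟩
  have := h ⊤
  simp only [le_top, ofPred_true, inter_univ] at this
  exact le_iSup F ⊤ _ this

lemma IsTime.le (hτ : IsTime F τ) (i : TimeInterval T) : MeasurableSet[F i] {ω | τ ω ≤ i} :=
  isTime_iff.1 hτ i

lemma IsTime.measurable_min (hτ : IsTime F τ) (i : TimeInterval T) :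
    Measurable[F i] fun ω => min (τ ω) i := by
  refine measurable_of_Iic fun j => ?_
  rcases le_total i j with h | h
  · have : (fun ω => min (τ ω) i) ⁻¹' Iic j = univ := by
      ext ω; simp [h]
    rw [this]; exact @MeasurableSet.univ _ (F i)
  · rcases h.eq_or_lt with rfl | h
    · have : (fun ω => min (τ ω) j) ⁻¹' Iic j = univ := by
        ext ω; simp
      rw [this]; exact @MeasurableSet.univ _ (F j)
    have : (fun ω => min (τ ω) i) ⁻¹' Iic j = {ω | τ ω ≤ j} := by
      ext ω; simp [not_le.2 h]
    rw [this]; exact F.mono h.le _ (hτ.le j)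

lemma IsTime.measurable (hτ : IsTime F τ) : Measurable τ := by
  have := (hτ.measurable_min ⊤).mono (F.le ⊤) le_rfl
  simpa using this

lemma UsualConditions.measurableSet_congr (hF : UsualConditions F P) {i : TimeInterval T}
    {s t : Set Ω} (hs : MeasurableSet[F i] s) (hst : ∀ᵐ ω ∂P, ω ∈ s ↔ ω ∈ t) :
    MeasurableSet[F i] t := by
  have h1 : MeasurableSet[F i] (s \ t) := F.mono bot_le _ (hF.complete _ (by
    refine measure_mono_null (fun ω hω => ?_) hst
    exact fun h => hω.2 (h.1 hω.1)))
  have h2 : MeasurableSet[F i] (t \ s) := F.mono bot_le _ (hF.complete _ (by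
    refine measure_mono_null (fun ω hω => ?_) hst
    exact fun h => hω.2 (h.2 hω.1)))
  have : t = (s \ (s \ t)) ∪ (t \ s) := by ext ω; simp only [mem_union, Set.mem_sdiff]; tauto
  rw [this]
  exact (hs.diff h1).union h2

lemma UsualConditions.isTime_congr (hF : UsualConditions F P) (hτ : IsTime F τ)
    (h : τ =ᵐ[P] τ') : IsTime F τ' := by
  refine isTime_iff.2 fun i => hF.measurableSet_congr (hτ.le i) ?_
  filter_upwards [h] with ω hω
  simp [hω]

lemma UsualConditions.measurableSpace_congr (hF : UsualConditions F P) (hτ : IsTime F τ)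
    (hτ' : IsTime F τ') (h : τ =ᵐ[P] τ') : hτ.measurableSpace = hτ'.measurableSpace := by
  ext s
  rw [hτ.measurableSet_iff, hτ'.measurableSet_iff]
  have h' : ∀ i, ∀ᵐ ω ∂P, ω ∈ s ∩ {ω | τ ω ≤ i} ↔ ω ∈ s ∩ {ω | τ' ω ≤ i} := fun i => by
    filter_upwards [h] with ω hω
    simp [hω]
  exact ⟨fun hs i => hF.measurableSet_congr (hs i) (h' i),
    fun hs i => hF.measurableSet_congr (hs i) ((h' i).mono fun _ h => h.symm)⟩

/-- Under the usual conditions strict inequalities suffice to recognise a stopping time. The last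
time `⊤` is isolated from the right and needs its own argument. -/
lemma UsualConditions.isTime_of_lt (hF : UsualConditions F P)
    (h : ∀ i, MeasurableSet[F i] {ω | τ ω < i}) : IsTime F τ := by
  have := hF.rightContinuous
  refine isStoppingTime_of_measurableSet_lt_of_isRightContinuous'
    (fun i => by simpa using h i) fun i hi => ?_
  have : i = ⊤ := by
    by_contra hne
    exact (nhdsGT_neBot_of_lt_top (lt_top_iff_ne_top.2 hne)).ne hi
  subst this
  have e : {ω | (τ ω : WithTop (TimeInterval T)) = ((⊤ : TimeInterval T) : WithTop _)} =
      {ω | τ ω < ⊤}ᶜ := by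
    ext ω; simp [lt_top_iff_ne_top]
  rw [e]
  exact (h ⊤).compl

lemma isTime_iSup {ρ : ℕ → Ω → TimeInterval T} (hρ : ∀ n, IsTime F (ρ n)) :
    IsTime F fun ω => ⨆ n, ρ n ω := by
  refine isTime_iff.2 fun i => ?_
  have : {ω | ⨆ n, ρ n ω ≤ i} = ⋂ n, {ω | ρ n ω ≤ i} := by
    ext ω; simp [iSup_le_iff]
  rw [this]
  exact MeasurableSet.iInter fun n => (hρ n).le i

variable {d : ℕ} {X : TimeInterval T → Ω → Euc d}

lemma tendsto_grid_ceil (t : TimeInterval T) :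
    Tendsto (fun m : ℕ => (grid m ⌈(t : ℝ) * 2 ^ m / T⌉₊ : TimeInterval T)) atTop (𝓝 t) := by
  rw [tendsto_subtype_rng]
  have h1 : Tendsto (fun m : ℕ => (t : ℝ) + T / 2 ^ m) atTop (𝓝 (t + 0)) := by
    refine tendsto_const_nhds.add ?_
    have := (tendsto_pow_atTop_nhds_zero_of_lt_one (r := (1 / 2 : ℝ)) (by norm_num)
      (by norm_num)).const_mul T
    simpa [div_eq_mul_inv] using this
  rw [add_zero] at h1
  exact tendsto_of_tendsto_of_tendsto_of_le_of_le tendsto_const_nhds h1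
    (fun m => Subtype.coe_le_coe.2 (exists_grid_ge t m).1) fun m => (exists_grid_ge t m).2

lemma measurable_eval_nat {α β : Type*} {m : MeasurableSpace α} {mβ : MeasurableSpace β}
    {f : ℕ → α → β} (hf : ∀ j, Measurable (f j)) {N : α → ℕ} (hN : Measurable N) :
    Measurable fun a => f (N a) a :=
  (measurable_from_prod_countable_right (f := fun p : ℕ × α => f p.1 p.2) hf).comp
    (hN.prodMk measurable_id)

/-- A right-continuous adapted process evaluated at an `F_t`-measurable time before `t` is
`F_t`-measurable. -/
lemma measurable_eval_of_le (hX : Adapted F X)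
    (hc : ∀ ω t, ContinuousWithinAt (fun t => X t ω) (Ici t) t) {t : TimeInterval T}
    {ρ : Ω → TimeInterval T} (hρ : Measurable[F t] ρ) (hle : ∀ ω, ρ ω ≤ t) :
    Measurable[F t] fun ω => X (ρ ω) ω := by
  refine @measurable_of_tendsto_metrizable _ _ (F t) _ _ _ _
    (fun m ω => X (min t (grid m ⌈(ρ ω : ℝ) * 2 ^ m / T⌉₊)) ω) _ (fun m => ?_) ?_
  · have h2 : Measurable[F t] fun ω => ⌈(ρ ω : ℝ) * 2 ^ m / T⌉₊ :=
      Nat.measurable_ceil.comp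
        ((((measurable_subtype_coe.comp hρ)).mul_const _).div_const _)
    exact measurable_eval_nat (f := fun j => X (min t (grid m j)))
      (fun j => (hX _).mono (F.mono (min_le_left _ _)) le_rfl) h2
  · refine tendsto_pi_nhds.2 fun ω => ?_
    refine (hc ω (ρ ω)).tendsto.comp (tendsto_nhdsWithin_iff.2 ⟨?_, Eventually.of_forall fun m =>
      le_min (hle ω) (exists_grid_ge _ m).1⟩)
    have := (tendsto_const_nhds (x := t)).min (tendsto_grid_ceil (ρ ω))
    rwa [min_eq_right (hle ω)] at this

lemma IsTime.measurable_stopped (hτ : IsTime F τ) (hX : Adapted F X)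
    (hc : ∀ ω t, ContinuousWithinAt (fun t => X t ω) (Ici t) t) :
    Measurable[hτ.measurableSpace] fun ω => X (τ ω) ω := by
  intro s hs
  refine hτ.measurableSet_iff.2 fun i => ?_
  have h := measurable_eval_of_le hX hc (hτ.measurable_min i) fun ω => min_le_right _ _
  have e : (fun ω => X (τ ω) ω) ⁻¹' s ∩ {ω | τ ω ≤ i} =
      (fun ω => X (min (τ ω) i) ω) ⁻¹' s ∩ {ω | τ ω ≤ i} := by
    ext ω
    simp only [mem_inter_iff, mem_preimage, mem_ofPred_eq, and_congr_left_iff]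
    intro h; rw [min_eq_left h]
  rw [e]
  exact (h hs).inter (hτ.le i)

/-- The entrance time into an open set is a stopping time. -/
lemma UsualConditions.isTime_sInf_gt (hF : UsualConditions F P) (hX : Adapted F X)
    (hc : ∀ ω t, ContinuousWithinAt (fun t => X t ω) (Ici t) t)
    (hτ : IsTime F τ) (hσ : IsTime F σ) (hle : ∀ ω, τ ω ≤ σ ω) (r : ℝ) :
    IsTime F fun ω => sInf {t | σ ω ≤ t ∧ r < ‖X t ω - X (τ ω) ω‖} := by
  refine hF.isTime_of_lt fun i => ?_
  have e : {ω | sInf {t | σ ω ≤ t ∧ r < ‖X t ω - X (τ ω) ω‖} < i} =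
      ⋃ m : ℕ, ⋃ j : ℕ, {ω | grid m j < i ∧ (σ ω ≤ grid m j ∧
        r < ‖X (grid m j) ω - X (min (τ ω) (grid m j)) ω‖)} := by
    ext ω
    simp only [mem_ofPred_eq, mem_iUnion, sInf_lt_iff]
    constructor
    · rintro ⟨u, ⟨hu, hr⟩, hui⟩
      have h1 : ∀ᶠ s in 𝓝[>] u, r < ‖X s ω - X (τ ω) ω‖ :=
        (((hc ω u).mono_left (nhdsWithin_mono _ Ioi_subset_Ici_self)).sub_const _).norm.eventually
          (lt_mem_nhds hr)
      have h2 : ∀ᶠ s in 𝓝[>] u, s ∈ Ioo u i := Ioo_mem_nhdsGT hui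
      obtain ⟨s, ⟨m, j, rfl⟩, hs1, hs2⟩ :=
        ((frequently_grid (hui.trans_le le_top)).and_eventually (h1.and h2)).exists
      refine ⟨m, j, hs2.2, hu.trans hs2.1.le, ?_⟩
      rwa [min_eq_left ((hle ω).trans (hu.trans hs2.1.le))]
    · rintro ⟨m, j, hi, hs, hr⟩
      rw [min_eq_left ((hle ω).trans hs)] at hr
      exact ⟨_, ⟨hs, hr⟩, hi⟩
  rw [e]
  refine MeasurableSet.iUnion fun m => MeasurableSet.iUnion fun j => ?_
  by_cases hij : grid (T := T) m j < i
  · simp only [hij, true_and]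
    refine F.mono hij.le _ (MeasurableSet.inter (hσ.le _) ?_)
    have h := measurable_eval_of_le hX hc (hτ.measurable_min (grid m j)) fun ω => min_le_right _ _
    exact measurableSet_lt (@measurable_const _ _ _ (F (grid m j)) r)
      (measurable_norm.comp ((hX _).sub h))
  · simp [hij]

/-- The first time a càdlàg adapted process has moved by `ε` is a stopping time. It is the début of
a closed set, hence not directly a limit of hitting times of open sets; instead, the largest
stopping time below it (up to null sets) is shown to be equal to it. -/
lemma UsualConditions.isTime_nextMove [IsProbabilityMeasure P] (hF : UsualConditions F P)
    (hX : Adapted F X)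
    (hc : ∀ ω, IsCadlagPath fun t => X t ω) (hτ : IsTime F τ) {ε : ℝ} (hε : 0 < ε) :
    IsTime F fun ω => nextMove (fun t => X t ω) ε (τ ω) := by
  set D : Ω → TimeInterval T := fun ω => nextMove (fun t => X t ω) ε (τ ω) with hD
  have hcr : ∀ ω t, ContinuousWithinAt (fun t => X t ω) (Ici t) t := fun ω t => (hc ω t).1
  let C : Set (Ω → TimeInterval T) := {σ | IsTime F σ ∧ (∀ ω, τ ω ≤ σ ω) ∧ ∀ ω, σ ω ≤ D ω}
  have hτC : τ ∈ C := ⟨hτ, fun _ => le_rfl, fun _ => le_nextMove⟩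
  have hint : ∀ σ, IsTime F σ → Integrable (fun ω => (σ ω : ℝ)) P := fun σ hσ =>
    Integrable.of_bound (measurable_subtype_coe.comp hσ.measurable).aestronglyMeasurable T
      (ae_of_all _ fun ω => by
        rw [Real.norm_of_nonneg (σ ω).2.1]; exact (σ ω).2.2)
  set I : (Ω → TimeInterval T) → ℝ := fun σ => ∫ ω, (σ ω : ℝ) ∂P with hI
  have hbdd : BddAbove (I '' C) := by
    refine ⟨T, ?_⟩
    rintro _ ⟨σ, hσ, rfl⟩
    calc I σ ≤ ∫ _, T ∂P := integral_mono (hint σ hσ.1) (integrable_const _) fun ω => (σ ω).2.2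
      _ = T := by simp
  obtain ⟨u, -, hu, huC⟩ := exists_seq_tendsto_sSup (S := I '' C) ⟨_, τ, hτC, rfl⟩ hbdd
  choose ρ hρC hρ using huC
  set σ : Ω → TimeInterval T := fun ω => ⨆ n, ρ n ω with hσdef
  have hσC : σ ∈ C := ⟨isTime_iSup fun n => (hρC n).1,
    fun ω => ((hρC 0).2.1 ω).trans (le_iSup (fun n => ρ n ω) 0),
    fun ω => iSup_le fun n => (hρC n).2.2 ω⟩
  have hσmax : ∀ σ' ∈ C, I σ' ≤ I σ := fun σ' hσ' => by
    refine (le_csSup hbdd ⟨σ', hσ', rfl⟩).trans (le_of_tendsto hu (Eventually.of_forall fun n => ?_))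
    rw [← hρ n]
    exact integral_mono (hint _ (hρC n).1) (hint _ hσC.1) fun ω => le_iSup (fun n => ρ n ω) n
  set E : ℕ → Ω → TimeInterval T := fun k ω =>
    sInf {t | σ ω ≤ t ∧ ε - 1 / (k + 1) < ‖X t ω - X (τ ω) ω‖} with hE
  have hσE : ∀ k ω, σ ω ≤ E k ω := fun k ω => le_sInf fun _ h => h.1
  have hED : ∀ k ω, E k ω ≤ D ω := fun k ω => by
    rcases (le_top : D ω ≤ ⊤).eq_or_lt with h | h
    · rw [h]; exact le_top
    · refine sInf_le ⟨hσC.2.2 ω, ?_⟩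
      have := (hc ω).le_norm_sub_nextMove (s := τ ω) h
      have h1 : (0 : ℝ) < 1 / (k + 1) := by positivity
      exact (by linarith : ε - 1 / ((k : ℝ) + 1) < ε).trans_le this
  have hEC : (fun ω => ⨆ k, E k ω) ∈ C := ⟨isTime_iSup fun k =>
      hF.isTime_sInf_gt hX hcr hτ hσC.1 hσC.2.1 _,
    fun ω => (hσC.2.1 ω).trans ((hσE 0 ω).trans (le_iSup (fun k => E k ω) 0)),
    fun ω => iSup_le fun k => hED k ω⟩
  have hle : ∀ ω, (σ ω : ℝ) ≤ ((⨆ k, E k ω : TimeInterval T) : ℝ) := fun ω =>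
    Subtype.coe_le_coe.2 ((hσE 0 ω).trans (le_iSup (fun k => E k ω) 0))
  have heq : ∀ᵐ ω ∂P, (σ ω : ℝ) = ((⨆ k, E k ω : TimeInterval T) : ℝ) := by
    refine (integral_eq_iff_of_ae_le (hint _ hσC.1) (hint _ hEC.1) (ae_of_all _ hle)).1 ?_
    exact le_antisymm (integral_mono (hint _ hσC.1) (hint _ hEC.1) hle) (hσmax _ hEC)
  refine hF.isTime_congr hσC.1 ?_
  filter_upwards [heq] with ω hω
  have hω' : σ ω = ⨆ k, E k ω := Subtype.ext hω
  refine le_antisymm (hσC.2.2 ω) ?_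
  rcases (le_top : σ ω ≤ ⊤).eq_or_lt with h | h
  · rw [h]; exact le_top
  have hEk : ∀ k, E k ω = σ ω := fun k =>
    le_antisymm (by rw [hω']; exact le_iSup (fun k => E k ω) k) (hσE k ω)
  have hk : ∀ k : ℕ, ε - 1 / ((k : ℝ) + 1) ≤ ‖X (σ ω) ω - X (τ ω) ω‖ := fun k => by
    by_contra! hlt
    have h1 : ∀ᶠ t in 𝓝[≥] (σ ω), ‖X t ω - X (τ ω) ω‖ < ε - 1 / ((k : ℝ) + 1) :=
      (((hcr ω (σ ω))).sub_const (X (τ ω) ω)).norm.eventually (gt_mem_nhds hlt)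
    obtain ⟨v, hv, hs'⟩ := (mem_nhdsGE_iff_exists_Ico_subset' h).1 h1
    have h2 : E k ω < v := by rw [hEk]; exact hv
    obtain ⟨t, ht, htv⟩ := sInf_lt_iff.1 h2
    exact lt_asymm (hs' ⟨ht.1, htv⟩) ht.2
  have hε' : ε ≤ ‖X (σ ω) ω - X (τ ω) ω‖ := by
    refine le_of_tendsto (x := atTop) ?_ (Eventually.of_forall hk)
    simpa using (tendsto_one_div_add_atTop_nhds_zero_nat (𝕜 := ℝ)).const_sub ε
  refine sInf_le ⟨(hσC.2.1 ω).lt_of_ne fun h => ?_, hε'⟩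
  rw [← h] at hε'
  simp only [sub_self, norm_zero] at hε'
  exact absurd hε (not_lt.2 hε')

lemma UsualConditions.isTime_moveTime [IsProbabilityMeasure P] (hF : UsualConditions F P)
    (hX : Adapted F X) (hc : ∀ ω, IsCadlagPath fun t => X t ω) {ε : ℝ} (hε : 0 < ε) (n : ℕ) :
    IsTime F (moveTime X ε n) := by
  induction n with
  | zero => exact isStoppingTime_const F ⊥
  | succ n ih => exact hF.isTime_nextMove hX hc ih hε

end Stopping

/-! ### Oscillation counts of square-integrable martingales -/

/-- The last recorded value of the sequence `x`: a new value is recorded each time the sequence is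
at distance at least `η` from the recorded one. -/
noncomputable def oscRef (η : ℝ) (x : ℕ → ℝ) : ℕ → ℝ
  | 0 => x 0
  | n + 1 => if η ≤ |x (n + 1) - oscRef η x n| then x (n + 1) else oscRef η x n

/-- The number of values recorded by `oscRef` up to time `n`, after the initial one. -/
noncomputable def oscCount (η : ℝ) (x : ℕ → ℝ) : ℕ → ℕ
  | 0 => 0
  | n + 1 => if η ≤ |x (n + 1) - oscRef η x n| then oscCount η x n + 1 else oscCount η x n

section Osc

variable {η : ℝ} {x : ℕ → ℝ}

lemma oscRef_succ (η : ℝ) (x : ℕ → ℝ) (n : ℕ) : oscRef η x (n + 1) =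
    if η ≤ |x (n + 1) - oscRef η x n| then x (n + 1) else oscRef η x n := rfl

lemma oscCount_succ (η : ℝ) (x : ℕ → ℝ) (n : ℕ) : oscCount η x (n + 1) =
    if η ≤ |x (n + 1) - oscRef η x n| then oscCount η x n + 1 else oscCount η x n := rfl

lemma abs_sub_oscRef_lt (hη : 0 < η) (n : ℕ) : |x n - oscRef η x n| < η := by
  cases n with
  | zero => simpa [oscRef] using hη
  | succ n =>
    rw [oscRef_succ]
    split_ifs with h
    · simpa using hη
    · exact not_le.1 h

lemma oscCount_mono (η : ℝ) (x : ℕ → ℝ) : Monotone (oscCount η x) := by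
  refine monotone_nat_of_le_succ fun n => ?_
  rw [oscCount_succ]; split_ifs <;> omega

lemma oscRef_eq_of_oscCount_eq {i j : ℕ} (hij : i ≤ j) (h : oscCount η x i = oscCount η x j) :
    oscRef η x i = oscRef η x j := by
  induction j, hij using Nat.le_induction with
  | base => rfl
  | succ j hij ih =>
    have h1 := oscCount_mono η x hij
    rw [oscCount_succ] at h
    rw [oscRef_succ]
    split_ifs at h ⊢ with hc
    · omega
    · exact ih h

/-- An oscillation by `2 * η` between two times forces a new recorded value in between. -/
lemma oscCount_lt_of_le_abs_sub (hη : 0 < η) {i j : ℕ} (hij : i ≤ j)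
    (h : 2 * η ≤ |x j - x i|) : oscCount η x i < oscCount η x j := by
  refine (oscCount_mono η x hij).lt_of_ne fun he => ?_
  have h1 := oscRef_eq_of_oscCount_eq hij he
  have h2 := abs_sub_oscRef_lt (x := x) hη i
  have h3 := abs_sub_oscRef_lt (x := x) hη j
  rw [← h1] at h3
  rw [abs_lt] at h2 h3
  rcases abs_cases (x j - x i) with h4 | h4 <;> linarith

/-- Pathwise energy estimate: up to a martingale transform, `η ^ 2` times the number of recorded
values is bounded by the final square. -/
lemma oscCount_energy (hη : 0 < η) (n : ℕ) :
    η ^ 2 * oscCount η x n + (x n - oscRef η x n) ^ 2 ≤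
      x n ^ 2 - 2 * ∑ j ∈ Finset.range n, oscRef η x j * (x (j + 1) - x j) := by
  induction n with
  | zero =>
    simp only [oscCount, oscRef, Nat.cast_zero, Finset.range_zero, Finset.sum_empty]
    nlinarith [sq_nonneg (x 0)]
  | succ n ih =>
    rw [Finset.sum_range_succ, oscCount_succ, oscRef_succ]
    split_ifs with h
    · have h2 : η ^ 2 ≤ (x (n + 1) - oscRef η x n) ^ 2 := by
        rw [← sq_abs (x (n + 1) - oscRef η x n)]
        exact pow_le_pow_left₀ hη.le h 2
      push_cast
      nlinarith
    · nlinarith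

variable {Ω : Type*} {mΩ : MeasurableSpace Ω} {P : Measure Ω} {M : ℕ → Ω → ℝ}

lemma measurable_oscRef {m : MeasurableSpace Ω} (n : ℕ) (hM : ∀ j ≤ n, Measurable (M j)) :
    Measurable fun ω => oscRef η (fun j => M j ω) n := by
  induction n with
  | zero => exact hM 0 le_rfl
  | succ n ih =>
    have ih' := ih fun j hj => hM j (hj.trans n.le_succ)
    simp only [oscRef_succ]
    exact Measurable.ite (measurableSet_le measurable_const
      (continuous_abs.measurable.comp ((hM _ le_rfl).sub ih'))) (hM _ le_rfl) ih'

lemma measurable_oscCount {m : MeasurableSpace Ω} (n : ℕ) (hM : ∀ j, Measurable (M j)) :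
    Measurable fun ω => oscCount η (fun j => M j ω) n := by
  induction n with
  | zero => exact measurable_const
  | succ n ih =>
    simp only [oscCount_succ]
    exact Measurable.ite (measurableSet_le measurable_const
      (continuous_abs.measurable.comp ((hM _).sub (measurable_oscRef n fun j _ => hM j))))
      (ih.add_const 1) ih

lemma memLp_oscRef (hM : ∀ j, Measurable (M j)) (hM2 : ∀ j, MemLp (M j) 2 P) (n : ℕ) :
    MemLp (fun ω => oscRef η (fun j => M j ω) n) 2 P := by
  induction n with
  | zero => exact hM2 0
  | succ n ih =>
    set s := {ω | η ≤ |M (n + 1) ω - oscRef η (fun j => M j ω) n|} with hs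
    have hsm : MeasurableSet s := measurableSet_le measurable_const
      (continuous_abs.measurable.comp ((hM _).sub (measurable_oscRef n fun j _ => hM j)))
    have : (fun ω => oscRef η (fun j => M j ω) (n + 1)) =
        s.indicator (M (n + 1)) + sᶜ.indicator fun ω => oscRef η (fun j => M j ω) n := by
      ext ω
      by_cases h : ω ∈ s
      · have h' : η ≤ |M (n + 1) ω - oscRef η (fun j => M j ω) n| := h
        simp [oscRef_succ, h, h']
      · have h' : ¬ η ≤ |M (n + 1) ω - oscRef η (fun j => M j ω) n| := h
        simp [oscRef_succ, h, h']
    rw [this]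
    exact ((hM2 _).indicator hsm).add (ih.indicator hsm.compl)

/-- The expected number of oscillations of size `η` of a martingale with terminal value `X` in
`L²` is at most `E[X ^ 2] / η ^ 2`. -/
lemma lintegral_oscCount_le [IsProbabilityMeasure P] (hη : 0 < η) {X : Ω → ℝ} (hX : MemLp X 2 P)
    {G : ℕ → MeasurableSpace Ω} (hGle : ∀ j, G j ≤ mΩ) (hG : Monotone G)
    (hM : ∀ j, Measurable[G j] (M j)) (hMX : ∀ j, M j =ᵐ[P] P[X|G j]) (n : ℕ) :
    ∫⁻ ω, (oscCount η (fun j => M j ω) n : ENNReal) ∂P ≤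
      ENNReal.ofReal ((∫ ω, X ω ^ 2 ∂P) / η ^ 2) := by
  have hM' : ∀ j, Measurable (M j) := fun j => (hM j).mono (hGle j) le_rfl
  have hM2 : ∀ j, MemLp (M j) 2 P := fun j =>
    (hX.condExp (m := G j) (by norm_num)).ae_eq (hMX j).symm
  have hX1 : Integrable X P := hX.integrable (by norm_num)
  set R : ℕ → Ω → ℝ := fun j ω => oscRef η (fun j => M j ω) j with hR
  have hRm : ∀ j, Measurable[G j] (R j) := fun j => measurable_oscRef (m := G j) j fun i hi =>
    (hM i).mono (hG hi) le_rfl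
  have hR2 : ∀ j, MemLp (R j) 2 P := memLp_oscRef hM' hM2
  -- the transform has mean zero
  have key : ∀ j i, j ≤ i → ∫ ω, R j ω * M i ω ∂P = ∫ ω, R j ω * X ω ∂P := by
    intro j i hji
    have h1 : P[R j * X|G i] =ᵐ[P] R j * P[X|G i] :=
      condExp_mul_of_stronglyMeasurable_left ((hRm j).mono (hG hji) le_rfl).stronglyMeasurable
        ((hR2 j).integrable_mul hX) hX1
    have h2 : ∫ ω, (P[R j * X|G i]) ω ∂P = ∫ ω, (R j * X) ω ∂P := integral_condExp (hGle i)
    rw [show ∫ ω, R j ω * X ω ∂P = ∫ ω, (R j * X) ω ∂P from rfl, ← h2]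
    refine integral_congr_ae ?_
    filter_upwards [h1, hMX i] with ω h1 h2
    rw [h1, h2]; rfl
  have hterm : ∀ j, Integrable (fun ω => R j ω * (M (j + 1) ω - M j ω)) P := fun j =>
    (hR2 j).integrable_mul ((hM2 _).sub (hM2 j))
  have hcm : Measurable fun ω => (oscCount η (fun j => M j ω) n : ℝ) :=
    measurable_from_nat.comp (measurable_oscCount n hM')
  have hMn : Integrable (fun ω => M n ω ^ 2) P := (hM2 n).integrable_sq
  have hsum : Integrable (fun ω => ∑ j ∈ Finset.range n, R j ω * (M (j + 1) ω - M j ω)) P :=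
    integrable_finsetSum _ fun j _ => hterm j
  have hle : ∀ ω, η ^ 2 * (oscCount η (fun j => M j ω) n : ℝ) ≤
      M n ω ^ 2 - 2 * ∑ j ∈ Finset.range n, R j ω * (M (j + 1) ω - M j ω) := fun ω => by
    have := oscCount_energy (x := fun j => M j ω) hη n
    have h2 := sq_nonneg (M n ω - oscRef η (fun j => M j ω) n)
    linarith
  have hci : Integrable (fun ω => η ^ 2 * (oscCount η (fun j => M j ω) n : ℝ)) P := by
    refine (hMn.sub (hsum.const_mul 2)).mono' (hcm.const_mul _).aestronglyMeasurable
      (ae_of_all _ fun ω => ?_)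
    rw [Real.norm_of_nonneg (by positivity)]
    exact hle ω
  have hint : ∫ ω, η ^ 2 * (oscCount η (fun j => M j ω) n : ℝ) ∂P ≤ ∫ ω, X ω ^ 2 ∂P := by
    calc _ ≤ ∫ ω, (M n ω ^ 2 - 2 * ∑ j ∈ Finset.range n, R j ω * (M (j + 1) ω - M j ω)) ∂P :=
          integral_mono hci (hMn.sub (hsum.const_mul 2)) hle
      _ = ∫ ω, M n ω ^ 2 ∂P := by
          rw [integral_sub hMn (hsum.const_mul 2), integral_const_mul,
            integral_finsetSum _ fun j _ => hterm j, Finset.sum_eq_zero, mul_zero, sub_zero]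
          intro j _
          simp only [mul_sub]
          have hi : ∀ i, Integrable (fun ω => R j ω * M i ω) P := fun i =>
            (hR2 j).integrable_mul (hM2 i)
          rw [integral_sub (hi _) (hi _), key j _ j.le_succ, key j j le_rfl, sub_self]
      _ ≤ ∫ ω, X ω ^ 2 ∂P := by
          have h1 : (fun ω => (P[X|G n]) ω ^ 2) ≤ᵐ[P] P[fun ω => X ω ^ 2|G n] :=
            ConvexOn.map_condExp_le_univ (φ := fun y : ℝ => y ^ 2) (hGle n)
              (Even.convexOn_pow (by decide)) (continuous_pow 2).lowerSemicontinuous hX1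
              hX.integrable_sq
          calc ∫ ω, M n ω ^ 2 ∂P ≤ ∫ ω, (P[fun ω => X ω ^ 2|G n]) ω ∂P := by
                refine integral_mono_ae hMn integrable_condExp ?_
                filter_upwards [h1, hMX n] with ω h1 h2
                rw [h2]; exact h1
            _ = _ := integral_condExp (hGle n)
  have hci' : Integrable (fun ω => (oscCount η (fun j => M j ω) n : ℝ)) P := by
    have := hci.const_mul (η ^ 2)⁻¹
    refine this.congr (ae_of_all _ fun ω => ?_)
    field_simp
  have e : ∫⁻ ω, (oscCount η (fun j => M j ω) n : ENNReal) ∂P =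
      ENNReal.ofReal (∫ ω, (oscCount η (fun j => M j ω) n : ℝ) ∂P) := by
    rw [ofReal_integral_eq_lintegral_ofReal hci' (ae_of_all _ fun ω => by positivity)]
    simp
  rw [e]
  refine ENNReal.ofReal_le_ofReal ?_
  rw [le_div_iff₀ (by positivity), mul_comm, ← integral_const_mul]
  exact hint

end Osc

/-! ### Càdlàg versions of closed martingales -/

/-- The union of all grids, a countable dense subset of `[0, T]`. -/
def gridPts (T : ℝ) [Fact ((0 : ℝ) ≤ T)] : Set (TimeInterval T) := {t | ∃ m j, t = grid m j}

section Regularize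

variable {T : ℝ} [hT : Fact ((0 : ℝ) ≤ T)] {f : TimeInterval T → ℝ} {η : ℝ}

/-- The number of `η`-oscillations of `f` along the grid of mesh `T / 2 ^ m`, up to index `j`. -/
noncomputable def gridCount (f : TimeInterval T → ℝ) (η : ℝ) (m j : ℕ) : ℕ :=
  oscCount η (fun j => f (grid m j)) j

/-- On all fine grids, `f` has at least `k` oscillations of size `η` within `(a, b)`. -/
def HasOsc (f : TimeInterval T → ℝ) (η : ℝ) (k : ℕ) (a b : TimeInterval T) : Prop :=
  ∃ m₀, ∀ m ≥ m₀, ∃ i i', i ≤ i' ∧ a < grid m i ∧ grid m i' < b ∧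
    gridCount f η m i + k ≤ gridCount f η m i'

lemma hasOsc_one (hη : 0 < η) {a b x y : TimeInterval T} (hx : x ∈ gridPts T) (hy : y ∈ gridPts T)
    (hax : a < x) (hay : a < y) (hxb : x < b) (hyb : y < b) (h : 2 * η ≤ |f x - f y|) :
    HasOsc f η 1 a b := by
  wlog hxy : x ≤ y generalizing x y
  · exact this hy hx hay hax hyb hxb (by rwa [abs_sub_comm]) (le_of_not_ge hxy)
  obtain ⟨m₁, j₁, rfl⟩ := hx
  obtain ⟨m₂, j₂, rfl⟩ := hy
  refine ⟨max m₁ m₂, fun m hm => ?_⟩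
  have e1 := grid_eq_grid (T := T) ((le_max_left _ _).trans hm) j₁
  have e2 := grid_eq_grid (T := T) ((le_max_right _ _).trans hm) j₂
  set i := j₁ * 2 ^ (m - m₁)
  set i' := j₂ * 2 ^ (m - m₂)
  rw [e1] at hax h hxy
  rw [e2] at hyb h hxy
  have hii : i ≤ i' := by
    by_contra! hlt
    have := le_antisymm hxy (grid_mono m hlt.le)
    rw [this] at h
    simp only [sub_self, abs_zero] at h
    linarith
  refine ⟨i, i', hii, hax, hyb, ?_⟩
  rw [abs_sub_comm] at h
  exact oscCount_lt_of_le_abs_sub hη hii h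

lemma HasOsc.add {k l : ℕ} {a b c : TimeInterval T} (h1 : HasOsc f η k a b)
    (h2 : HasOsc f η l b c) : HasOsc f η (k + l) a c := by
  obtain ⟨m₁, h1⟩ := h1
  obtain ⟨m₂, h2⟩ := h2
  refine ⟨max m₁ m₂, fun m hm => ?_⟩
  obtain ⟨i, i', hi, ha, hb, hc⟩ := h1 m ((le_max_left _ _).trans hm)
  obtain ⟨j, j', hj, hb', hc', hd⟩ := h2 m ((le_max_right _ _).trans hm)
  have hij : i' ≤ j := by
    by_contra! hlt
    exact absurd ((hb.trans hb').trans_le (grid_mono m hlt.le)) (lt_irrefl _)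
  refine ⟨i, j', hi.trans (hij.trans hj), ha, hc', ?_⟩
  have : gridCount f η m i' ≤ gridCount f η m j := oscCount_mono _ _ hij
  omega

lemma HasOsc.le_gridCount {k : ℕ} {a b : TimeInterval T} (h : HasOsc f η k a b) :
    ∃ m₀, ∀ m ≥ m₀, k ≤ gridCount f η m (2 ^ m) := by
  obtain ⟨m₀, h⟩ := h
  refine ⟨m₀, fun m hm => ?_⟩
  obtain ⟨i, i', hi, -, hb, hc⟩ := h m hm
  have : i' ≤ 2 ^ m := by
    by_contra! hlt
    rw [grid_eq_top hlt.le] at hb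
    exact not_top_lt hb
  have : gridCount f η m i' ≤ gridCount f η m (2 ^ m) := oscCount_mono _ _ this
  omega

/-- For every size of oscillations, `f` has boundedly many of them along infinitely many grids. -/
def HasFiniteOsc (f : TimeInterval T → ℝ) : Prop :=
  ∀ k : ℕ, ¬ ∀ K, ∃ m₀, ∀ m ≥ m₀, K ≤ gridCount f (1 / (k + 1)) m (2 ^ m)

lemma exists_tendsto_of_forall_exists_dist_lt {l : Filter (TimeInterval T)}
    (h : ∀ k : ℕ, ∃ s ∈ l, ∀ x ∈ s, ∀ y ∈ s, |f x - f y| < 2 * (1 / (k + 1))) :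
    ∃ y, Tendsto f l (𝓝 y) := by
  rcases l.eq_or_neBot with rfl | hl
  · exact ⟨0, tendsto_bot⟩
  refine cauchy_map_iff_exists_tendsto.1 (Metric.cauchy_iff.2 ⟨hl.map f, fun δ hδ => ?_⟩)
  obtain ⟨k, hk⟩ := exists_nat_one_div_lt (half_pos hδ)
  obtain ⟨s, hs, hsd⟩ := h k
  refine ⟨f '' s, image_mem_map hs, ?_⟩
  rintro _ ⟨x, hx, rfl⟩ _ ⟨y, hy, rfl⟩
  have := hsd x hx y hy
  rw [Real.dist_eq]; linarith

lemma HasFiniteOsc.exists_tendsto_right (hf : HasFiniteOsc f) (t : TimeInterval T) :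
    ∃ y, Tendsto f (𝓝[Ioi t ∩ gridPts T] t) (𝓝 y) := by
  refine exists_tendsto_of_forall_exists_dist_lt fun k => ?_
  by_contra! hne
  have hη : (0 : ℝ) < 1 / (k + 1) := by positivity
  rcases (le_top : t ≤ ⊤).eq_or_lt with rfl | ht
  · obtain ⟨x, hx, -⟩ := hne ∅ (by simp)
    exact hx
  have key : ∀ K, ∀ b, t < b → HasOsc f (1 / (k + 1)) K t b := by
    intro K
    induction K with
    | zero =>
      intro b hb
      obtain ⟨m, j, h1, h2⟩ := exists_grid_between hb
      refine ⟨m, fun m' hm' => ?_⟩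
      rw [grid_eq_grid hm'] at h1 h2
      exact ⟨_, _, le_rfl, h1, h2, le_rfl⟩
    | succ K ih =>
      intro b hb
      obtain ⟨x, ⟨⟨hx1, hx2⟩, hx3⟩, y, ⟨⟨hy1, hy2⟩, hy3⟩, hxy⟩ := hne (Ioo t b ∩ gridPts T) (by
        rw [nhdsWithin_inter']
        exact inter_mem_inf (Ioo_mem_nhdsGT hb) (mem_principal_self _))
      obtain ⟨a, ha, ha'⟩ := exists_between (lt_min hx1 hy1)
      exact (ih a ha).add (hasOsc_one hη hx3 hy3 (ha'.trans_le (min_le_left _ _))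
        (ha'.trans_le (min_le_right _ _)) hx2 hy2 hxy)
  exact hf k fun K => (key K ⊤ ht).le_gridCount

lemma HasFiniteOsc.exists_tendsto_left (hf : HasFiniteOsc f) (t : TimeInterval T) :
    ∃ y, Tendsto f (𝓝[Iio t ∩ gridPts T] t) (𝓝 y) := by
  refine exists_tendsto_of_forall_exists_dist_lt fun k => ?_
  by_contra! hne
  have hη : (0 : ℝ) < 1 / (k + 1) := by positivity
  rcases (bot_le : ⊥ ≤ t).eq_or_lt with rfl | ht
  · obtain ⟨x, hx, -⟩ := hne ∅ (by simp)
    exact hx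
  have key : ∀ K, ∀ b, b < t → HasOsc f (1 / (k + 1)) K b t := by
    intro K
    induction K with
    | zero =>
      intro b hb
      obtain ⟨m, j, h1, h2⟩ := exists_grid_between hb
      refine ⟨m, fun m' hm' => ?_⟩
      rw [grid_eq_grid hm'] at h1 h2
      exact ⟨_, _, le_rfl, h1, h2, le_rfl⟩
    | succ K ih =>
      intro b hb
      obtain ⟨x, ⟨⟨hx1, hx2⟩, hx3⟩, y, ⟨⟨hy1, hy2⟩, hy3⟩, hxy⟩ := hne (Ioo b t ∩ gridPts T) (by
        rw [nhdsWithin_inter']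
        exact inter_mem_inf (Ioo_mem_nhdsLT hb) (mem_principal_self _))
      obtain ⟨a, ha', ha⟩ := exists_between (max_lt hx2 hy2)
      rw [add_comm K 1]
      exact (hasOsc_one hη hx3 hy3 hx1 hy1 ((le_max_left _ _).trans_lt ha')
        ((le_max_right _ _).trans_lt ha') hxy).add (ih a ha)
  exact hf k fun K => (key K ⊥ ht).le_gridCount

lemma nhdsWithin_Ioi_inter_gridPts_neBot {t : TimeInterval T} (ht : t < ⊤) :
    (𝓝[Ioi t ∩ gridPts T] t).NeBot := by
  rw [nhdsWithin_inter']
  exact frequently_iff_neBot.1 (frequently_grid ht)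

/-- Right limits along the grid points define a càdlàg path. -/
lemma HasFiniteOsc.exists_cadlag (hf : HasFiniteOsc f) :
    ∃ g : TimeInterval T → ℝ, IsCadlagPath g ∧ g ⊤ = f ⊤ ∧
      ∀ t < ⊤, Tendsto f (𝓝[Ioi t ∩ gridPts T] t) (𝓝 (g t)) := by
  classical
  choose r hr using hf.exists_tendsto_right
  set g : TimeInterval T → ℝ := fun t => if t = ⊤ then f ⊤ else r t with hg
  have hgr : ∀ t < ⊤, Tendsto f (𝓝[Ioi t ∩ gridPts T] t) (𝓝 (g t)) := fun t ht => by
    simp only [hg, ht.ne, if_false]; exact hr t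
  -- a closed condition holding for `f` on the grid points of `(a, b)` holds for `g` on `(a, b)`
  have hcl : ∀ (C : Set ℝ) (a b : TimeInterval T), IsClosed C →
      (∀ x ∈ Ioo a b ∩ gridPts T, f x ∈ C) → ∀ s ∈ Ioo a b, g s ∈ C := by
    intro C a b hC hfC s hs
    have hst : s < ⊤ := hs.2.trans_le le_top
    have := nhdsWithin_Ioi_inter_gridPts_neBot hst
    refine hC.mem_of_tendsto (hgr s hst) ?_
    rw [nhdsWithin_inter']
    filter_upwards [inter_mem_inf (Ioo_mem_nhdsGT hs.2) (mem_principal_self _)] with x hx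
    exact hfC x ⟨⟨hs.1.trans hx.1.1, hx.1.2⟩, hx.2⟩
  refine ⟨g, fun t => ⟨?_, ?_⟩, by simp [hg], hgr⟩
  · rcases (le_top : t ≤ ⊤).eq_or_lt with rfl | ht
    · rw [Ici_top]; exact continuousWithinAt_singleton
    rw [← continuousWithinAt_Ioi_iff_Ici]
    refine Metric.tendsto_nhds.2 fun δ hδ => ?_
    have h1 := (hgr t ht) (Metric.closedBall_mem_nhds (g t) (half_pos hδ))
    rw [mem_map, nhdsWithin_inter', mem_inf_principal] at h1
    obtain ⟨b, hb, hsub⟩ := (mem_nhdsGT_iff_exists_Ioo_subset' ht).1 h1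
    filter_upwards [Ioo_mem_nhdsGT hb] with s hs
    have := hcl _ t b Metric.isClosed_closedBall (fun x hx => hsub hx.1 hx.2) s hs
    exact (Metric.mem_closedBall.1 this).trans_lt (half_lt_self hδ)
  · obtain ⟨y, hy⟩ := hf.exists_tendsto_left t
    refine ⟨y, ?_⟩
    rcases (bot_le : ⊥ ≤ t).eq_or_lt with rfl | ht
    · simp
    refine Metric.tendsto_nhds.2 fun δ hδ => ?_
    have h1 := hy (Metric.closedBall_mem_nhds y (half_pos hδ))
    rw [mem_map, nhdsWithin_inter', mem_inf_principal] at h1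
    obtain ⟨b, hb, hsub⟩ := (mem_nhdsLT_iff_exists_Ioo_subset' ht).1 h1
    filter_upwards [Ioo_mem_nhdsLT hb] with s hs
    have := hcl _ b t Metric.isClosed_closedBall (fun x hx => hsub hx.1 hx.2) s hs
    exact (Metric.mem_closedBall.1 this).trans_lt (half_lt_self hδ)

end Regularize

section Martingale

variable {Ω : Type*} {mΩ : MeasurableSpace Ω} {T : ℝ} [hT : Fact ((0 : ℝ) ≤ T)]
  {F : Filtration (TimeInterval T) mΩ} {Q : Measure Ω} [IsProbabilityMeasure Q]

/-- By Fatou along the grids: the expected oscillation counts are bounded uniformly in the mesh. -/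
lemma ae_hasFiniteOsc_condExp {X : Ω → ℝ} (hX : MemLp X 2 Q) :
    ∀ᵐ ω ∂Q, HasFiniteOsc fun t => (Q[X|F t]) ω := by
  refine ae_all_iff.2 fun k => ?_
  have hη : (0 : ℝ) < 1 / (k + 1) := by positivity
  set N : ℕ → Ω → ENNReal := fun m ω =>
    (gridCount (fun t => (Q[X|F t]) ω) (1 / (k + 1)) m (2 ^ m) : ENNReal) with hN
  have hm : ∀ t, Measurable[F t] (Q[X|F t]) := fun t => stronglyMeasurable_condExp.measurable
  have hNm : ∀ m, Measurable (N m) := fun m => by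
    have : Measurable fun ω => oscCount (1 / ((k : ℝ) + 1))
        (fun j => (Q[X|F (grid m j)]) ω) (2 ^ m) :=
      measurable_oscCount _ fun j => (hm _).mono (F.le _) le_rfl
    exact measurable_from_nat.comp this
  have hle : ∀ m, ∫⁻ ω, N m ω ∂Q ≤ ENNReal.ofReal ((∫ ω, X ω ^ 2 ∂Q) / (1 / (k + 1)) ^ 2) :=
    fun m => lintegral_oscCount_le hη hX (G := fun j => F (grid m j)) (fun j => F.le _)
      (fun i j hij => F.mono (grid_mono m hij)) (fun j => hm _) (fun j => EventuallyEq.rfl) _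
  have hlim : ∫⁻ ω, liminf (fun m => N m ω) atTop ∂Q ≠ ⊤ := by
    refine ne_top_of_le_ne_top
      (b := ENNReal.ofReal ((∫ ω, X ω ^ 2 ∂Q) / (1 / (k + 1)) ^ 2)) ENNReal.ofReal_ne_top
      ((lintegral_liminf_le hNm).trans
      (liminf_le_of_le (by isBoundedDefault) fun b hb => ?_))
    obtain ⟨m, hm⟩ := hb.exists
    exact hm.trans (hle m)
  filter_upwards [ae_lt_top (.liminf hNm) hlim] with ω hω hbad
  refine hω.ne (ENNReal.eq_top_of_forall_nnreal_le fun r => ?_)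
  obtain ⟨K, hK⟩ := exists_nat_ge r
  obtain ⟨m₀, hm₀⟩ := hbad K
  refine le_liminf_of_le (by isBoundedDefault) ?_
  filter_upwards [eventually_ge_atTop m₀] with m hm
  calc (r : ENNReal) ≤ (K : ENNReal) := by exact_mod_cast hK
    _ ≤ N m ω := by simpa [hN] using hm₀ m hm

/-- Right-continuity of a filtration: measurability with respect to all later σ-algebras. -/
lemma UsualConditions.measurable_of_forall_gt {β : Type*} [MeasurableSpace β] {P : Measure Ω}
    (hF : UsualConditions F P) {t : TimeInterval T} (ht : t < ⊤) {g : Ω → β}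
    (h : ∀ u, t < u → Measurable[F u] g) : Measurable[F t] g := by
  have := hF.rightContinuous
  have hne := nhdsGT_neBot_of_lt_top ht
  intro s hs
  refine Filtration.IsRightContinuous.measurableSet ?_
  rw [Filtration.rightCont_eq_of_neBot_nhdsGT]
  simp only [MeasurableSpace.measurableSet_iInf]
  exact fun u hu => h u hu hs

/-- Under the usual conditions, the martingale closed by a square-integrable random variable has a
version all of whose paths are càdlàg. -/
lemma exists_cadlag_condExp (hF : UsualConditions F Q) {X : Ω → ℝ} (hX : MemLp X 2 Q) :
    ∃ N : TimeInterval T → Ω → ℝ, (∀ ω, IsCadlagPath fun t => N t ω) ∧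
      ∀ t, N t =ᵐ[Q] Q[X|F t] := by
  classical
  have hgood := ae_hasFiniteOsc_condExp (F := F) hX
  set good : Set Ω := {ω | HasFiniteOsc fun t => (Q[X|F t]) ω} with hgooddef
  have hgm : ∀ t, MeasurableSet[F t] good := fun t =>
    hF.measurableSet_congr (@MeasurableSet.univ _ (F t)) (by
      filter_upwards [hgood] with ω hω
      exact ⟨fun _ => hω, fun _ => mem_univ _⟩)
  choose! g hg1 hg2 hg3 using fun ω (hω : ω ∈ good) => HasFiniteOsc.exists_cadlag hω
  have hX1 : Integrable X Q := hX.integrable (by norm_num)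
  refine ⟨fun t => good.indicator fun ω => g ω t, fun ω => ?_, fun t => ?_⟩
  · by_cases hω : ω ∈ good
    · simpa [indicator_of_mem hω] using hg1 ω hω
    · simp only [indicator_of_notMem hω]
      exact fun t => ⟨continuousWithinAt_const, 0, tendsto_const_nhds⟩
  rcases (le_top : t ≤ ⊤).eq_or_lt with rfl | ht
  · filter_upwards [hgood] with ω hω
    rw [indicator_of_mem (show ω ∈ good from hω), hg2 ω hω]
  have := nhdsWithin_Ioi_inter_gridPts_neBot ht
  obtain ⟨s, hs⟩ := exists_seq_tendsto (𝓝[Ioi t ∩ gridPts T] t)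
  set M : ℕ → Ω → ℝ := fun n => good.indicator (Q[X|F (s n)]) with hM
  set L : Ω → ℝ := good.indicator fun ω => g ω t with hL
  have hlim : ∀ ω, Tendsto (fun n => M n ω) atTop (𝓝 (L ω)) := fun ω => by
    by_cases hω : ω ∈ good
    · simp only [hM, hL, indicator_of_mem hω]
      exact (hg3 ω hω t ht).comp hs
    · simp only [hM, hL, indicator_of_notMem hω]
      exact tendsto_const_nhds
  have hMm : ∀ n, Measurable[F (s n)] (M n) := fun n =>
    Measurable.indicator (stronglyMeasurable_condExp.measurable) (hgm _)
  have hs1 : ∀ᶠ n in atTop, t < s n := hs.eventually (by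
    filter_upwards [self_mem_nhdsWithin] with x hx using hx.1)
  have hs2 : ∀ u, t < u → ∀ᶠ n in atTop, s n < u := fun u hu =>
    (hs.mono_right nhdsWithin_le_nhds).eventually (gt_mem_nhds hu)
  have hLm : Measurable[F t] L := by
    refine hF.measurable_of_forall_gt ht fun u hu => ?_
    obtain ⟨n₀, hn₀⟩ := eventually_atTop.1 (hs2 u hu)
    refine @measurable_of_tendsto_metrizable _ _ (F u) _ _ _ _ (fun n => M (n + n₀)) _
      (fun n => (hMm _).mono (F.mono (hn₀ _ (by omega)).le) le_rfl)
      (tendsto_pi_nhds.2 fun ω => (hlim ω).comp (tendsto_add_atTop_nat n₀))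
  have hMae : ∀ n, M n =ᵐ[Q] Q[X|F (s n)] := fun n => by
    filter_upwards [hgood] with ω hω
    exact indicator_of_mem (show ω ∈ good from hω) _
  have hMaesm : ∀ n, AEStronglyMeasurable (M n) Q := fun n =>
    ((hMm n).mono (F.le _) le_rfl).aestronglyMeasurable
  have hUI := (hX1.uniformIntegrable_condExp (ℱ := fun n => F (s n)) fun n => F.le _).ae_eq
    fun n => (hMae n).symm
  have hL1 : MemLp L 1 Q := hUI.memLp_of_ae_tendsto (ae_of_all _ hlim)
  have hconv := tendsto_Lp_finite_of_tendsto_ae le_rfl ENNReal.one_ne_top hMaesm hL1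
    hUI.unifIntegrable (ae_of_all _ hlim)
  have hLi : Integrable L Q := memLp_one_iff_integrable.1 hL1
  refine ae_eq_condExp_of_forall_setIntegral_eq (F.le t) hX1 (fun _ _ _ => hLi.integrableOn)
    (fun A hA _ => ?_) hLm.aestronglyMeasurable
  have h1 := tendsto_setIntegral_of_L1' L hLi.aestronglyMeasurable
    (Eventually.of_forall fun n => integrable_condExp.congr (hMae n).symm) hconv A
  refine tendsto_nhds_unique h1 (tendsto_const_nhds.congr' ?_)
  filter_upwards [hs1] with n hn
  rw [setIntegral_congr_ae (F.le t _ hA) ((hMae n).mono fun _ h _ => h),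
    setIntegral_condExp (F.le _) hX1 (F.mono hn.le _ hA)]

/-- The vector-valued version: a càdlàg adapted process whose value at `t` is `E[X|F_t]`. -/
lemma exists_cadlag_martingale {d : ℕ} (hF : UsualConditions F Q) {X : Ω → Euc d}
    (hX : MemLp X 2 Q) :
    ∃ N : TimeInterval T → Ω → Euc d, (∀ ω, IsCadlagPath fun t => N t ω) ∧
      (∀ t, Measurable[F t] (N t)) ∧ ∀ t, N t =ᵐ[Q] Q[X|F t] := by
  have hXi : ∀ i, MemLp (fun ω => X ω i) 2 Q := fun i =>
    (EuclideanSpace.proj (𝕜 := ℝ) i).comp_memLp' hX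
  choose N hN1 hN2 using fun i => exists_cadlag_condExp hF (hXi i)
  have hae : ∀ t, (fun ω => WithLp.toLp 2 fun i => N i t ω) =ᵐ[Q] Q[X|F t] := fun t => by
    have h1 : ∀ i, (fun ω => (Q[X|F t]) ω i) =ᵐ[Q] Q[fun ω => X ω i|F t] := fun i =>
      (EuclideanSpace.proj (𝕜 := ℝ) i).comp_condExp_comm (hX.integrable (by norm_num))
    filter_upwards [ae_all_iff.2 h1, ae_all_iff.2 fun i => hN2 i t] with ω h1 h2
    ext i
    have h3 := h1 i
    have h4 := h2 i
    simp only at h3 h4 ⊢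
    rw [h4, ← h3]
  refine ⟨fun t ω => WithLp.toLp 2 fun i => N i t ω, fun ω t => ⟨?_, ?_⟩, fun t => ?_, hae⟩
  · exact (PiLp.continuous_toLp 2 _).continuousAt.comp_continuousWithinAt
      (continuousWithinAt_pi.2 fun i => (hN1 i ω t).1)
  · choose l hl using fun i => (hN1 i ω t).2
    exact ⟨_, ((PiLp.continuous_toLp 2 _).tendsto _).comp (tendsto_pi_nhds.2 hl)⟩
  · intro B hB
    refine hF.measurableSet_congr
      ((stronglyMeasurable_condExp (f := X) (m := F t) (μ := Q)).measurable hB) ?_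
    filter_upwards [hae t] with ω hω
    simp only [mem_preimage]
    rw [← hω]

end Martingale

/-! ### Convex gauges -/

section Gauge

variable {g : ℝ → ℝ}

lemma ConvexOn.monotoneOn_of_nonneg_of_zero (hg : ConvexOn ℝ (Ici 0) g)
    (hg0 : ∀ x, 0 ≤ x → 0 ≤ g x) (h0 : g 0 = 0) : MonotoneOn g (Ici 0) := by
  intro x hx y hy hxy
  rcases (show (0 : ℝ) ≤ y from hy).eq_or_lt with h | h
  · rw [le_antisymm hxy (h ▸ hx)]
  have hx' : 0 ≤ x := hx
  have h1 := hg.2 (mem_Ici.2 (le_refl (0 : ℝ))) hy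
    (show 0 ≤ 1 - x / y by rw [sub_nonneg, div_le_one h]; exact hxy)
    (show 0 ≤ x / y by positivity) (by ring)
  simp only [smul_eq_mul, mul_zero, zero_add, h0, div_mul_cancel₀ x h.ne'] at h1
  refine h1.trans (mul_le_of_le_one_left (hg0 y hy) ((div_le_one h).2 hxy))

/-- Extension of `g` by the constant `g 0` to the negative axis. -/
def extendGauge (g : ℝ → ℝ) (x : ℝ) : ℝ := g (max x 0)

lemma extendGauge_of_nonneg {x : ℝ} (hx : 0 ≤ x) : extendGauge g x = g x := by
  rw [extendGauge, max_eq_left hx]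

lemma monotone_extendGauge (hg : MonotoneOn g (Ici 0)) : Monotone (extendGauge g) :=
  fun _ _ hxy => hg (mem_Ici.2 (le_max_right _ _)) (mem_Ici.2 (le_max_right _ _)) (max_le_max_right 0 hxy)

lemma convexOn_extendGauge (hg : ConvexOn ℝ (Ici 0) g) (hm : MonotoneOn g (Ici 0)) :
    ConvexOn ℝ univ (extendGauge g) := by
  refine ⟨convex_univ, fun x _ y _ a b ha hb hab => ?_⟩
  have h1 : max (a • x + b • y) 0 ≤ a • max x 0 + b • max y 0 := by
    simp only [smul_eq_mul]
    refine max_le ?_ (by positivity)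
    exact add_le_add (mul_le_mul_of_nonneg_left (le_max_left _ _) ha)
      (mul_le_mul_of_nonneg_left (le_max_left _ _) hb)
  have h2 : (0 : ℝ) ≤ a • max x 0 + b • max y 0 := (le_max_right _ _).trans h1
  exact (hm (mem_Ici.2 (le_max_right _ _)) h2 h1).trans
    (hg.2 (mem_Ici.2 (le_max_right _ _)) (mem_Ici.2 (le_max_right _ _)) ha hb hab)

lemma continuous_extendGauge (hg : ConvexOn ℝ (Ici 0) g) (hm : MonotoneOn g (Ici 0)) :
    Continuous (extendGauge g) :=
  continuousOn_univ.1 ((convexOn_extendGauge hg hm).continuousOn isOpen_univ)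

lemma tendsto_gauge_add_sqrt (hg : ConvexOn ℝ (Ici 0) g) (hm : MonotoneOn g (Ici 0))
    (h0 : g 0 = 0) : Tendsto (fun δ : ℝ => g (2 * δ) + 2 * √δ) (𝓝[>] 0) (𝓝 0) := by
  have h1 : Continuous fun δ : ℝ => extendGauge g (2 * δ) + 2 * √δ := by
    have := continuous_extendGauge hg hm
    fun_prop
  have h2 := (h1.tendsto 0).mono_left (nhdsWithin_le_nhds (s := Ioi 0))
  simp only [mul_zero, Real.sqrt_zero, add_zero, extendGauge_of_nonneg le_rfl, h0] at h2
  refine h2.congr' ?_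
  filter_upwards [self_mem_nhdsWithin] with δ hδ
  have hδ' : (0 : ℝ) < δ := hδ
  rw [extendGauge_of_nonneg (by positivity)]

end Gauge

/-! ### Maximal inequalities -/

section Maximal

variable {Ω : Type*} {mΩ : MeasurableSpace Ω}

/-- A weak `L²` bound implies an `L¹` bound. -/
lemma lintegral_ofReal_le_of_weak {Q : Measure Ω} [IsProbabilityMeasure Q] {V : Ω → ℝ}
    (hV : Measurable V) {a C : ℝ} (ha : 0 < a) (hC : 0 ≤ C)
    (h : ∀ r, 0 < r → Q {ω | r < V ω} ≤ ENNReal.ofReal (C / r ^ 2)) :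
    ∫⁻ ω, ENNReal.ofReal (V ω) ∂Q ≤ ENNReal.ofReal (a + 2 * C / a) := by
  set b : ℕ → ℝ := fun k => a * 2 ^ k with hb
  have hb0 : ∀ k, 0 < b k := fun k => by positivity
  have hs : ∀ k, MeasurableSet {ω | b k < V ω} := fun k => measurableSet_lt measurable_const hV
  have hpt : ∀ ω, ENNReal.ofReal (V ω) ≤ ENNReal.ofReal a +
      ∑' k, ({ω | b k < V ω}.indicator (fun _ => ENNReal.ofReal (b k)) ω) := by
    intro ω
    have h1 : ∀ n, V ω ≤ b n → ENNReal.ofReal (V ω) ≤ ENNReal.ofReal a +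
      ∑ k ∈ Finset.range n, ({ω | b k < V ω}.indicator (fun _ => ENNReal.ofReal (b k)) ω) := by
      intro n
      induction n with
      | zero => intro hn; simpa [hb] using ENNReal.ofReal_le_ofReal hn
      | succ n ih =>
        intro hn
        rw [Finset.sum_range_succ]
        by_cases hω : b n < V ω
        · have hall : ∀ k ∈ Finset.range n,
              ({ω | b k < V ω}.indicator (fun _ => ENNReal.ofReal (b k)) ω) =
                ENNReal.ofReal (b k) := fun k hk => by
            have hk' : k ≤ n := (Finset.mem_range.1 hk).le
            have hbk : b k ≤ b n :=
              mul_le_mul_of_nonneg_left (pow_le_pow_right₀ (by norm_num) hk') ha.le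
            exact indicator_of_mem (show ω ∈ {ω | b k < V ω} from hbk.trans_lt hω) _
          rw [Finset.sum_congr rfl hall, indicator_of_mem (show ω ∈ {ω | b n < V ω} from hω),
            ← ENNReal.ofReal_sum_of_nonneg fun k _ => (hb0 k).le,
            ← ENNReal.ofReal_add (Finset.sum_nonneg fun k _ => (hb0 k).le) (hb0 n).le,
            ← ENNReal.ofReal_add ha.le
              (add_nonneg (Finset.sum_nonneg fun k _ => (hb0 k).le) (hb0 n).le)]
          refine ENNReal.ofReal_le_ofReal (hn.trans (le_of_eq ?_))
          rw [← Finset.sum_range_succ]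
          simp only [hb, ← Finset.mul_sum]
          have := geom_sum_eq (x := (2 : ℝ)) (by norm_num) (n + 1)
          rw [this]; ring
        · refine (ih (not_lt.1 hω)).trans ?_
          gcongr
          exact le_self_add
    obtain ⟨n, hn⟩ := pow_unbounded_of_one_lt (V ω / a) (by norm_num : (1 : ℝ) < 2)
    refine (h1 n ?_).trans (by gcongr; exact ENNReal.sum_le_tsum _)
    rw [div_lt_iff₀ ha] at hn; simp only [hb]; linarith
  calc ∫⁻ ω, ENNReal.ofReal (V ω) ∂Q ≤ ∫⁻ ω, (ENNReal.ofReal a +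
      ∑' k, ({ω | b k < V ω}.indicator (fun _ => ENNReal.ofReal (b k)) ω)) ∂Q :=
        lintegral_mono hpt
    _ = ENNReal.ofReal a + ∑' k, ENNReal.ofReal (b k) * Q {ω | b k < V ω} := by
        rw [lintegral_add_left measurable_const, lintegral_tsum
          fun k => (measurable_const.indicator (hs k)).aemeasurable]
        simp only [lintegral_indicator_const (hs _), lintegral_const, measure_univ, mul_one]
    _ ≤ ENNReal.ofReal a + ∑' k : ℕ, ENNReal.ofReal (C / a * (1 / 2) ^ k) := by
        gcongr with k
        refine (mul_le_mul_right (h _ (hb0 k)) _).trans (le_of_eq ?_)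
        rw [← ENNReal.ofReal_mul (hb0 k).le]
        congr 1
        simp only [hb]
        rw [one_div, inv_pow]
        field_simp
    _ = ENNReal.ofReal (a + 2 * C / a) := by
        have hsum := (summable_geometric_two).mul_left (C / a)
        rw [← ENNReal.ofReal_tsum_of_nonneg (fun k => by positivity) hsum, tsum_mul_left,
          tsum_geometric_two, ← ENNReal.ofReal_add ha.le (by positivity)]
        congr 1; ring

variable {T : ℝ} [hT : Fact ((0 : ℝ) ≤ T)] {F : Filtration (TimeInterval T) mΩ}

/-- If `α ≤ β` on the events of `F_t` contained in `A_t`, then decomposing according to the first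
grid point at which `A` is entered gives `α ≤ β` on the event that `A` is entered at all. -/
lemma measure_iUnion_grid_le {α β : Measure Ω} {A : TimeInterval T → Set Ω}
    (hA : ∀ t, MeasurableSet[F t] (A t))
    (h : ∀ t E, MeasurableSet[F t] E → E ⊆ A t → α E ≤ β E) :
    α (⋃ m, ⋃ j, A (grid m j)) ≤ β univ := by
  have hmono : Monotone fun m => ⋃ j, A (grid m j) := by
    intro m m' hm
    refine iUnion_subset fun j => ?_
    rw [grid_eq_grid hm]
    exact subset_iUnion (fun j => A (grid m' j)) _
  rw [hmono.measure_iUnion]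
  refine iSup_le fun m => ?_
  have hd : ∀ j, MeasurableSet[F (grid m j)] (disjointed (fun j => A (grid m j)) j) := by
    intro j
    rw [disjointed_eq_inter_compl]
    refine (hA _).inter ?_
    refine MeasurableSet.iInter fun i => MeasurableSet.iInter fun hi => ?_
    exact (F.mono (grid_mono m hi.le) _ (hA _)).compl
  have hd' : ∀ j, MeasurableSet (disjointed (fun j => A (grid m j)) j) := fun j => F.le _ _ (hd j)
  calc α (⋃ j, A (grid m j)) = ∑' j, α (disjointed (fun j => A (grid m j)) j) := by
        rw [← iUnion_disjointed, measure_iUnion (disjoint_disjointed _) hd']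
    _ ≤ ∑' j, β (disjointed (fun j => A (grid m j)) j) :=
        ENNReal.tsum_le_tsum fun j => h _ _ (hd j) (disjointed_subset _ _)
    _ = β (⋃ j, A (grid m j)) := by
        rw [← measure_iUnion (disjoint_disjointed _) hd', iUnion_disjointed]
    _ ≤ β univ := measure_mono (subset_univ _)

end Maximal

/-! ### Summing the rare large increments -/

section Dominate

variable {Ω : Type*} {mΩ : MeasurableSpace Ω} {Q : Measure Ω} [IsProbabilityMeasure Q]

/-- Functions `q n` with integrals at most `θ / (2 * 8 ^ n)` are simultaneously dominated by
`R ^ 2 / 4 ^ n` for a square-integrable `R`. -/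
lemma exists_dominating_memLp {q : ℕ → Ω → ENNReal} (hq : ∀ n, Measurable (q n)) {θ : ℝ}
    (hθ : 0 ≤ θ) (h : ∀ n, ∫⁻ ω, q n ω ∂Q ≤ ENNReal.ofReal (θ / 2 * (1 / 8) ^ n)) :
    ∃ R : Ω → ℝ, Measurable R ∧ (∀ ω, 0 ≤ R ω) ∧ MemLp R 2 Q ∧ ∫ ω, R ω ^ 2 ∂Q ≤ θ ∧
      ∀ᵐ ω ∂Q, ∀ n, q n ω ≤ ENNReal.ofReal ((1 / 4) ^ n * R ω ^ 2) := by
  set Θ : Ω → ENNReal := fun ω => ∑' n, ENNReal.ofReal (4 ^ n) * q n ω with hΘ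
  have hΘm : Measurable Θ := Measurable.tsum fun n => (hq n).const_mul _
  have hint : ∫⁻ ω, Θ ω ∂Q ≤ ENNReal.ofReal θ := by
    rw [lintegral_tsum fun n => ((hq n).const_mul _).aemeasurable]
    calc ∑' n, ∫⁻ ω, ENNReal.ofReal (4 ^ n) * q n ω ∂Q
        ≤ ∑' n : ℕ, ENNReal.ofReal (θ / 2 * (1 / 2) ^ n) := by
          refine ENNReal.tsum_le_tsum fun n => ?_
          rw [lintegral_const_mul _ (hq n)]
          refine (mul_le_mul_right (h n) _).trans (le_of_eq ?_)
          rw [← ENNReal.ofReal_mul (by positivity)]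
          congr 1
          rw [mul_left_comm, ← mul_pow]; norm_num
      _ = ENNReal.ofReal θ := by
          rw [← ENNReal.ofReal_tsum_of_nonneg (fun k => by positivity)
            (summable_geometric_two.mul_left _), tsum_mul_left, tsum_geometric_two]
          congr 1; ring
  have hfin : ∀ᵐ ω ∂Q, Θ ω < ⊤ := ae_lt_top hΘm (ne_top_of_le_ne_top ENNReal.ofReal_ne_top hint)
  have hRm : Measurable fun ω => √(Θ ω).toReal := hΘm.ennreal_toReal.sqrt
  have hsq : ∀ ω, √(Θ ω).toReal ^ 2 = (Θ ω).toReal := fun ω => Real.sq_sqrt ENNReal.toReal_nonneg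
  have hi : Integrable (fun ω => (Θ ω).toReal) Q :=
    integrable_toReal_of_lintegral_ne_top hΘm.aemeasurable
      (ne_top_of_le_ne_top ENNReal.ofReal_ne_top hint)
  refine ⟨fun ω => √(Θ ω).toReal, hRm, fun ω => Real.sqrt_nonneg _,
    (memLp_two_iff_integrable_sq hRm.aestronglyMeasurable).2 (by simpa only [hsq] using hi), ?_, ?_⟩
  · simp only [hsq]
    rw [integral_toReal hΘm.aemeasurable hfin]
    exact ENNReal.toReal_le_of_le_ofReal hθ hint
  · filter_upwards [hfin] with ω hω n
    rw [hsq, ENNReal.ofReal_mul (by positivity), ENNReal.ofReal_toReal hω.ne]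
    calc q n ω = ENNReal.ofReal ((1 / 4) ^ n) * (ENNReal.ofReal (4 ^ n) * q n ω) := by
          rw [← mul_assoc, ← ENNReal.ofReal_mul (by positivity), ← mul_pow]; norm_num
      _ ≤ ENNReal.ofReal ((1 / 4) ^ n) * Θ ω := by
          gcongr
          exact ENNReal.le_tsum n

end Dominate

/-! ### The process sampled at its move times -/

section Sampled

variable {Ω : Type*} {mΩ : MeasurableSpace Ω} {T : ℝ} [hT : Fact ((0 : ℝ) ≤ T)] {d : ℕ}
  {F : Filtration (TimeInterval T) mΩ} {Q : Measure Ω} {S : TimeInterval T → Ω → Euc d} {ε : ℝ}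

/-- The increment of `S` between its `n`-th and `n + 1`-st move times. -/
noncomputable def moveStep (S : TimeInterval T → Ω → Euc d) (ε : ℝ) (n : ℕ) (ω : Ω) : Euc d :=
  S (moveTime S ε (n + 1) ω) ω - S (moveTime S ε n ω) ω

/-- The `n`-th step is regular if it ends at the terminal time and is smaller than `ε`. -/
def regularStep (S : TimeInterval T → Ω → Euc d) (ε : ℝ) (n : ℕ) : Set Ω :=
  {ω | moveTime S ε (n + 1) ω = ⊤} ∩ {ω | ‖moveStep S ε n ω‖ < ε}

/-- The event that `t` lies between the `n`-th and the `n + 1`-st move times. -/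
def moveBlock (S : TimeInterval T → Ω → Euc d) (ε : ℝ) (n : ℕ) (t : TimeInterval T) : Set Ω :=
  {ω | moveTime S ε n ω ≤ t ∧ t < moveTime S ε (n + 1) ω}

/-- If all steps which are not regular are small, then `S` is bounded at its move times: a regular
step occurs at most once with a nonzero increment, since it leads to the terminal time. -/
lemma norm_moveTime_le {ω : Ω} (hε : 0 < ε) {r : ℝ} (hr : 0 ≤ r)
    (h : ∀ n, ω ∉ regularStep S ε n → ‖moveStep S ε n ω‖ ≤ (1 / 2) ^ n * r) (m : ℕ) :
    ‖S (moveTime S ε m ω) ω‖ ≤ ‖S ⊥ ω‖ + ε + 2 * r := by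
  have hpow : ∀ m : ℕ, (1 / 2 : ℝ) ^ (m + 1) = (1 / 2) ^ m / 2 := fun m => by rw [pow_succ]; ring
  have key : ∀ m, (moveTime S ε m ω ≠ ⊤ →
      ‖S (moveTime S ε m ω) ω‖ ≤ ‖S ⊥ ω‖ + (2 - 2 * (1 / 2) ^ m) * r) ∧
      ‖S (moveTime S ε m ω) ω‖ ≤ ‖S ⊥ ω‖ + ε + (2 - 2 * (1 / 2) ^ m) * r := by
    intro m
    induction m with
    | zero =>
      have : moveTime S ε 0 ω = ⊥ := rfl
      simp only [this]
      constructor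
      · intro; simp
      · simpa using hε.le
    | succ m ih =>
      have hp : (0 : ℝ) < (1 / 2) ^ m := by positivity
      have hpr : 0 ≤ (1 / 2 : ℝ) ^ m * r := by positivity
      have htri : ‖S (moveTime S ε (m + 1) ω) ω‖ ≤
          ‖S (moveTime S ε m ω) ω‖ + ‖moveStep S ε m ω‖ := by
        have e : S (moveTime S ε (m + 1) ω) ω = S (moveTime S ε m ω) ω + moveStep S ε m ω := by
          rw [moveStep]; abel
        rw [e]; exact norm_add_le _ _
      have hmono := moveTime_mono S ε ω m.le_succ
      constructor
      · intro hne
        have hne' : moveTime S ε m ω ≠ ⊤ := fun h => hne (top_le_iff.1 (h ▸ hmono))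
        have h1 := h m fun hreg => hne hreg.1
        have h2 := ih.1 hne'
        rw [hpow]; nlinarith
      · by_cases hm : moveTime S ε m ω = ⊤
        · have hm' : moveTime S ε (m + 1) ω = ⊤ := top_le_iff.1 (hm ▸ hmono)
          rw [hm', ← hm, hpow]
          nlinarith [ih.2]
        · have h2 := ih.1 hm
          by_cases hreg : ω ∈ regularStep S ε m
          · have h3 : ‖moveStep S ε m ω‖ < ε := hreg.2
            rw [hpow]; nlinarith
          · have h1 := h m hreg
            rw [hpow]; nlinarith
  have := (key m).2
  have hp : 0 ≤ (1 / 2 : ℝ) ^ m * r := by positivity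
  nlinarith

/-- The process `S`, sampled at its move times, is a martingale closed by the square-integrable
random variable `S_T`. -/
structure IsMoveMartingale (F : Filtration (TimeInterval T) mΩ) (Q : Measure Ω)
    (S : TimeInterval T → Ω → Euc d) (ε : ℝ) : Prop where
  adapted : Adapted F S
  cadlag : ∀ ω, IsCadlagPath fun t => S t ω
  isTime : ∀ n, IsTime F (moveTime S ε n)
  integrable : ∀ n, Integrable (fun ω => S (moveTime S ε n ω) ω) Q
  memLp : MemLp (S ⊤) 2 Q
  setIntegral_eq : ∀ n A, MeasurableSet[(isTime n).measurableSpace] A →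
    ∫ ω in A, S ⊤ ω ∂Q = ∫ ω in A, S (moveTime S ε n ω) ω ∂Q

lemma integral_eq_zero_of_lintegral_eq {μ : Measure Ω} {f : Ω → Euc d} (hf : Integrable f μ)
    (h : ∀ i, ∫⁻ ω, ENNReal.ofReal (f ω i) ∂μ = ∫⁻ ω, ENNReal.ofReal (-f ω i) ∂μ) :
    ∫ ω, f ω ∂μ = 0 := by
  ext i
  have h1 : ∫ ω, f ω i ∂μ = (∫ ω, f ω ∂μ) i :=
    (EuclideanSpace.proj (𝕜 := ℝ) i).integral_comp_comm hf
  have h2 : Integrable (fun ω => f ω i) μ := (EuclideanSpace.proj (𝕜 := ℝ) i).integrable_comp hf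
  rw [← h1, integral_eq_lintegral_pos_part_sub_lintegral_neg_part h2, h i, sub_self]
  rfl

/-- Centred increments and a square-integrable bound on the sampled values suffice: `moveTime`
reaches `⊤` after finitely many steps, so dominated convergence passes from the martingale property
of consecutive samples to the terminal value. -/
lemma isMoveMartingale_of_dominated [IsFiniteMeasure Q] (hε : 0 < ε) (hS : Adapted F S)
    (hc : ∀ ω, IsCadlagPath fun t => S t ω) (hτ : ∀ n, IsTime F (moveTime S ε n))
    (hstep : ∀ n B, MeasurableSet[(hτ n).measurableSpace] B → ∀ i,
      ∫⁻ ω in B, ENNReal.ofReal (moveStep S ε n ω i) ∂Q =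
        ∫⁻ ω in B, ENNReal.ofReal (-moveStep S ε n ω i) ∂Q)
    {K : Ω → ℝ} (hK : MemLp K 2 Q)
    (hle : ∀ᵐ ω ∂Q, ∀ m, ‖S (moveTime S ε m ω) ω‖ ≤ K ω) : IsMoveMartingale F Q S ε := by
  have hm : ∀ n, Measurable[(hτ n).measurableSpace] fun ω => S (moveTime S ε n ω) ω :=
    fun n => (hτ n).measurable_stopped hS fun ω t => (hc ω t).1
  have hm' : ∀ n, Measurable fun ω => S (moveTime S ε n ω) ω := fun n =>
    (hm n).mono (hτ n).measurableSpace_le le_rfl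
  have hKi : Integrable K Q := hK.integrable (by norm_num)
  have hi : ∀ n, Integrable (fun ω => S (moveTime S ε n ω) ω) Q := fun n =>
    hKi.mono' (hm' n).aestronglyMeasurable (hle.mono fun ω h => h n)
  have hGmono : ∀ n m, n ≤ m → (hτ n).measurableSpace ≤ (hτ m).measurableSpace := fun n m hnm =>
    IsStoppingTime.measurableSpace_mono _ _ fun ω =>
      WithTop.coe_le_coe.2 (moveTime_mono S ε ω hnm)
  have hev : ∀ ω, ∀ᶠ m in atTop, S (moveTime S ε m ω) ω = S ⊤ ω := fun ω => by
    obtain ⟨N, hN⟩ := exists_moveTime_eq_top (hc ω) hε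
    filter_upwards [eventually_ge_atTop N] with m hm
    have h1 := moveTime_mono S ε ω hm
    simp only [hN] at h1
    rw [top_le_iff.1 h1]
  refine ⟨hS, hc, hτ, hi, ?_, fun n A hA => ?_⟩
  · refine hK.mono ((hS ⊤).mono (F.le _) le_rfl).aestronglyMeasurable ?_
    filter_upwards [hle] with ω hω
    obtain ⟨m, hm⟩ := (hev ω).exists
    rw [← hm]
    exact (hω m).trans (le_abs_self _)
  · have hA' : MeasurableSet A := (hτ n).measurableSpace_le _ hA
    have heq : ∀ m, n ≤ m → ∫ ω in A, S (moveTime S ε m ω) ω ∂Q =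
        ∫ ω in A, S (moveTime S ε n ω) ω ∂Q := by
      intro m hnm
      induction m, hnm using Nat.le_induction with
      | base => rfl
      | succ m hnm ih =>
        rw [← ih, ← sub_eq_zero, ← integral_sub (hi _).integrableOn (hi _).integrableOn]
        exact integral_eq_zero_of_lintegral_eq ((hi _).sub (hi _)).integrableOn
          (hstep m A (hGmono n m hnm _ hA))
    have hlim : Tendsto (fun m => ∫ ω in A, S (moveTime S ε m ω) ω ∂Q) atTop
        (𝓝 (∫ ω in A, S ⊤ ω ∂Q)) :=
      tendsto_integral_of_dominated_convergence K (fun m => (hm' m).aestronglyMeasurable)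
        hKi.integrableOn (fun m => ae_restrict_of_ae (hle.mono fun ω h => h m))
        (ae_of_all _ fun ω => tendsto_const_nhds.congr' ((hev ω).mono fun _ h => h.symm))
    refine tendsto_nhds_unique hlim (tendsto_const_nhds.congr' ?_)
    filter_upwards [eventually_ge_atTop n] with m hm using (heq m hm).symm

namespace IsMoveMartingale

lemma condExp_moveTime [IsFiniteMeasure Q] (h : IsMoveMartingale F Q S ε) (n : ℕ) :
    (fun ω => S (moveTime S ε n ω) ω) =ᵐ[Q] Q[S ⊤|(h.isTime n).measurableSpace] :=
  ae_eq_condExp_of_forall_setIntegral_eq (h.isTime n).measurableSpace_le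
    (h.memLp.integrable (by norm_num)) (fun _ _ _ => (h.integrable n).integrableOn)
    (fun A hA _ => (h.setIntegral_eq n A hA).symm)
    ((h.isTime n).measurable_stopped h.adapted
      fun ω t => (h.cadlag ω t).1).stronglyMeasurable.aestronglyMeasurable

variable {S' : TimeInterval T → Ω → Euc d} {t : TimeInterval T} {n : ℕ} {B : Set Ω}

lemma measurableSet_moveBlock (h : IsMoveMartingale F Q S ε) (n : ℕ) (t : TimeInterval T) :
    MeasurableSet[F t] (moveBlock S ε n t) := by
  have h2 := ((h.isTime (n + 1)).le t).compl
  have e : moveBlock S ε n t = {ω | moveTime S ε n ω ≤ t} ∩ {ω | moveTime S ε (n + 1) ω ≤ t}ᶜ := by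
    ext ω; simp [moveBlock]
  rw [e]
  exact ((h.isTime n).le t).inter h2

/-- Events of `F_t` before the next move time are known at the next move time. -/
lemma measurableSet_of_subset_moveBlock (h : IsMoveMartingale F Q S ε)
    (hB : MeasurableSet[F t] B) (hsub : B ⊆ moveBlock S ε n t) :
    MeasurableSet[(h.isTime (n + 1)).measurableSpace] B := by
  refine (h.isTime (n + 1)).measurableSet_iff.2 fun i => ?_
  rcases le_or_gt i t with hi | hi
  · have : B ∩ {ω | moveTime S ε (n + 1) ω ≤ i} = ∅ := by
      ext ω
      simp only [mem_inter_iff, mem_ofPred_eq, mem_empty_iff_false, iff_false, not_and, not_le]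
      exact fun hω => hi.trans_lt (hsub hω).2
    rw [this]; exact @MeasurableSet.empty _ (F i)
  · exact (F.mono hi.le _ hB).inter ((h.isTime (n + 1)).le i)

/-- On a block, the difference `S'_t - S_t` is the conditional expectation of the increment of `S`
up to the next move time. -/
lemma condExp_indicator_sub [IsFiniteMeasure Q] (h : IsMoveMartingale F Q S ε) (hε : 0 < ε)
    (hS'm : Measurable[F t] (S' t)) (hS' : S' t =ᵐ[Q] Q[S ⊤|F t]) (hB : MeasurableSet[F t] B)
    (hsub : B ⊆ moveBlock S ε n t) :
    Integrable (B.indicator fun ω => S (moveTime S ε (n + 1) ω) ω - S t ω) Q ∧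
    (B.indicator fun ω => S' t ω - S t ω) =ᵐ[Q]
      Q[B.indicator fun ω => S (moveTime S ε (n + 1) ω) ω - S t ω|F t] := by
  have hB' := F.le _ _ hB
  have hSt : Measurable (S t) := (h.adapted t).mono (F.le t) le_rfl
  have hSB : Integrable (B.indicator (S t)) Q := by
    refine ((h.integrable n).norm.add (integrable_const ε)).mono'
      (hSt.indicator hB').aestronglyMeasurable (ae_of_all _ fun ω => ?_)
    by_cases hω : ω ∈ B
    · rw [indicator_of_mem hω]
      have h1 : ‖S t ω - S (moveTime S ε n ω) ω‖ < ε :=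
        norm_sub_lt_of_lt_nextMove (f := fun t => S t ω) hε (hsub hω).1 (hsub hω).2
      calc ‖S t ω‖ = ‖S (moveTime S ε n ω) ω + (S t ω - S (moveTime S ε n ω) ω)‖ := by
            congr 1; abel
        _ ≤ _ := (norm_add_le _ _).trans (by simpa using h1.le)
    · rw [indicator_of_notMem hω, norm_zero]
      exact add_nonneg (norm_nonneg _) hε.le
  have hSB' : IntegrableOn (S t) B Q := (integrable_indicator_iff hB').1 hSB
  have hS1 : Integrable (S ⊤) Q := h.memLp.integrable (by norm_num)
  have hS'i : Integrable (S' t) Q := integrable_condExp.congr hS'.symm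
  have hξ : Integrable (B.indicator fun ω => S (moveTime S ε (n + 1) ω) ω - S t ω) Q :=
    (integrable_indicator_iff hB').2 ((h.integrable (n + 1)).integrableOn.sub hSB')
  have hμ : Integrable (B.indicator fun ω => S' t ω - S t ω) Q :=
    (integrable_indicator_iff hB').2 (hS'i.integrableOn.sub hSB')
  refine ⟨hξ, ae_eq_condExp_of_forall_setIntegral_eq (F.le t) hξ (fun _ _ _ => hμ.integrableOn)
    (fun A hA _ => ?_)
    ((hS'm.sub (h.adapted t)).indicator hB).stronglyMeasurable.aestronglyMeasurable⟩
  have hAB : MeasurableSet[F t] (A ∩ B) := hA.inter hB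
  have hSAB : IntegrableOn (S t) (A ∩ B) Q := hSB'.mono_set inter_subset_right
  rw [setIntegral_indicator hB', setIntegral_indicator hB',
    integral_sub hS'i.integrableOn hSAB, integral_sub (h.integrable _).integrableOn hSAB,
    ← h.setIntegral_eq _ _ (h.measurableSet_of_subset_moveBlock hAB
      (inter_subset_right.trans hsub)), ← setIntegral_condExp (F.le t) hS1 hAB,
    setIntegral_congr_ae (F.le t _ hAB) (hS'.mono fun _ h _ => h)]

/-- Conditional Jensen inequality on a block. -/
lemma ae_indicator_le_condExp [IsFiniteMeasure Q] (h : IsMoveMartingale F Q S ε) (hε : 0 < ε)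
    (hS'm : Measurable[F t] (S' t)) (hS' : S' t =ᵐ[Q] Q[S ⊤|F t]) (hB : MeasurableSet[F t] B)
    (hsub : B ⊆ moveBlock S ε n t) {Φ : Euc d → ℝ} (hΦ : ConvexOn ℝ univ Φ) (hΦc : Continuous Φ)
    (hΦ0 : ∀ y, 0 ≤ Φ y) {ρ : Ω → ℝ} (hρ : Integrable ρ Q)
    (hle : ∀ᵐ ω ∂Q, Φ (B.indicator (fun ω => S (moveTime S ε (n + 1) ω) ω - S t ω) ω) ≤ ρ ω) :
    ∀ᵐ ω ∂Q, Φ (B.indicator (fun ω => S' t ω - S t ω) ω) ≤ (Q[ρ|F t]) ω := by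
  obtain ⟨hξ, hμ⟩ := h.condExp_indicator_sub hε hS'm hS' hB hsub
  have hΦi : Integrable (Φ ∘ B.indicator fun ω => S (moveTime S ε (n + 1) ω) ω - S t ω) Q := by
    refine hρ.mono' (hΦc.comp_aestronglyMeasurable hξ.aestronglyMeasurable) ?_
    filter_upwards [hle] with ω hω
    rw [Function.comp_apply, Real.norm_of_nonneg (hΦ0 _)]
    exact hω
  have h1 := ConvexOn.map_condExp_le_univ (F.le t) hΦ hΦc.lowerSemicontinuous hξ hΦi
  have h2 := condExp_mono (m := F t) hΦi hρ hle
  filter_upwards [h1, h2, hμ] with ω h1 h2 h3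
  rw [h3]
  exact h1.trans h2

lemma exists_mem_moveBlock (h : IsMoveMartingale F Q S ε) (hε : 0 < ε) (ht : t < ⊤) (ω : Ω) :
    ∃ n, ω ∈ moveBlock S ε n t := exists_moveTime_le_lt (h.cadlag ω) hε ht

end IsMoveMartingale

end Sampled

/-! ### The distance between the process and the martingale -/

section PathSup

variable {T : ℝ} [hT : Fact ((0 : ℝ) ≤ T)] {E : Type*} [NormedAddCommGroup E]
  {f : TimeInterval T → E}

lemma IsCadlagPath.exists_grid_lt (hf : IsCadlagPath f) {G : ℝ → ℝ} (hG : Monotone G)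
    (hGc : Continuous G) {x : ℝ} (hx : x < G (⨆ t, ‖f t‖)) : ∃ m j, x < G ‖f (grid m j)‖ := by
  by_contra! hne
  have h1 : ∀ t, G ‖f t‖ ≤ x := fun t =>
    forall_mem_of_forall_grid_mem (f := fun t => G ‖f t‖)
      (fun t => hGc.continuousAt.comp_continuousWithinAt (hf t).1.norm) isClosed_Iic hne t
  rw [hG.map_ciSup_of_continuousAt hGc.continuousAt hf.bddAbove_range_norm] at hx
  exact absurd (ciSup_le h1) (not_le.2 hx)

lemma IsCadlagPath.norm_le_iSup (hf : IsCadlagPath f) (t : TimeInterval T) :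
    ‖f t‖ ≤ ⨆ t, ‖f t‖ := le_ciSup hf.bddAbove_range_norm t

lemma IsCadlagPath.iSup_norm_nonneg (hf : IsCadlagPath f) : 0 ≤ ⨆ t, ‖f t‖ :=
  (norm_nonneg (f ⊤)).trans (hf.norm_le_iSup ⊤)

lemma measurable_iSup_norm {Ω : Type*} {m : MeasurableSpace Ω} {d : ℕ}
    {D : TimeInterval T → Ω → Euc d} (hD : ∀ t, Measurable (D t))
    (hc : ∀ ω, IsCadlagPath fun t => D t ω) : Measurable fun ω => ⨆ t, ‖D t ω‖ := by
  refine measurable_of_Ioi fun c => ?_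
  have e : (fun ω => ⨆ t, ‖D t ω‖) ⁻¹' Ioi c = ⋃ m, ⋃ j, {ω | c < ‖D (grid m j) ω‖} := by
    ext ω
    simp only [mem_preimage, mem_Ioi, mem_iUnion, mem_ofPred_eq]
    refine ⟨fun h => (hc ω).exists_grid_lt monotone_id continuous_id h, ?_⟩
    rintro ⟨m, j, h⟩
    exact h.trans_le ((hc ω).norm_le_iSup _)
  rw [e]
  exact MeasurableSet.iUnion fun m => MeasurableSet.iUnion fun j =>
    measurableSet_lt measurable_const (hD _).norm

end PathSup

section Estimate

variable {Ω : Type*} {mΩ : MeasurableSpace Ω} {T : ℝ} [hT : Fact ((0 : ℝ) ≤ T)] {d : ℕ}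
  {F : Filtration (TimeInterval T) mΩ} {Q : Measure Ω} [IsProbabilityMeasure Q]
  {S S' : TimeInterval T → Ω → Euc d} {ε : ℝ}

namespace IsMoveMartingale

lemma ae_eq_top (h : IsMoveMartingale F Q S ε) (hS' : ∀ t, S' t =ᵐ[Q] Q[S ⊤|F t]) :
    S' ⊤ =ᵐ[Q] S ⊤ := by
  have := condExp_of_stronglyMeasurable (μ := Q) (F.le ⊤) (h.adapted ⊤).stronglyMeasurable
    (h.memLp.integrable (by norm_num))
  rw [← this]
  exact hS' ⊤

variable {G : ℝ → ℝ} {R : Ω → ℝ}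

/-- On the block from `moveTime n` to `moveTime (n + 1)` the difference `S'_t - S_t` is the
conditional expectation of the next sampled value minus `S_t`, of norm at most `ε` plus that of the
step; Jensen's inequality gives the bound. -/
lemma ae_gauge_le (h : IsMoveMartingale F Q S ε) (hε : 0 < ε)
    (hS'm : ∀ t, Measurable[F t] (S' t)) (hS' : ∀ t, S' t =ᵐ[Q] Q[S ⊤|F t])
    (hG : ConvexOn ℝ univ G) (hGc : Continuous G) (hGm : Monotone G) (hG0 : ∀ x, 0 ≤ x → 0 ≤ G x)
    (hRi : Integrable R Q) (hR0 : ∀ ω, 0 ≤ R ω)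
    (hR : ∀ᵐ ω ∂Q, ∀ n, G (ε + ‖moveStep S ε n ω‖) ≤ G (2 * ε) + R ω) (t : TimeInterval T) :
    ∀ᵐ ω ∂Q, G ‖S t ω - S' t ω‖ ≤ G (2 * ε) + (Q[R|F t]) ω := by
  have hN0 : ∀ᵐ ω ∂Q, 0 ≤ (Q[R|F t]) ω := condExp_nonneg (ae_of_all _ hR0)
  rcases (le_top : t ≤ ⊤).eq_or_lt with rfl | ht
  · filter_upwards [h.ae_eq_top hS', hN0] with ω h1 h2
    rw [h1, sub_self, norm_zero]
    have := hGm (by positivity : 0 ≤ 2 * ε)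
    linarith
  have hΦ : ConvexOn ℝ univ fun y : Euc d => G ‖y‖ := by
    have h1 := (convexOn_norm (convex_univ (𝕜 := ℝ) (E := Euc d)))
    refine ⟨convex_univ, fun x _ y _ a b ha hb hab => ?_⟩
    exact (hGm (h1.2 (mem_univ x) (mem_univ y) ha hb hab)).trans
      (hG.2 (mem_univ _) (mem_univ _) ha hb hab)
  have hcond : Q[fun ω => G (2 * ε) + R ω|F t] =ᵐ[Q] fun ω => G (2 * ε) + (Q[R|F t]) ω := by
    have h1 := condExp_add (m := F t) (integrable_const (μ := Q) (G (2 * ε))) hRi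
    rw [condExp_const (F.le t)] at h1
    exact h1
  have hn : ∀ n, ∀ᵐ ω ∂Q, ω ∈ moveBlock S ε n t →
      G ‖S t ω - S' t ω‖ ≤ G (2 * ε) + (Q[R|F t]) ω := by
    intro n
    have h1 := h.ae_indicator_le_condExp hε (hS'm t) (hS' t) (h.measurableSet_moveBlock n t)
      subset_rfl hΦ (hGc.comp continuous_norm) (fun y => hG0 _ (norm_nonneg y))
      (ρ := fun ω => G (2 * ε) + R ω) ((integrable_const _).add hRi) (by
        filter_upwards [hR] with ω hω
        by_cases hB : ω ∈ moveBlock S ε n t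
        · refine le_trans (hGm ?_) (hω n)
          rw [indicator_of_mem hB]
          have h1 : ‖S t ω - S (moveTime S ε n ω) ω‖ < ε :=
            norm_sub_lt_of_lt_nextMove (f := fun t => S t ω) hε hB.1 hB.2
          have e : S (moveTime S ε (n + 1) ω) ω - S t ω =
            moveStep S ε n ω - (S t ω - S (moveTime S ε n ω) ω) := by rw [moveStep]; abel
          rw [e]
          exact (norm_sub_le _ _).trans (by linarith)
        · rw [indicator_of_notMem hB, norm_zero]
          have := hGm (by positivity : 0 ≤ 2 * ε)
          linarith [hR0 ω])
    filter_upwards [h1, hcond] with ω h1 h2 hB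
    rw [indicator_of_mem hB, h2, norm_sub_rev] at h1
    exact h1
  filter_upwards [ae_all_iff.2 hn] with ω hω
  obtain ⟨n, hn⟩ := h.exists_mem_moveBlock hε ht ω
  exact hω n hn

/-- A weak `L²` maximal inequality, by first entrance along the grids. -/
lemma measure_gauge_gt_le (h : IsMoveMartingale F Q S ε) (hε : 0 < ε)
    (hS'm : ∀ t, Measurable[F t] (S' t)) (hS' : ∀ t, S' t =ᵐ[Q] Q[S ⊤|F t])
    (hS'c : ∀ ω, IsCadlagPath fun t => S' t ω)
    (hG : ConvexOn ℝ univ G) (hGc : Continuous G) (hGm : Monotone G) (hG0 : ∀ x, 0 ≤ x → 0 ≤ G x)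
    (hR2 : MemLp R 2 Q) (hR0 : ∀ ω, 0 ≤ R ω)
    (hR : ∀ᵐ ω ∂Q, ∀ n, G (ε + ‖moveStep S ε n ω‖) ≤ G (2 * ε) + R ω) {r : ℝ} (hr : 0 < r) :
    Q {ω | r < G (⨆ t, ‖S t ω - S' t ω‖) - G (2 * ε)} ≤
      ENNReal.ofReal ((∫ ω, R ω ^ 2 ∂Q) / r ^ 2) := by
  have hRi : Integrable R Q := hR2.integrable (by norm_num)
  have hRs : Integrable (fun ω => R ω ^ 2) Q := hR2.integrable_sq
  set A : TimeInterval T → Set Ω := fun t => {ω | G (2 * ε) + r < G ‖S t ω - S' t ω‖} with hA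
  have hAm : ∀ t, MeasurableSet[F t] (A t) := fun t =>
    measurableSet_lt (@measurable_const _ _ _ (F t) _)
      (hGc.measurable.comp (measurable_norm.comp ((h.adapted t).sub (hS'm t))))
  have hsub : {ω | r < G (⨆ t, ‖S t ω - S' t ω‖) - G (2 * ε)} ⊆ ⋃ m, ⋃ j, A (grid m j) := by
    intro ω hω
    have hω' : r < G (⨆ t, ‖S t ω - S' t ω‖) - G (2 * ε) := hω
    obtain ⟨m, j, hmj⟩ := ((h.cadlag ω).sub (hS'c ω)).exists_grid_lt hGm hGc
      (show G (2 * ε) + r < _ by linarith)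
    exact mem_iUnion.2 ⟨m, mem_iUnion.2 ⟨j, hmj⟩⟩
  have hfe := measure_iUnion_grid_le (F := F) (α := ENNReal.ofReal (r ^ 2) • Q)
    (β := Q.withDensity fun ω => ENNReal.ofReal (R ω ^ 2)) hAm (by
      intro t E hE hEA
      have hE' := F.le _ _ hE
      rw [Measure.smul_apply, smul_eq_mul, withDensity_apply _ hE',
        ← ofReal_integral_eq_lintegral_ofReal hRs.integrableOn (ae_of_all _ fun ω => by positivity),
        ← ofReal_measureReal, ← ENNReal.ofReal_mul (by positivity)]
      refine ENNReal.ofReal_le_ofReal ?_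
      have h1 : r * Q.real E ≤ ∫ ω in E, R ω ∂Q := by
        rw [← setIntegral_condExp (F.le t) hRi hE]
        calc r * Q.real E = ∫ _ in E, r ∂Q := by rw [setIntegral_const, smul_eq_mul, mul_comm]
          _ ≤ _ := by
            refine setIntegral_mono_on_ae (integrable_const _).integrableOn
              integrable_condExp.integrableOn hE' ?_
            filter_upwards [h.ae_gauge_le hε hS'm hS' hG hGc hGm hG0 hRi hR0 hR t] with ω hω hωE
            have : G (2 * ε) + r < G ‖S t ω - S' t ω‖ := hEA hωE
            linarith
      have h2 : 0 ≤ ∫ ω in E, (R ω - r) ^ 2 ∂Q := integral_nonneg fun ω => sq_nonneg _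
      have h3 : ∫ ω in E, (R ω - r) ^ 2 ∂Q =
          ∫ ω in E, R ω ^ 2 ∂Q - 2 * r * ∫ ω in E, R ω ∂Q + r ^ 2 * Q.real E := by
        have e : ∀ ω, (R ω - r) ^ 2 = R ω ^ 2 - 2 * r * R ω + r ^ 2 := fun ω => by ring
        simp only [e]
        have i2 : Integrable (fun ω => 2 * r * R ω) (Q.restrict E) :=
          hRi.integrableOn.const_mul _
        have i3 : Integrable (fun ω => R ω ^ 2 - 2 * r * R ω) (Q.restrict E) :=
          hRs.integrableOn.sub i2
        rw [integral_add i3 (integrable_const _), integral_sub hRs.integrableOn i2,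
          integral_const_mul, setIntegral_const, smul_eq_mul]
        ring
      -- `r * Q E ≤ ∫ R` and `0 ≤ ∫ (R - r) ^ 2` over `E` give `r ^ 2 * Q E ≤ ∫ R ^ 2`
      nlinarith)
  rw [withDensity_apply _ MeasurableSet.univ, Measure.restrict_univ,
    ← ofReal_integral_eq_lintegral_ofReal hRs (ae_of_all _ fun ω => by positivity),
    Measure.smul_apply, smul_eq_mul] at hfe
  refine (measure_mono hsub).trans ?_
  rw [ENNReal.ofReal_div_of_pos (by positivity), ENNReal.le_div_iff_mul_le
    (Or.inl (by simpa using hr.ne')) (Or.inl ENNReal.ofReal_ne_top), mul_comm]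
  exact hfe

/-- The bound on the expected gauge of the maximal distance. The weak inequality with
`E[R ^ 2] ≤ ε / 16`, integrated from the level `√ε / 2`, costs at most `3 / 4 * √ε`. -/
lemma integral_gauge_lt (h : IsMoveMartingale F Q S ε) (hε : 0 < ε)
    (hS'm : ∀ t, Measurable[F t] (S' t)) (hS' : ∀ t, S' t =ᵐ[Q] Q[S ⊤|F t])
    (hS'c : ∀ ω, IsCadlagPath fun t => S' t ω)
    (hG : ConvexOn ℝ univ G) (hGc : Continuous G) (hGm : Monotone G) (hG0 : ∀ x, 0 ≤ x → 0 ≤ G x)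
    (hR2 : MemLp R 2 Q) (hR0 : ∀ ω, 0 ≤ R ω) (hRε : ∫ ω, R ω ^ 2 ∂Q ≤ ε / 16)
    (hR : ∀ᵐ ω ∂Q, ∀ n, G (ε + ‖moveStep S ε n ω‖) ≤ G (2 * ε) + R ω) :
    Integrable (fun ω => G (⨆ t, ‖S t ω - S' t ω‖)) Q ∧
      ∫ ω, G (⨆ t, ‖S t ω - S' t ω‖) ∂Q < G (2 * ε) + 2 * √ε := by
  set Z : Ω → ℝ := fun ω => ⨆ t, ‖S t ω - S' t ω‖ with hZ
  have hZm : Measurable Z := measurable_iSup_norm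
    (D := fun t ω => S t ω - S' t ω)
    (fun t => ((h.adapted t).mono (F.le t) le_rfl).sub ((hS'm t).mono (F.le t) le_rfl))
    fun ω => (h.cadlag ω).sub (hS'c ω)
  have hZ0 : ∀ ω, 0 ≤ Z ω := fun ω => ((h.cadlag ω).sub (hS'c ω)).iSup_norm_nonneg
  have hGZ : Measurable fun ω => G (Z ω) := hGc.measurable.comp hZm
  have hs : 0 < √ε := Real.sqrt_pos.2 hε
  have hV := lintegral_ofReal_le_of_weak (Q := Q) (V := fun ω => G (Z ω) - G (2 * ε))
    (hGZ.sub_const _) (a := √ε / 2) (C := ε / 16) (by positivity) (by positivity) fun r hr =>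
      (h.measure_gauge_gt_le hε hS'm hS' hS'c hG hGc hGm hG0 hR2 hR0 hR hr).trans
        (ENNReal.ofReal_le_ofReal (by gcongr))
  have he : √ε / 2 + 2 * (ε / 16) / (√ε / 2) = 3 / 4 * √ε := by
    have := Real.mul_self_sqrt hε.le
    field_simp
    nlinarith
  rw [he] at hV
  have hG2 : 0 ≤ G (2 * ε) := hG0 _ (by positivity)
  have hle : ∫⁻ ω, ENNReal.ofReal (G (Z ω)) ∂Q ≤ ENNReal.ofReal (G (2 * ε) + 3 / 4 * √ε) := by
    calc ∫⁻ ω, ENNReal.ofReal (G (Z ω)) ∂Q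
        ≤ ∫⁻ ω, (ENNReal.ofReal (G (2 * ε)) + ENNReal.ofReal (G (Z ω) - G (2 * ε))) ∂Q := by
          refine lintegral_mono fun ω => ?_
          have := ENNReal.ofReal_add_le (p := G (2 * ε)) (q := G (Z ω) - G (2 * ε))
          simpa using this
      _ = ENNReal.ofReal (G (2 * ε)) + ∫⁻ ω, ENNReal.ofReal (G (Z ω) - G (2 * ε)) ∂Q := by
          rw [lintegral_add_left measurable_const]; simp
      _ ≤ _ := by
          rw [ENNReal.ofReal_add hG2 (by positivity)]
          gcongr
  have hi : Integrable (fun ω => G (Z ω)) Q :=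
    (lintegral_ofReal_ne_top_iff_integrable hGZ.aestronglyMeasurable
      (ae_of_all _ fun ω => hG0 _ (hZ0 ω))).1 (ne_top_of_le_ne_top ENNReal.ofReal_ne_top hle)
  refine ⟨hi, ?_⟩
  rw [integral_eq_lintegral_of_nonneg_ae (ae_of_all _ fun ω => hG0 _ (hZ0 ω))
    hGZ.aestronglyMeasurable]
  refine (ENNReal.toReal_le_of_le_ofReal (by positivity) hle).trans_lt ?_
  linarith

end IsMoveMartingale

end Estimate

/-! ### Positivity of càdlàg martingales -/

section Positivity

variable {Ω : Type*} {mΩ : MeasurableSpace Ω} {T : ℝ} [hT : Fact ((0 : ℝ) ≤ T)]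
  {F : Filtration (TimeInterval T) mΩ} {Q : Measure Ω} [IsProbabilityMeasure Q]
  {X : Ω → ℝ} {N : TimeInterval T → Ω → ℝ}

lemma ae_forall_nonneg_of_terminal_nonneg (hX0 : ∀ᵐ ω ∂Q, 0 ≤ X ω)
    (hN : ∀ t, N t =ᵐ[Q] Q[X|F t])
    (hc : ∀ ω t, ContinuousWithinAt (fun t => N t ω) (Ici t) t) :
    ∀ᵐ ω ∂Q, ∀ t, 0 ≤ N t ω := by
  have h1 : ∀ t, ∀ᵐ ω ∂Q, 0 ≤ N t ω := fun t => by
    filter_upwards [hN t, condExp_nonneg (m := F t) hX0] with ω h1 h2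
    rw [h1]; exact h2
  filter_upwards [ae_all_iff.2 fun m => ae_all_iff.2 fun j => h1 (grid m j)] with ω hω t
  exact forall_mem_of_forall_grid_mem (hc ω) isClosed_Ici hω t

/-- A càdlàg martingale with strictly positive terminal value stays strictly positive: the terminal
value has expectation at most `δ` on the event that the martingale falls below `δ`. -/
lemma ae_forall_pos_of_terminal_pos (hX : Integrable X Q) (hX0 : ∀ᵐ ω ∂Q, 0 < X ω)
    (hNm : ∀ t, Measurable[F t] (N t)) (hN : ∀ t, N t =ᵐ[Q] Q[X|F t])
    (hc : ∀ ω t, ContinuousWithinAt (fun t => N t ω) (Ici t) t) :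
    ∀ᵐ ω ∂Q, ∀ t, 0 < N t ω := by
  set α : Measure Ω := Q.withDensity fun ω => ENNReal.ofReal (X ω) with hα
  set U : ℕ → Set Ω := fun k => ⋃ m, ⋃ j, {ω | N (grid m j) ω < 1 / (k + 1)} with hU
  have hUle : ∀ k, α (U k) ≤ ENNReal.ofReal (1 / (k + 1)) := by
    intro k
    have := measure_iUnion_grid_le (F := F) (α := α) (β := ENNReal.ofReal (1 / (k + 1)) • Q)
      (A := fun t => {ω | N t ω < 1 / (k + 1)})
      (fun t => measurableSet_lt (hNm t) (@measurable_const _ _ _ (F t) _)) (by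
        intro t E hE hEA
        have hE' := F.le _ _ hE
        rw [hα, withDensity_apply _ hE', ← ofReal_integral_eq_lintegral_ofReal hX.integrableOn
          (ae_restrict_of_ae (hX0.mono fun ω h => h.le)), Measure.smul_apply, smul_eq_mul,
          ← ofReal_measureReal, ← ENNReal.ofReal_mul (by positivity)]
        refine ENNReal.ofReal_le_ofReal ?_
        rw [← setIntegral_condExp (F.le t) hX hE]
        calc ∫ ω in E, (Q[X|F t]) ω ∂Q ≤ ∫ _ in E, (1 / ((k : ℝ) + 1)) ∂Q := by
              refine setIntegral_mono_on_ae integrable_condExp.integrableOn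
                (integrable_const _).integrableOn hE' ?_
              filter_upwards [hN t] with ω h1 h2
              rw [← h1]
              exact le_of_lt (hEA h2)
          _ = 1 / (k + 1) * Q.real E := by rw [setIntegral_const, smul_eq_mul, mul_comm])
    simpa [hU] using this
  have hα0 : α (⋂ k, U k) = 0 := by
    refine le_antisymm (ge_of_tendsto' (x := atTop) ?_ fun k =>
      (measure_mono (iInter_subset _ k)).trans (hUle k)) zero_le
    simpa using ENNReal.tendsto_ofReal (tendsto_one_div_add_atTop_nhds_zero_nat (𝕜 := ℝ))
  have hQα : Q ≪ α := withDensity_absolutelyContinuous'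
    hX.aestronglyMeasurable.aemeasurable.ennreal_ofReal (by
      filter_upwards [hX0] with ω hω using (ENNReal.ofReal_pos.2 hω).ne')
  have h0 : ∀ᵐ ω ∂Q, ω ∉ ⋂ k, U k := measure_eq_zero_iff_ae_notMem.1 (hQα hα0)
  filter_upwards [h0] with ω hω t
  obtain ⟨k, hk⟩ : ∃ k, ω ∉ U k := by simpa using hω
  have hk' : ∀ m j, 1 / ((k : ℝ) + 1) ≤ N (grid m j) ω := fun m j => by
    by_contra! hlt
    exact hk (mem_iUnion.2 ⟨m, mem_iUnion.2 ⟨j, hlt⟩⟩)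
  have := forall_mem_of_forall_grid_mem (hc ω) (isClosed_Ici (a := 1 / ((k : ℝ) + 1))) hk' t
  exact lt_of_lt_of_le (by positivity) this

end Positivity

/-! ### The uniform bound for continuous processes -/

section ContinuousCase

variable {Ω : Type*} {mΩ : MeasurableSpace Ω} {T : ℝ} [hT : Fact ((0 : ℝ) ≤ T)] {d : ℕ}
  {F : Filtration (TimeInterval T) mΩ} {Q : Measure Ω} [IsProbabilityMeasure Q]
  {S S' : TimeInterval T → Ω → Euc d} {ε : ℝ}

/-- For a continuous path, before the next move time `S` can be at distance nearly `ε` from its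
last value only close to the next move time. -/
lemma exists_forall_moveBlock_close {ω : Ω} (hf : Continuous fun t => S t ω)
    (hc : IsCadlagPath fun t => S t ω) (hε : 0 < ε) :
    ∃ k : ℕ, ∀ n t, ω ∈ moveBlock S ε n t →
      ε - 1 / (k + 1) < ‖S t ω - S (moveTime S ε n ω) ω‖ →
      ‖S t ω - S (moveTime S ε (n + 1) ω) ω‖ < ε / 2 := by
  have hn : ∀ n, ∃ k : ℕ, ∀ t, ω ∈ moveBlock S ε n t →
      ε - 1 / (k + 1) < ‖S t ω - S (moveTime S ε n ω) ω‖ →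
      ‖S t ω - S (moveTime S ε (n + 1) ω) ω‖ < ε / 2 := by
    intro n
    set a := moveTime S ε n ω
    set b := moveTime S ε (n + 1) ω with hb
    set C : Set (TimeInterval T) := Icc a b ∩ {t | ε / 2 ≤ ‖S t ω - S b ω‖} with hC
    have hCc : IsCompact C := isCompact_Icc.inter_right
      (isClosed_le continuous_const (hf.sub continuous_const).norm)
    rcases C.eq_empty_or_nonempty with he | hne
    · refine ⟨0, fun t ht _ => ?_⟩
      by_contra! hlt
      have : t ∈ C := ⟨⟨ht.1, ht.2.le⟩, hlt⟩
      rw [he] at this; exact this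
    obtain ⟨s, hs, hmax⟩ := hCc.exists_isMaxOn hne
      ((hf.sub continuous_const).norm.continuousOn (f := fun t => ‖S t ω - S a ω‖))
    have hsb : s < b := by
      refine lt_of_le_of_ne hs.1.2 fun h => ?_
      have h1 : ε / 2 ≤ ‖S s ω - S b ω‖ := hs.2
      rw [h, sub_self, norm_zero] at h1
      linarith
    have hlt : ‖S s ω - S a ω‖ < ε :=
      norm_sub_lt_of_lt_nextMove (f := fun t => S t ω) hε hs.1.1 hsb
    obtain ⟨k, hk⟩ := exists_nat_one_div_lt (sub_pos.2 hlt)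
    refine ⟨k, fun t ht hkt => ?_⟩
    by_contra! hge
    have h1 : ‖S t ω - S a ω‖ ≤ ‖S s ω - S a ω‖ := hmax (show t ∈ C from ⟨⟨ht.1, ht.2.le⟩, hge⟩)
    linarith
  choose k hk using hn
  obtain ⟨N, hN⟩ := exists_moveTime_eq_top hc hε
  refine ⟨(Finset.range N).sup k, fun n t ht hlt => hk n t ht (lt_of_le_of_lt ?_ hlt)⟩
  have hnN : n < N := by
    by_contra! hge
    have h1 := moveTime_mono S ε ω hge
    simp only [hN] at h1
    exact absurd (h1.trans ht.1) (not_le.2 (ht.2.trans_le le_top))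
  have h1 : k n ≤ (Finset.range N).sup k := Finset.le_sup (Finset.mem_range.2 hnN)
  have h2 : (1 : ℝ) / (((Finset.range N).sup k : ℕ) + 1) ≤ 1 / (k n + 1) := by
    have : (k n : ℝ) ≤ ((Finset.range N).sup k : ℕ) := by exact_mod_cast h1
    gcongr
  linarith

namespace IsMoveMartingale

variable {t : TimeInterval T} {n : ℕ} {E : Set Ω}

lemma ae_norm_indicator_le (hcont : ∀ᵐ ω ∂Q, Continuous fun t => S t ω) (hε : 0 < ε)
    {c : ℝ} (hc : -ε ≤ c)
    (hE : ∀ ω ∈ E, ‖S t ω - S (moveTime S ε n ω) ω‖ ≤ c) :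
    ∀ᵐ ω ∂Q, ‖E.indicator (fun ω => S (moveTime S ε (n + 1) ω) ω - S t ω) ω‖ ≤ ε + c := by
  filter_upwards [hcont] with ω hω
  by_cases h : ω ∈ E
  · rw [indicator_of_mem h]
    have h1 : ‖S (moveTime S ε (n + 1) ω) ω - S (moveTime S ε n ω) ω‖ ≤ ε :=
      norm_sub_nextMove_le hω hε
    have e : S (moveTime S ε (n + 1) ω) ω - S t ω =
      (S (moveTime S ε (n + 1) ω) ω - S (moveTime S ε n ω) ω) -
        (S t ω - S (moveTime S ε n ω) ω) := by abel
    rw [e]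
    exact (norm_sub_le _ _).trans (add_le_add h1 (hE ω h))
  · rw [indicator_of_notMem h, norm_zero]; linarith

/-- The conditional variance of the next sampled value is small where `S'_t` is almost as far as
possible from `S_t`. -/
lemma integral_norm_sub_sq_le (h : IsMoveMartingale F Q S ε) (hε : 0 < ε)
    (hcont : ∀ᵐ ω ∂Q, Continuous fun t => S t ω)
    (hS'm : ∀ t, Measurable[F t] (S' t)) (hS' : ∀ t, S' t =ᵐ[Q] Q[S ⊤|F t])
    (hE : MeasurableSet[F t] E) (hsub : E ⊆ moveBlock S ε n t) {η : ℝ} (hη : η ≤ 2 * ε)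
    (hη0 : 0 ≤ η)
    (hfar : ∀ ω ∈ E, 2 * ε - η < ‖S t ω - S' t ω‖) :
    ∫⁻ ω in E, ENNReal.ofReal (‖S (moveTime S ε (n + 1) ω) ω - S' t ω‖ ^ 2) ∂Q ≤
      ENNReal.ofReal (4 * ε * η) * Q E := by
  have hE' := F.le _ _ hE
  obtain ⟨hξi, hμ⟩ := h.condExp_indicator_sub hε (hS'm t) (hS' t) hE hsub
  set ξ : Ω → Euc d := E.indicator fun ω => S (moveTime S ε (n + 1) ω) ω - S t ω with hξ
  set μ : Ω → Euc d := E.indicator fun ω => S' t ω - S t ω with hμdef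
  have hξb : ∀ᵐ ω ∂Q, ‖ξ ω‖ ≤ 2 * ε := by
    have := ae_norm_indicator_le (Q := Q) hcont hε (c := ε) (by linarith) fun ω hω =>
      (norm_sub_lt_of_lt_nextMove (f := fun t => S t ω) hε (hsub hω).1 (hsub hω).2).le
    filter_upwards [this] with ω hω
    rw [two_mul]; exact hω
  have hμb : ∀ᵐ ω ∂Q, ‖μ ω‖ ≤ 2 * ε := by
    have := h.ae_indicator_le_condExp hε (hS'm t) (hS' t) hE hsub
      (convexOn_norm (convex_univ (𝕜 := ℝ) (E := Euc d))) continuous_norm norm_nonneg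
      (ρ := fun _ => 2 * ε) (integrable_const _) hξb
    rw [condExp_const (F.le t)] at this
    exact this
  have hμm : Measurable[F t] μ := ((hS'm t).sub (h.adapted t)).indicator hE
  have hμi : Integrable μ Q := integrable_condExp.congr hμ.symm
  have hξ2 : MemLp ξ 2 Q := (memLp_top_of_bound hξi.aestronglyMeasurable _ hξb).mono_exponent le_top
  have hμ2 : MemLp μ 2 Q := (memLp_top_of_bound hμi.aestronglyMeasurable _ hμb).mono_exponent le_top
  have hin : Integrable (fun ω => inner ℝ (μ ω) (ξ ω)) Q := by
    refine Integrable.of_bound (hμi.aestronglyMeasurable.inner hξi.aestronglyMeasurable)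
      (2 * ε * (2 * ε)) ?_
    filter_upwards [hμb, hξb] with ω h1 h2
    exact (norm_inner_le_norm _ _).trans (mul_le_mul h1 h2 (norm_nonneg _) (by positivity))
  have hcross : ∫ ω, inner ℝ (μ ω) (ξ ω) ∂Q = ∫ ω, ‖μ ω‖ ^ 2 ∂Q := by
    have h1 := condExp_bilin_of_stronglyMeasurable_left (innerSL ℝ) hμm.stronglyMeasurable
      (g := ξ) (μ := Q) (m := F t) hin hξi
    have h2 : ∫ ω, (Q[fun ω => innerSL ℝ (μ ω) (ξ ω)|F t]) ω ∂Q =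
      ∫ ω, inner ℝ (μ ω) (ξ ω) ∂Q := integral_condExp (F.le t)
    rw [← h2]
    refine integral_congr_ae ?_
    filter_upwards [h1, hμ] with ω h1 h2
    rw [h1, ← h2]
    exact (innerSL_apply_apply ℝ _ _).trans (real_inner_self_eq_norm_sq _)
  have hξs : Integrable (fun ω => ‖ξ ω‖ ^ 2) Q := hξ2.integrable_norm_pow (by norm_num)
  have hμs : Integrable (fun ω => ‖μ ω‖ ^ 2) Q := hμ2.integrable_norm_pow (by norm_num)
  have hds : Integrable (fun ω => ‖ξ ω - μ ω‖ ^ 2) Q :=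
    (hξ2.sub hμ2).integrable_norm_pow (by norm_num)
  have hvar : ∫ ω, ‖ξ ω - μ ω‖ ^ 2 ∂Q = ∫ ω, ‖ξ ω‖ ^ 2 ∂Q - ∫ ω, ‖μ ω‖ ^ 2 ∂Q := by
    have e : ∀ ω, ‖ξ ω - μ ω‖ ^ 2 = ‖ξ ω‖ ^ 2 - 2 * inner ℝ (μ ω) (ξ ω) + ‖μ ω‖ ^ 2 := fun ω => by
      rw [norm_sub_sq_real, real_inner_comm]
    simp only [e]
    have i1 : Integrable (fun ω => ‖ξ ω‖ ^ 2 - 2 * inner ℝ (μ ω) (ξ ω)) Q :=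
      hξs.sub (hin.const_mul 2)
    rw [integral_add i1 hμs, integral_sub hξs (hin.const_mul 2), integral_const_mul, hcross]
    ring
  have hE1 : ∫ ω, ‖ξ ω‖ ^ 2 ∂Q ≤ (2 * ε) ^ 2 * Q.real E := by
    calc ∫ ω, ‖ξ ω‖ ^ 2 ∂Q ≤ ∫ ω, E.indicator (fun _ => (2 * ε) ^ 2) ω ∂Q := by
          refine integral_mono_ae hξs ((integrable_const _).indicator hE') ?_
          filter_upwards [hξb] with ω hω
          by_cases hωE : ω ∈ E
          · rw [indicator_of_mem hωE]
            exact pow_le_pow_left₀ (norm_nonneg _) hω 2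
          · rw [indicator_of_notMem hωE, hξ, indicator_of_notMem hωE]; simp
      _ = _ := by rw [integral_indicator_const _ hE', smul_eq_mul, mul_comm]
  have hE2 : (2 * ε - η) ^ 2 * Q.real E ≤ ∫ ω, ‖μ ω‖ ^ 2 ∂Q := by
    calc (2 * ε - η) ^ 2 * Q.real E = ∫ ω, E.indicator (fun _ => (2 * ε - η) ^ 2) ω ∂Q := by
          rw [integral_indicator_const _ hE', smul_eq_mul, mul_comm]
      _ ≤ _ := by
          refine integral_mono ((integrable_const _).indicator hE') hμs fun ω => ?_
          by_cases hωE : ω ∈ E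
          · simp only [hμdef, indicator_of_mem hωE]
            have := hfar ω hωE
            rw [norm_sub_rev] at this
            exact pow_le_pow_left₀ (by linarith) this.le 2
          · simp only [indicator_of_notMem hωE]; positivity
  have hfin : ∫ ω, ‖ξ ω - μ ω‖ ^ 2 ∂Q ≤ 4 * ε * η * Q.real E := by
    have h0 : 0 ≤ Q.real E := measureReal_nonneg
    have : 0 ≤ η ^ 2 * Q.real E := by positivity
    rw [hvar]; nlinarith
  have e : ∫⁻ ω in E, ENNReal.ofReal (‖S (moveTime S ε (n + 1) ω) ω - S' t ω‖ ^ 2) ∂Q =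
      ∫⁻ ω in E, ENNReal.ofReal (‖ξ ω - μ ω‖ ^ 2) ∂Q := by
    refine setLIntegral_congr_fun hE' fun ω hω => ?_
    simp only [hξ, hμdef, indicator_of_mem hω]
    congr 3; abel
  rw [e]
  calc ∫⁻ ω in E, ENNReal.ofReal (‖ξ ω - μ ω‖ ^ 2) ∂Q
      ≤ ∫⁻ ω, ENNReal.ofReal (‖ξ ω - μ ω‖ ^ 2) ∂Q := setLIntegral_le_lintegral _ _
    _ = ENNReal.ofReal (∫ ω, ‖ξ ω - μ ω‖ ^ 2 ∂Q) :=
        (ofReal_integral_eq_lintegral_ofReal hds (ae_of_all _ fun ω => by positivity)).symm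
    _ ≤ ENNReal.ofReal (4 * ε * η * Q.real E) := ENNReal.ofReal_le_ofReal hfin
    _ = _ := by rw [ENNReal.ofReal_mul (by positivity), ofReal_measureReal]

/-- The event that `S'_t` is almost at distance `2 * ε` from `S_t`. The second condition then holds
almost surely; it is included because it forces `t` to be close to the next move time. -/
def farEvent (S S' : TimeInterval T → Ω → Euc d) (ε η : ℝ) (n : ℕ) (t : TimeInterval T) : Set Ω :=
  moveBlock S ε n t ∩ ({ω | ε - η < ‖S t ω - S (min (moveTime S ε n ω) t) ω‖} ∩
    {ω | 2 * ε - η < ‖S t ω - S' t ω‖})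

lemma measurableSet_farEvent (h : IsMoveMartingale F Q S ε) (hS'm : ∀ t, Measurable[F t] (S' t))
    (η : ℝ) (n : ℕ) (t : TimeInterval T) : MeasurableSet[F t] (farEvent S S' ε η n t) := by
  have h1 := measurable_eval_of_le h.adapted (fun ω t => (h.cadlag ω t).1)
    ((h.isTime n).measurable_min t) fun ω => min_le_right _ _
  refine (h.measurableSet_moveBlock n t).inter (MeasurableSet.inter ?_ ?_)
  · exact measurableSet_lt (@measurable_const _ _ _ (F t) _)
      (measurable_norm.comp ((h.adapted t).sub h1))
  · exact measurableSet_lt (@measurable_const _ _ _ (F t) _)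
      (measurable_norm.comp ((h.adapted t).sub (hS'm t)))

lemma ae_lt_of_far (h : IsMoveMartingale F Q S ε) (hε : 0 < ε)
    (hcont : ∀ᵐ ω ∂Q, Continuous fun t => S t ω)
    (hS'm : ∀ t, Measurable[F t] (S' t)) (hS' : ∀ t, S' t =ᵐ[Q] Q[S ⊤|F t]) {η : ℝ} (hη : η ≤ ε)
    (n : ℕ) (t : TimeInterval T) :
    ∀ᵐ ω ∂Q, ω ∈ moveBlock S ε n t → 2 * ε - η < ‖S t ω - S' t ω‖ →
      ω ∈ farEvent S S' ε η n t := by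
  have h1 := measurable_eval_of_le h.adapted (fun ω t => (h.cadlag ω t).1)
    ((h.isTime n).measurable_min t) fun ω => min_le_right _ _
  set E := moveBlock S ε n t ∩ {ω | ‖S t ω - S (min (moveTime S ε n ω) t) ω‖ ≤ ε - η} with hE
  have hEm : MeasurableSet[F t] E := (h.measurableSet_moveBlock n t).inter
    (measurableSet_le (measurable_norm.comp ((h.adapted t).sub h1))
      (@measurable_const _ _ _ (F t) _))
  have h2 := ae_norm_indicator_le (Q := Q) (n := n) (t := t) (E := E) hcont hε (c := ε - η)
    (by linarith) fun ω hω => by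
      have := hω.2
      rw [mem_ofPred_eq, min_eq_left hω.1.1] at this
      exact this
  have h3 := h.ae_indicator_le_condExp hε (hS'm t) (hS' t) hEm inter_subset_left
    (convexOn_norm (convex_univ (𝕜 := ℝ) (E := Euc d))) continuous_norm norm_nonneg
    (ρ := fun _ => ε + (ε - η)) (integrable_const _) h2
  rw [condExp_const (F.le t)] at h3
  filter_upwards [h3] with ω h3 hB hfar
  refine ⟨hB, ?_, hfar⟩
  rw [mem_ofPred_eq]
  by_contra! hle
  rw [indicator_of_mem (show ω ∈ E from ⟨hB, hle⟩), norm_sub_rev] at h3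
  linarith

lemma pairwise_disjoint_moveBlock (t : TimeInterval T) :
    Pairwise (Function.onFun Disjoint fun n => moveBlock S ε n t) := by
  intro i j hij
  wlog hlt : i < j generalizing i j
  · exact (this hij.symm (lt_of_le_of_ne (not_lt.1 hlt) hij.symm)).symm
  refine Set.disjoint_left.2 fun ω hi hj => ?_
  have h1 := moveTime_mono S ε ω (Nat.succ_le_of_lt hlt)
  exact absurd (h1.trans hj.1) (not_le.2 hi.2)

/-- For a continuous process, the distance to the martingale is strictly below `2 * ε`. Near the
bound `2 * ε`, the process `S` must be about to reach its next move time, whereas `S'` is far from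
the next sampled value, and the latter event has small probability by the variance estimate. -/
lemma ae_iSup_lt (h : IsMoveMartingale F Q S ε) (hε : 0 < ε)
    (hcont : ∀ᵐ ω ∂Q, Continuous fun t => S t ω)
    (hS'm : ∀ t, Measurable[F t] (S' t)) (hS' : ∀ t, S' t =ᵐ[Q] Q[S ⊤|F t])
    (hS'c : ∀ ω, IsCadlagPath fun t => S' t ω) :
    ∀ᵐ ω ∂Q, (⨆ t, ‖S t ω - S' t ω‖) < 2 * ε := by
  set K : ℕ → Set Ω := fun k => {ω | ∀ n t, ω ∈ moveBlock S ε n t →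
      ε - 1 / (k + 1) < ‖S t ω - S (moveTime S ε n ω) ω‖ →
      ‖S t ω - S (moveTime S ε (n + 1) ω) ω‖ < ε / 2} with hK
  set U : ℝ → Set Ω := fun η => ⋃ m, ⋃ j, ⋃ n, farEvent S S' ε η n (grid m j) with hU
  have hUm : ∀ η, MeasurableSet (U η) := fun η => MeasurableSet.iUnion fun m =>
    MeasurableSet.iUnion fun j => MeasurableSet.iUnion fun n =>
      F.le _ _ (h.measurableSet_farEvent hS'm η n (grid m j))
  have hUK : ∀ (k : ℕ) (η : ℝ), 0 < η → η ≤ 1 / ((k : ℝ) + 1) → η ≤ ε / 2 →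
      Q (U η ∩ K k) ≤ ENNReal.ofReal (4 * η / ε) := by
    intro k η hη0 hηk hηε
    have hfe := measure_iUnion_grid_le (F := F) (α := Q.restrict (K k))
      (β := ENNReal.ofReal (4 * η / ε) • Q) (A := fun t => ⋃ n, farEvent S S' ε η n t)
      (fun t => MeasurableSet.iUnion fun n => h.measurableSet_farEvent hS'm η n t) (by
        intro t E hE hEA
        have hEn : ∀ n, MeasurableSet[F t] (E ∩ moveBlock S ε n t) := fun n =>
          hE.inter (h.measurableSet_moveBlock n t)
        have hEu : E = ⋃ n, E ∩ moveBlock S ε n t := by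
          refine subset_antisymm (fun ω hω => ?_) (iUnion_subset fun n => inter_subset_left)
          obtain ⟨n, hn⟩ := mem_iUnion.1 (hEA hω)
          exact mem_iUnion.2 ⟨n, hω, hn.1⟩
        have hdisj : Pairwise (Function.onFun Disjoint fun n => E ∩ moveBlock S ε n t) :=
          fun i j hij => (pairwise_disjoint_moveBlock (S := S) (ε := ε) t hij).mono
            inter_subset_right inter_subset_right
        rw [hEu, measure_iUnion hdisj fun n => F.le _ _ (hEn n),
          measure_iUnion hdisj fun n => F.le _ _ (hEn n)]
        refine ENNReal.tsum_le_tsum fun n => ?_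
        have hE' := F.le _ _ (hEn n)
        have hfarE : ∀ ω ∈ E ∩ moveBlock S ε n t, ω ∈ farEvent S S' ε η n t := by
          intro ω hω
          obtain ⟨n', hn'⟩ := mem_iUnion.1 (hEA hω.1)
          have : n' = n := by
            by_contra hne
            exact Set.disjoint_left.1 (pairwise_disjoint_moveBlock t hne) hn'.1 hω.2
          exact this ▸ hn'
        have hvar := h.integral_norm_sub_sq_le hε hcont hS'm hS' (hEn n) inter_subset_right
          (by linarith : η ≤ 2 * ε) hη0.le fun ω hω => (hfarE ω hω).2.2
        have hpt : ∀ ω ∈ E ∩ moveBlock S ε n t ∩ K k,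
            ε ≤ ‖S (moveTime S ε (n + 1) ω) ω - S' t ω‖ := by
          intro ω hω
          obtain ⟨hB, h1, h2⟩ := hfarE ω hω.1
          rw [mem_ofPred_eq, min_eq_left hB.1] at h1
          rw [mem_ofPred_eq] at h2
          have h3 := hω.2 n t hB (by linarith)
          have e : S t ω - S' t ω = (S t ω - S (moveTime S ε (n + 1) ω) ω) +
            (S (moveTime S ε (n + 1) ω) ω - S' t ω) := by abel
          have h4 := norm_add_le (S t ω - S (moveTime S ε (n + 1) ω) ω)
            (S (moveTime S ε (n + 1) ω) ω - S' t ω)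
          rw [← e] at h4
          linarith
        have hmeas : Measurable fun ω => S (moveTime S ε (n + 1) ω) ω - S' t ω :=
          (((h.isTime (n + 1)).measurable_stopped h.adapted fun ω t => (h.cadlag ω t).1).mono
            (h.isTime (n + 1)).measurableSpace_le le_rfl).sub ((hS'm t).mono (F.le t) le_rfl)
        have hmk : ENNReal.ofReal (ε ^ 2) * Q.restrict (K k) (E ∩ moveBlock S ε n t) ≤
            ENNReal.ofReal (4 * ε * η) * Q (E ∩ moveBlock S ε n t) := by
          refine le_trans ?_ hvar
          have h5 := mul_meas_ge_le_lintegral (μ := Q.restrict (E ∩ moveBlock S ε n t))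
            (hmeas.norm.pow_const 2).ennreal_ofReal (ENNReal.ofReal (ε ^ 2))
          refine le_trans (mul_le_mul_right ?_ _) h5
          rw [Measure.restrict_apply hE', Measure.restrict_apply
            (measurableSet_le measurable_const (hmeas.norm.pow_const 2).ennreal_ofReal)]
          refine measure_mono fun ω hω => ⟨?_, hω.1⟩
          exact ENNReal.ofReal_le_ofReal (pow_le_pow_left₀ hε.le (hpt ω hω) 2)
        have he2 : ENNReal.ofReal (ε ^ 2) ≠ 0 := by simpa using hε.ne'
        rw [Measure.smul_apply, smul_eq_mul]
        rw [← ENNReal.mul_le_mul_iff_right he2 ENNReal.ofReal_ne_top, ← mul_assoc,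
          ← ENNReal.ofReal_mul (by positivity)]
        convert hmk using 3
        field_simp)
    rw [Measure.restrict_apply (hUm η)] at hfe
    simpa using hfe
  have hZU : ∀ η, 0 < η → η ≤ ε →
      ∀ᵐ ω ∂Q, 2 * ε ≤ (⨆ t, ‖S t ω - S' t ω‖) → ω ∈ U η := by
    intro η hη hηε
    filter_upwards [h.ae_eq_top hS', ae_all_iff.2 fun m => ae_all_iff.2 fun j =>
      ae_all_iff.2 fun n => h.ae_lt_of_far hε hcont hS'm hS' hηε n (grid m j)] with ω htop hω hZ
    obtain ⟨m, j, hmj⟩ := ((h.cadlag ω).sub (hS'c ω)).exists_grid_lt monotone_id continuous_id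
      (show 2 * ε - η < _ from (by linarith : 2 * ε - η < 2 * ε).trans_le hZ)
    simp only [id] at hmj
    have hlt : grid (T := T) m j < ⊤ := by
      refine lt_top_iff_ne_top.2 fun he => ?_
      rw [he, htop, sub_self, norm_zero] at hmj
      linarith
    obtain ⟨n, hn⟩ := h.exists_mem_moveBlock hε hlt ω
    exact mem_iUnion.2 ⟨m, mem_iUnion.2 ⟨j, mem_iUnion.2 ⟨n, hω m j n hn hmj⟩⟩⟩
  have hnull : ∀ k, Q ({ω | 2 * ε ≤ ⨆ t, ‖S t ω - S' t ω‖} ∩ K k) = 0 := by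
    intro k
    have h1 : ∀ᶠ η in 𝓝[>] (0 : ℝ), Q ({ω | 2 * ε ≤ ⨆ t, ‖S t ω - S' t ω‖} ∩ K k) ≤
        ENNReal.ofReal (4 * η / ε) := by
      have hk : (0 : ℝ) < min (1 / ((k : ℝ) + 1)) (ε / 2) := lt_min (by positivity) (by positivity)
      filter_upwards [Ioc_mem_nhdsGT hk] with η hη
      have hη2 := hη.2.trans (min_le_right _ _)
      refine le_trans (measure_mono_ae ?_) (hUK k η hη.1 (hη.2.trans (min_le_left _ _)) hη2)
      filter_upwards [hZU η hη.1 (by linarith)] with ω hω hω'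
      exact ⟨hω hω'.1, hω'.2⟩
    have h2 : Tendsto (fun η : ℝ => ENNReal.ofReal (4 * η / ε)) (𝓝[>] 0) (𝓝 0) := by
      have h3 : Continuous fun η : ℝ => ENNReal.ofReal (4 * η / ε) :=
        ENNReal.continuous_ofReal.comp (by fun_prop)
      simpa using (h3.tendsto 0).mono_left (nhdsWithin_le_nhds (s := Ioi 0))
    exact le_antisymm (ge_of_tendsto h2 h1) zero_le
  have hall : ∀ᵐ ω ∂Q, ∀ k, ω ∉ {ω | 2 * ε ≤ ⨆ t, ‖S t ω - S' t ω‖} ∩ K k :=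
    ae_all_iff.2 fun k => measure_eq_zero_iff_ae_notMem.1 (hnull k)
  filter_upwards [hall, hcont] with ω hω hc
  by_contra! hge
  obtain ⟨k, hk⟩ := exists_forall_moveBlock_close hc (h.cadlag ω) hε
  exact hω k ⟨hge, hk⟩

end IsMoveMartingale

end ContinuousCase

/-! ### Assembling the measure and the martingale -/

section Assembly

variable {Ω : Type*} {mΩ : MeasurableSpace Ω} {P : Measure Ω} [IsProbabilityMeasure P] {T : ℝ}
  [hT : Fact ((0 : ℝ) ≤ T)] {d : ℕ} {F : Filtration (TimeInterval T) mΩ}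
  {S : TimeInterval T → Ω → Euc d} {ε : ℝ}

lemma UsualConditions.of_absolutelyContinuous {Q : Measure Ω} (hF : UsualConditions F P)
    (hPQ : P ≪ Q) : UsualConditions F Q :=
  ⟨hF.rightContinuous, fun N hN => hF.complete N (hPQ hN)⟩

/-- The σ-algebras at the move times. -/
noncomputable def moveFiltration (hτ : ∀ n, IsTime F (moveTime S ε n)) : Filtration ℕ mΩ where
  seq n := (hτ n).measurableSpace
  mono' _ _ hnm := IsStoppingTime.measurableSpace_mono _ _ fun ω =>
    WithTop.coe_le_coe.2 (moveTime_mono S ε ω hnm)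
  le' n := (hτ n).measurableSpace_le

lemma measurable_moveStep (hS : Adapted F S) (hc : ∀ ω, IsCadlagPath fun t => S t ω)
    (hτ : ∀ n, IsTime F (moveTime S ε n)) (n : ℕ) :
    Measurable[moveFiltration hτ (n + 1)] (moveStep S ε n) := by
  have hm : ∀ n, Measurable[moveFiltration hτ n] fun ω => S (moveTime S ε n ω) ω :=
    fun n => (hτ n).measurable_stopped hS fun ω t => (hc ω t).1
  exact (hm (n + 1)).sub ((hm n).mono ((moveFiltration hτ).mono n.le_succ) le_rfl)

lemma IsTime.measurableSet_eq_top {τ : Ω → TimeInterval T} (hτ : IsTime F τ) :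
    MeasurableSet[hτ.measurableSpace] {ω | τ ω = ⊤} := by
  refine hτ.measurableSet_iff.2 fun i => ?_
  rcases (le_top : i ≤ ⊤).eq_or_lt with rfl | hi
  · have h1 : MeasurableSet[F ⊤] {ω | τ ω = ⊤} := by
      have h2 := hτ.measurable_min ⊤ (measurableSet_singleton ⊤)
      have e : (fun ω => min (τ ω) ⊤) ⁻¹' {⊤} = {ω | τ ω = ⊤} := by ext ω; simp
      rwa [e] at h2
    exact h1.inter (hτ.le ⊤)
  · have : {ω | τ ω = ⊤} ∩ {ω | τ ω ≤ i} = ∅ := by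
      ext ω
      simp only [mem_inter_iff, mem_ofPred_eq, mem_empty_iff_false, iff_false, not_and, not_le]
      intro h; rw [h]; exact hi
    rw [this]; exact @MeasurableSet.empty _ (F i)

/-- Stickiness: at each move time, the process has a positive conditional probability of staying
within any given distance up to time `T`, so that the next step is small and ends at `T`. -/
lemma IsSticky.ae_pos_condExp (hS : Adapted F S) (hc : ∀ ω, IsCadlagPath fun t => S t ω)
    (hst : IsSticky P F S) (hε : 0 < ε) (hτ : ∀ n, IsTime F (moveTime S ε n)) (n : ℕ) {κ : ℝ}
    (hκ : 0 < κ) :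
    ∀ᵐ ω ∂P, 0 < (P⟦{ω | moveTime S ε (n + 1) ω = ⊤} ∩ {ω | ‖moveStep S ε n ω‖ < κ} |
      moveFiltration hτ n⟧) ω := by
  have h := hst (moveTime S ε n) (hτ n) (fun _ => min κ ε)
    (@measurable_const _ _ _ (hτ n).measurableSpace _) (fun _ => lt_min hκ hε)
  set B : Set Ω := {ω' | (⨆ u : Set.Ici (moveTime S ε n ω'),
    ‖S u ω' - S (moveTime S ε n ω') ω'‖) < min κ ε} with hB
  set C : Set Ω := {ω | moveTime S ε (n + 1) ω = ⊤} ∩ {ω | ‖moveStep S ε n ω‖ < κ} with hC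
  have hBC : B ⊆ C := by
    intro ω hω
    have hbdd : BddAbove (range fun u : Set.Ici (moveTime S ε n ω) =>
        ‖S u ω - S (moveTime S ε n ω) ω‖) := by
      obtain ⟨c, hc'⟩ := (hc ω).exists_norm_le
      refine ⟨c + c, ?_⟩
      rintro _ ⟨u, rfl⟩
      exact (norm_sub_le _ _).trans (add_le_add (hc' _) (hc' _))
    have hlt : ∀ u, moveTime S ε n ω ≤ u →
        ‖S u ω - S (moveTime S ε n ω) ω‖ < min κ ε := fun u hu =>
      (le_ciSup hbdd ⟨u, hu⟩).trans_lt hω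
    refine ⟨nextMove_eq_top (f := fun t => S t ω) fun u hu =>
      (hlt u hu).trans_le (min_le_right _ _), ?_⟩
    exact (hlt _ (moveTime_mono S ε ω n.le_succ)).trans_le (min_le_left _ _)
  have hCm : MeasurableSet C :=
    ((hτ (n + 1)).measurableSpace_le _ (hτ (n + 1)).measurableSet_eq_top).inter
      (measurableSet_lt ((measurable_moveStep hS hc hτ n).mono ((moveFiltration hτ).le _)
        le_rfl).norm measurable_const)
  -- the event `B` need not be measurable a priori; if it were not, its conditional probability
  -- would be the junk value `0`, against stickiness
  by_cases hi : Integrable (B.indicator fun _ => (1 : ℝ)) P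
  · have hmono := condExp_mono (m := moveFiltration hτ n) hi
      ((integrable_const (1 : ℝ)).indicator hCm)
      (ae_of_all P fun ω => indicator_le_indicator_of_subset hBC (fun _ => zero_le_one) ω)
    filter_upwards [h, hmono] with ω h1 h2
    exact lt_of_lt_of_le h1 h2
  · filter_upwards [h] with ω h1
    rw [condExp_of_not_integrable hi] at h1
    exact absurd h1 (lt_irrefl _)

lemma martingale_of_condExp {Q : Measure Ω} [IsFiniteMeasure Q] {X : Ω → Euc d}
    {S' : TimeInterval T → Ω → Euc d} (hm : ∀ t, Measurable[F t] (S' t))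
    (hS' : ∀ t, S' t =ᵐ[Q] Q[X|F t]) : Martingale S' F Q := by
  refine ⟨fun t => (hm t).stronglyMeasurable, fun s t hst => ?_⟩
  exact (condExp_congr_ae (hS' t)).trans
    ((condExp_condExp_of_le (F.mono hst) (F.le t)).trans (hS' s).symm)

/-- The measure change for the sampled process. The weight `W` controls the square of the step and
of the excess of the gauge over `G (2 * ε)`; both are dominated by one small square-integrable `R`,
since the irregular steps have geometrically small `W`-mass. -/
lemma exists_isMoveMartingale (hF : UsualConditions F P)
    (hS : Adapted F S) (hc : ∀ ω, IsCadlagPath fun t => S t ω) (hst : IsSticky P F S) (hε : 0 < ε)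
    (h0 : ∀ (n : ℕ) (hτ : IsTime F (moveTime S ε n)),
      ∀ᵐ ω ∂P, (0 : Euc d) ∈ relintHullSupport (condLaw P hτ.measurableSpace (moveStep S ε n) ω))
    {G : ℝ → ℝ} (hGc : Continuous G) (hGm : Monotone G) {θ : ℝ} (hθ : 0 < θ) :
    ∃ Q : Measure Ω, IsProbabilityMeasure Q ∧ Q ≪ P ∧ P ≪ Q ∧ IsMoveMartingale F Q S ε ∧
      ∃ R : Ω → ℝ, MemLp R 2 Q ∧ (∀ ω, 0 ≤ R ω) ∧ ∫ ω, R ω ^ 2 ∂Q ≤ θ ∧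
        ∀ᵐ ω ∂Q, ∀ n, G (ε + ‖moveStep S ε n ω‖) ≤ G (2 * ε) + R ω := by
  have hτ : ∀ n, IsTime F (moveTime S ε n) := hF.isTime_moveTime hS hc hε
  set H : Euc d → ℝ := fun y => G (ε + max ‖y‖ ε) - G (2 * ε) with hH
  have hHm : Measurable H := by fun_prop
  have hH0 : ∀ y, 0 ≤ H y := fun y => sub_nonneg.2 (hGm (by linarith [le_max_right ‖y‖ ε]))
  set W : Euc d → ℝ := fun y => 1 + ‖y‖ ^ 2 + H y ^ 2 with hW
  have hWm : Measurable W := by fun_prop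
  have hYm := measurable_moveStep hS hc hτ
  obtain ⟨Q, hQ, hQP, hPQ, hX₀, hbad, hmart⟩ := exists_equivalent_martingale_measure P
    (moveFiltration hτ) (Y := moveStep S ε) hYm
    (A := fun n => {ω | moveTime S ε n ω = ⊤}) (fun n => (hτ n).measurableSet_eq_top)
    (fun n m hnm ω hω => top_le_iff.1 ((show moveTime S ε n ω = ⊤ from hω) ▸
      moveTime_mono S ε ω hnm))
    (by
      ext ω
      simpa using exists_moveTime_eq_top (hc ω) hε)
    (fun n ω hω => by
      have h1 : moveTime S ε n ω = ⊤ := hω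
      have h2 : moveTime S ε (n + 1) ω = ⊤ := top_le_iff.1 (h1 ▸ moveTime_mono S ε ω n.le_succ)
      rw [moveStep, h1, h2, sub_self])
    (fun n => h0 n (hτ n))
    (fun n κ hκ => hst.ae_pos_condExp hS hc hε hτ n hκ)
    (X₀ := fun ω => ‖S ⊥ ω‖)
    (measurable_norm.comp ((hS ⊥).mono (IsStoppingTime.le_measurableSpace_of_const_le (hτ 0)
      fun ω => WithTop.coe_le_coe.2 bot_le) le_rfl))
    hWm (fun y => by simp only [hW]; nlinarith [sq_nonneg ‖y‖, sq_nonneg (H y)]) hε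
    (δ := fun n => θ / 2 * (1 / 8) ^ n) (fun n => by positivity)
    (by simpa using (tendsto_pow_atTop_nhds_zero_of_lt_one (r := (1 / 8 : ℝ)) (by norm_num)
      (by norm_num)).const_mul (θ / 2))
  have hregm : ∀ n, MeasurableSet (regularStep S ε n)ᶜ := fun n =>
    (((hτ (n + 1)).measurableSpace_le _ (hτ (n + 1)).measurableSet_eq_top).inter
      (measurableSet_lt ((hYm n).mono ((moveFiltration hτ).le _) le_rfl).norm
        measurable_const)).compl
  obtain ⟨R, hRm, hR0, hR2, hRθ, hR⟩ := exists_dominating_memLp (Q := Q)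
    (q := fun n => (regularStep S ε n)ᶜ.indicator fun ω => ENNReal.ofReal (W (moveStep S ε n ω)))
    (fun n => ((hWm.comp ((hYm n).mono ((moveFiltration hτ).le _)
      le_rfl)).ennreal_ofReal).indicator (hregm n)) hθ.le
    (fun n => by rw [lintegral_indicator (hregm n)]; exact hbad n)
  have hRW : ∀ᵐ ω ∂Q, ∀ n, ω ∉ regularStep S ε n →
      W (moveStep S ε n ω) ≤ ((1 / 2) ^ n * R ω) ^ 2 := by
    filter_upwards [hR] with ω hω n hn
    have h1 := hω n
    rw [indicator_of_mem (show ω ∈ (regularStep S ε n)ᶜ from hn),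
      ENNReal.ofReal_le_ofReal_iff (by positivity)] at h1
    refine h1.trans (le_of_eq ?_)
    rw [mul_pow, ← pow_mul, mul_comm n 2, pow_mul]; norm_num
  refine ⟨Q, hQ, hQP, hPQ, ?_, R, hR2, hR0, hRθ, ?_⟩
  · have hS0 : MemLp (fun ω => ‖S ⊥ ω‖) 2 Q := by
      have hm : Measurable fun ω => ‖S ⊥ ω‖ := ((hS ⊥).mono (F.le _) le_rfl).norm
      exact (memLp_two_iff_integrable_sq hm.aestronglyMeasurable).2
        ((lintegral_ofReal_ne_top_iff_integrable (hm.pow_const 2).aestronglyMeasurable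
          (ae_of_all _ fun ω => by positivity)).1 hX₀.ne)
    refine isMoveMartingale_of_dominated hε hS hc hτ hmart
      (K := fun ω => ‖S ⊥ ω‖ + ε + 2 * R ω)
      ((hS0.add (memLp_const ε)).add (hR2.const_mul 2)) ?_
    filter_upwards [hRW] with ω hω m
    refine norm_moveTime_le hε (hR0 ω) (fun n hn => ?_) m
    refine abs_le_of_sq_le_sq' ?_ (by have := hR0 ω; positivity) |>.2
    refine le_trans ?_ (hω n hn)
    simp only [hW]; nlinarith [sq_nonneg (H (moveStep S ε n ω))]
  · filter_upwards [hRW] with ω hω n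
    by_cases hn : ω ∈ regularStep S ε n
    · have h1 : ‖moveStep S ε n ω‖ < ε := hn.2
      have h2 := hGm (show ε + ‖moveStep S ε n ω‖ ≤ 2 * ε by linarith)
      linarith [hR0 ω]
    · have h1 : H (moveStep S ε n ω) ≤ (1 / 2) ^ n * R ω := by
        refine abs_le_of_sq_le_sq' ?_ (by have := hR0 ω; positivity) |>.2
        refine le_trans ?_ (hω n hn)
        simp only [hW]; nlinarith [sq_nonneg ‖moveStep S ε n ω‖]
      have h2 : (1 / 2 : ℝ) ^ n * R ω ≤ R ω :=
        mul_le_of_le_one_left (hR0 ω) (pow_le_one₀ (by norm_num) (by norm_num))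
      have h3 := hGm (add_le_add_right (le_max_left ‖moveStep S ε n ω‖ ε) ε)
      simp only [hH] at h1
      linarith

/-- The approximating martingale, for a process all of whose paths are càdlàg. -/
lemma exists_approximating_martingale (hF : UsualConditions F P)
    (hS : Adapted F S) (hc : ∀ ω, IsCadlagPath fun t => S t ω) (hst : IsSticky P F S)
    {g : ℝ → ℝ} (hg_convex : ConvexOn ℝ (Ici 0) g) (hg_nonneg : ∀ x, 0 ≤ x → 0 ≤ g x)
    (hg_zero : g 0 = 0) (hε : 0 < ε)
    (h0 : ∀ (n : ℕ) (hτ : IsTime F (moveTime S ε n)),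
      ∀ᵐ ω ∂P, (0 : Euc d) ∈
        relintHullSupport (condLaw P hτ.measurableSpace (moveStep S ε n) ω)) :
    ∃ Q : Measure Ω, IsProbabilityMeasure Q ∧ Q ≪ P ∧ P ≪ Q ∧
      ∃ S' : TimeInterval T → Ω → Euc d,
        Martingale S' F Q ∧
        (∀ ω, IsCadlagPath (fun t => S' t ω)) ∧
        S' ⊥ =ᵐ[P] S ⊥ ∧
        S' ⊤ =ᵐ[P] S ⊤ ∧
        Integrable (fun ω => g (⨆ t, ‖S t ω - S' t ω‖)) Q ∧
        ∫ ω, g (⨆ t, ‖S t ω - S' t ω‖) ∂Q < g (2 * ε) + 2 * √ε ∧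
        ((∀ᵐ ω ∂P, Continuous (fun t => S t ω)) →
          ∀ᵐ ω ∂P, (⨆ t, ‖S t ω - S' t ω‖) < 2 * ε) ∧
        ((∀ᵐ ω ∂P, ∀ t i, 0 < S t ω i) → ∀ᵐ ω ∂P, ∀ t i, 0 < S' t ω i) ∧
        ((∀ᵐ ω ∂P, ∀ t i, 0 ≤ S t ω i) → ∀ᵐ ω ∂P, ∀ t i, 0 ≤ S' t ω i) := by
  have hgm := hg_convex.monotoneOn_of_nonneg_of_zero hg_nonneg hg_zero
  obtain ⟨Q, hQ, hQP, hPQ, hmove, R, hR2, hR0, hRε, hR⟩ := exists_isMoveMartingale hF hS hc hst hε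
    h0 (continuous_extendGauge hg_convex hgm) (monotone_extendGauge hgm)
    (show 0 < ε / 16 by positivity)
  have hFQ := hF.of_absolutelyContinuous hPQ
  obtain ⟨S', hS'c, hS'm, hS'⟩ := exists_cadlag_martingale hFQ hmove.memLp
  have hSi : Integrable (S ⊤) Q := hmove.memLp.integrable (by norm_num)
  have hgauge := hmove.integral_gauge_lt hε hS'm hS' hS'c (convexOn_extendGauge hg_convex hgm)
    (continuous_extendGauge hg_convex hgm) (monotone_extendGauge hgm)
    (fun x hx => by rw [extendGauge_of_nonneg hx]; exact hg_nonneg x hx) hR2 hR0 hRε hR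
  have hsup : ∀ ω, extendGauge g (⨆ t, ‖S t ω - S' t ω‖) = g (⨆ t, ‖S t ω - S' t ω‖) := fun ω =>
    extendGauge_of_nonneg ((hc ω).sub (hS'c ω)).iSup_norm_nonneg
  simp only [hsup, extendGauge_of_nonneg (show (0 : ℝ) ≤ 2 * ε by positivity)] at hgauge
  have hcomp : ∀ i t, (fun ω => S' t ω i) =ᵐ[Q] Q[fun ω => S ⊤ ω i|F t] := fun i t => by
    have h1 : (fun ω => (Q[S ⊤|F t]) ω i) =ᵐ[Q] Q[fun ω => S ⊤ ω i|F t] :=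
      (EuclideanSpace.proj (𝕜 := ℝ) i).comp_condExp_comm hSi
    filter_upwards [hS' t, h1] with ω h2 h3
    rw [h2, ← h3]
  have hci : ∀ (i : Fin d) ω t, ContinuousWithinAt (fun t => S' t ω i) (Ici t) t := fun i ω t =>
    (EuclideanSpace.proj (𝕜 := ℝ) i).continuous.continuousAt.comp_continuousWithinAt (hS'c ω t).1
  refine ⟨Q, hQ, hQP, hPQ, S', martingale_of_condExp hS'm hS', hS'c, hPQ.ae_le ?_,
    hPQ.ae_le (hmove.ae_eq_top hS'), hgauge.1, hgauge.2, fun hcont => ?_, fun hpos => ?_,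
    fun hnn => ?_⟩
  · have h1 : (hmove.isTime 0).measurableSpace = F ⊥ := IsStoppingTime.measurableSpace_const F ⊥
    have h2 := hmove.condExp_moveTime 0
    rw [h1] at h2
    exact (hS' ⊥).trans h2.symm
  · exact hPQ.ae_le (hmove.ae_iSup_lt hε (hQP.ae_le hcont) hS'm hS' hS'c)
  · have h1 : ∀ i, ∀ᵐ ω ∂Q, ∀ t, 0 < S' t ω i := fun i =>
      ae_forall_pos_of_terminal_pos (N := fun t ω => S' t ω i) (X := fun ω => S ⊤ ω i)
        ((EuclideanSpace.proj (𝕜 := ℝ) i).integrable_comp hSi)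
        (hQP.ae_le (hpos.mono fun ω h => h ⊤ i))
        (fun t => (by fun_prop : Measurable fun y : Euc d => y i).comp (hS'm t))
        (hcomp i) (hci i)
    exact hPQ.ae_le ((ae_all_iff.2 h1).mono fun ω h t i => h i t)
  · have h1 : ∀ i, ∀ᵐ ω ∂Q, ∀ t, 0 ≤ S' t ω i := fun i =>
      ae_forall_nonneg_of_terminal_nonneg (N := fun t ω => S' t ω i) (X := fun ω => S ⊤ ω i)
        (hQP.ae_le (hnn.mono fun ω h => h ⊤ i)) (hcomp i) (hci i)
    exact hPQ.ae_le ((ae_all_iff.2 h1).mono fun ω h t i => h i t)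

end Assembly

/-! ### Removing a null set of paths -/

section Modification

variable {Ω : Type*} {mΩ : MeasurableSpace Ω} {P : Measure Ω} [IsProbabilityMeasure P] {T : ℝ}
  [hT : Fact ((0 : ℝ) ≤ T)] {d : ℕ} {F : Filtration (TimeInterval T) mΩ}
  {S S₁ : TimeInterval T → Ω → Euc d} {ε : ℝ}

lemma moveTime_congr {ω : Ω} (h : ∀ t, S t ω = S₁ t ω) (n : ℕ) :
    moveTime S ε n ω = moveTime S₁ ε n ω := by
  induction n with
  | zero => rfl
  | succ n ih =>
    have : (fun t => S t ω) = fun t => S₁ t ω := funext h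
    rw [moveTime_succ, moveTime_succ, ih, this]

lemma moveStep_congr {ω : Ω} (h : ∀ t, S t ω = S₁ t ω) (n : ℕ) :
    moveStep S ε n ω = moveStep S₁ ε n ω := by
  rw [moveStep, moveStep, moveTime_congr h, moveTime_congr h, h, h]

lemma IsSticky.congr (hst : IsSticky P F S) (h : ∀ᵐ ω ∂P, ∀ t, S t ω = S₁ t ω) :
    IsSticky P F S₁ := by
  intro τ hτ κ hκ hκ0
  have h1 := hst τ hτ κ hκ hκ0
  have h2 : ({ω' | (⨆ u : Set.Ici (τ ω'), ‖S u ω' - S (τ ω') ω'‖) < κ ω'}.indicator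
      fun _ => (1 : ℝ)) =ᵐ[P] {ω' | (⨆ u : Set.Ici (τ ω'), ‖S₁ u ω' - S₁ (τ ω') ω'‖) <
        κ ω'}.indicator fun _ => (1 : ℝ) := by
    filter_upwards [h] with ω hω
    simp only [indicator, mem_ofPred_eq, hω]
  filter_upwards [h1, condExp_congr_ae (m := hτ.measurableSpace) h2] with ω h3 h4
  rw [← h4]
  exact h3

lemma condLaw_congr (m : MeasurableSpace Ω) {Y Y₁ : Ω → Euc d} (h : Y =ᵐ[P] Y₁) :
    condLaw P m Y = condLaw P m Y₁ := by
  funext ω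
  rw [condLaw, condLaw]
  rw [condDistrib_congr_left (mβ := m) (X := (id : Ω → Ω)) h]

end Modification

/-- The hypothesis `h0` is required for the σ-algebra `F_{τ_n}` of the stopping time `τ_n`; the binder
`hτ` only names this σ-algebra (the `τ_n` are stopping times by the usual conditions, so that `h0`
is not void). -/
theorem proposition4p4 {Ω : Type*} {mΩ : MeasurableSpace Ω} (P : Measure Ω)
    [IsProbabilityMeasure P] (T : ℝ) [Fact ((0 : ℝ) ≤ T)] (d : ℕ)
    (F : Filtration (TimeInterval T) mΩ) (hF : UsualConditions F P)
    (S : TimeInterval T → Ω → Euc d) (hS_adapted : Adapted F S)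
    (hS_cadlag : ∀ᵐ ω ∂P, IsCadlagPath (fun t => S t ω))
    (hS_sticky : IsSticky P F S)
    (g : ℝ → ℝ) (hg_convex : ConvexOn ℝ (Ici 0) g) (hg_nonneg : ∀ x, 0 ≤ x → 0 ≤ g x)
    (hg_zero : g 0 = 0)
    (ε : ℝ) (hε : 0 < ε)
    (h0 : ∀ (n : ℕ)
      (hτ : IsStoppingTime F (fun ω => (moveTime S ε n ω : WithTop (TimeInterval T)))),
      ∀ᵐ ω ∂P, (0 : Euc d) ∈ relintHullSupport (condLaw P hτ.measurableSpace
        (fun ω' => S (moveTime S ε (n + 1) ω') ω' - S (moveTime S ε n ω') ω') ω)) :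
    (∃ Q : Measure Ω, IsProbabilityMeasure Q ∧ Q ≪ P ∧ P ≪ Q ∧
      ∃ S' : TimeInterval T → Ω → Euc d,
        Martingale S' F Q ∧
        (∀ᵐ ω ∂P, IsCadlagPath (fun t => S' t ω)) ∧
        S' ⊥ =ᵐ[P] S ⊥ ∧
        S' ⊤ =ᵐ[P] S ⊤ ∧
        Integrable (fun ω => g (⨆ t, ‖S t ω - S' t ω‖)) Q ∧
        ∫ ω, g (⨆ t, ‖S t ω - S' t ω‖) ∂Q < g (2 * ε) + 2 * √ε ∧
        ((∀ᵐ ω ∂P, Continuous (fun t => S t ω)) →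
          ∀ᵐ ω ∂P, (⨆ t, ‖S t ω - S' t ω‖) < 2 * ε) ∧
        ((∀ᵐ ω ∂P, ∀ t i, 0 < S t ω i) → ∀ᵐ ω ∂P, ∀ t i, 0 < S' t ω i) ∧
        ((∀ᵐ ω ∂P, ∀ t i, 0 ≤ S t ω i) → ∀ᵐ ω ∂P, ∀ t i, 0 ≤ S' t ω i)) ∧
    Tendsto (fun δ : ℝ => g (2 * δ) + 2 * √δ) (𝓝[>] 0) (𝓝 0) := by
  classical
  have hgm := hg_convex.monotoneOn_of_nonneg_of_zero hg_nonneg hg_zero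
  refine ⟨?_, tendsto_gauge_add_sqrt hg_convex hgm hg_zero⟩
  -- a modification all of whose paths are càdlàg
  set good : Set Ω := {ω | IsCadlagPath fun t => S t ω} with hgood
  have hgoodm : ∀ t, MeasurableSet[F t] good := fun t =>
    hF.measurableSet_congr (@MeasurableSet.univ _ (F t)) (by
      filter_upwards [hS_cadlag] with ω hω
      exact ⟨fun _ => hω, fun _ => mem_univ _⟩)
  set S₁ : TimeInterval T → Ω → Euc d := fun t => good.indicator (S t) with hS₁
  have hS₁_adapted : Adapted F S₁ := fun t => (hS_adapted t).indicator (hgoodm t)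
  have hS₁_cadlag : ∀ ω, IsCadlagPath fun t => S₁ t ω := fun ω => by
    by_cases hω : ω ∈ good
    · simp only [hS₁, indicator_of_mem hω]
      exact hω
    · simp only [hS₁, indicator_of_notMem hω]
      exact fun t => ⟨continuousWithinAt_const, 0, tendsto_const_nhds⟩
  have heq : ∀ᵐ ω ∂P, ∀ t, S t ω = S₁ t ω := by
    filter_upwards [hS_cadlag] with ω hω t
    exact (indicator_of_mem (show ω ∈ good from hω) _).symm
  have hsticky₁ := hS_sticky.congr heq
  have h0₁ : ∀ (n : ℕ) (hτ : IsTime F (moveTime S₁ ε n)),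
      ∀ᵐ ω ∂P, (0 : Euc d) ∈
        relintHullSupport (condLaw P hτ.measurableSpace (moveStep S₁ ε n) ω) := by
    intro n hτ₁
    have hae : moveTime S₁ ε n =ᵐ[P] moveTime S ε n :=
      heq.mono fun ω h => (moveTime_congr h n).symm
    have hτ := hF.isTime_congr hτ₁ hae
    have hstep : moveStep S₁ ε n =ᵐ[P] moveStep S ε n :=
      heq.mono fun ω h => (moveStep_congr h n).symm
    rw [hF.measurableSpace_congr hτ₁ hτ hae, condLaw_congr _ hstep]
    exact h0 n hτ
  obtain ⟨Q, hQ, hQP, hPQ, S', hmart, hc', hbot, htop, hint, hlt, hcont, hpos, hnn⟩ :=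
    exists_approximating_martingale hF hS₁_adapted hS₁_cadlag hsticky₁ hg_convex hg_nonneg hg_zero
      hε h0₁
  have hsup : ∀ᵐ ω ∂P, (⨆ t, ‖S₁ t ω - S' t ω‖) = ⨆ t, ‖S t ω - S' t ω‖ := by
    filter_upwards [heq] with ω hω
    simp only [hω]
  have hg : (fun ω => g (⨆ t, ‖S₁ t ω - S' t ω‖)) =ᵐ[Q] fun ω => g (⨆ t, ‖S t ω - S' t ω‖) :=
    hQP.ae_le (hsup.mono fun ω h => congrArg g h)
  refine ⟨Q, hQ, hQP, hPQ, S', hmart, ae_of_all _ hc', ?_, ?_, hint.congr hg, ?_, fun h => ?_,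
    fun h => hpos ?_, fun h => hnn ?_⟩
  · filter_upwards [hbot, heq] with ω h1 h2
    rw [h1, h2]
  · filter_upwards [htop, heq] with ω h1 h2
    rw [h1, h2]
  · rw [← integral_congr_ae hg]; exact hlt
  · have h1 : ∀ᵐ ω ∂P, Continuous fun t => S₁ t ω := by
      filter_upwards [h, heq] with ω h1 h2
      simpa only [h2] using h1
    filter_upwards [hcont h1, hsup] with ω h2 h3
    rw [← h3]; exact h2
  · filter_upwards [h, heq] with ω h1 h2 t i
    rw [← h2]; exact h1 t i
  · filter_upwards [h, heq] with ω h1 h2 t i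
    rw [← h2]; exact h1 t i
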